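/- Let $G$ be a finite tree with $p\ge 2$ vertices, each edge being identified, with an arbitrary orientation, with the interval $[0,\ell]$, $\ell>0$, and let $b_v\in\mathbb R$ for every vertex $v$. Consider the Robin problem with zero potential $$-y_e''=\lambda y_e\ \text{ on }[0,\ell]\quad\text{for every edge } e,$$ where at every vertex $v$ the functions $y_e$ on the edges meeting at $v$ take a common value $y(v)$ (continuity), and $$\sum_{e\ \text{incoming to } v} y_e'(\ell)+b_v\,y(v)=\sum_{e\ \text{outgoing from } v} y_e'(0).$$ Its spectrum is the set of $\lambda\in\mathbb C$ for which there is a nonzero solution, and the multiplicity of $\lambda$ is the dimension of the space of solutions. Let $D$ be the diagonal matrix of vertex degrees, $A$ the adjacency matrix of $G$, and $\psi(z)=\det(-zD+A)$. The polynomial $\psi$ has $p$ real zeros counted with multiplicity, namely the simple zeros $\pm1$ and $z_2,\dots,z_{p-1}\in(-1,1)$ (repeated according to multiplicity). The spectrum of the Robin problem is real, and it is, with eigenvalues counted with multiplicity, the union of the $2p-3$ sequences $$\{\lambda_k^{(1)}\}_{k=0}^\infty,\qquad \{\lambda_k^{(l)}\}_{k=0}^\infty,\qquad \{\lambda_k^{(-l)}\}_{k=1}^\infty,\qquad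 l=2,\dots,p-1,$$ which satisfy, as $k\to\infty$, $$\sqrt{\lambda_k^{(1)}}=\frac{\pi k}{\ell}+o(1),\qquad \sqrt{\lambda_k^{(\pm l)}}=\frac{\pm\arccos z_l+2\pi k}{\ell}+o(1),\quad l=2,\dots,p-1.$$ -/

import Mathlib

open Set Filter Topology Polynomial

/-- An orientation of the edges of a simple graph: every edge `e` gets an initial vertex `src e`
(the point `x = 0` of the edge) and a terminal vertex `tgt e` (the point `x = ℓ`), which are its
two end points. -/
structure EdgeOrientation {V : Type*} (G : SimpleGraph V) where
  src : G.edgeSet → V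
  tgt : G.edgeSet → V
  mk_eq : ∀ e : G.edgeSet, s(src e, tgt e) = (e : Sym2 V)

noncomputable section

/-- The polynomial `ψ(z) = det (-z D + A)`, where `D` is the diagonal degree matrix and `A` the
adjacency matrix of `G`. -/
def psiPoly {V : Type*} [Fintype V] [DecidableEq V] (G : SimpleGraph V) [DecidableRel G.Adj] :
    ℝ[X] :=
  Matrix.det (-((X : ℝ[X]) • G.degMatrix ℝ[X]) + G.adjMatrix ℝ[X])

/-- The first derivative of a function on the edge `[0, ℓ]` (one-sided at the end points). -/
def edgeDeriv (ℓ : ℝ) (f : ℝ → ℂ) : ℝ → ℂ := derivWithin f (Icc 0 ℓ)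

/-- `y` solves the Robin problem with zero potential and spectral parameter `μ` on the equilateral
graph `G` with edge length `ℓ` and Robin coefficients `b`. A function on the edge `[0, ℓ]` is
represented by its extension by zero to the real line. -/
structure IsRobinSolution {V : Type*} [Fintype V] [DecidableEq V] (G : SimpleGraph V)
    [DecidableRel G.Adj] (o : EdgeOrientation G) (ℓ : ℝ) (b : V → ℝ) (μ : ℂ)
    (y : G.edgeSet → ℝ → ℂ) : Prop where
  eq_zero_off : ∀ e, ∀ x ∉ Icc 0 ℓ, y e x = 0
  contDiffOn : ∀ e, ContDiffOn ℝ 2 (y e) (Icc 0 ℓ)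
  /-- `-y'' = μ y` on every edge. -/
  equation : ∀ e, ∀ x ∈ Icc 0 ℓ, -edgeDeriv ℓ (edgeDeriv ℓ (y e)) x = μ * y e x
  /-- Continuity: all edges meeting at `v` have there the same end value `u v`.
  Robin-Kirchhoff condition: at each vertex `v`, with the incoming edges on the left and the
  outgoing edges on the right, `∑ y'(ℓ) + b v * u v = ∑ y'(0)`. At a vertex of degree one this is
  `y'(ℓ) + b v * y ℓ = 0` or `-y'(0) + b v * y 0 = 0`. -/
  vertex : ∃ u : V → ℂ,
    (∀ e, y e 0 = u (o.src e)) ∧ (∀ e, y e ℓ = u (o.tgt e)) ∧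
    ∀ v, (∑ e : G.edgeSet, if o.tgt e = v then edgeDeriv ℓ (y e) ℓ else 0) + (b v : ℂ) * u v
      = ∑ e : G.edgeSet, if o.src e = v then edgeDeriv ℓ (y e) 0 else 0

theorem edgeDeriv_add {ℓ x : ℝ} {f g : ℝ → ℂ} (hf : DifferentiableOn ℝ f (Icc 0 ℓ))
    (hg : DifferentiableOn ℝ g (Icc 0 ℓ)) (hx : x ∈ Icc 0 ℓ) :
    edgeDeriv ℓ (f + g) x = edgeDeriv ℓ f x + edgeDeriv ℓ g x :=
  derivWithin_add (hf x hx) (hg x hx)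

theorem edgeDeriv_smul (ℓ x : ℝ) (c : ℂ) (f : ℝ → ℂ) :
    edgeDeriv ℓ (c • f) x = c * edgeDeriv ℓ f x := by
  rw [← smul_eq_mul]
  exact derivWithin_const_smul_field c f

theorem edgeDeriv_congr {ℓ x : ℝ} {f g : ℝ → ℂ} (h : EqOn f g (Icc 0 ℓ)) (hx : x ∈ Icc 0 ℓ) :
    edgeDeriv ℓ f x = edgeDeriv ℓ g x :=
  derivWithin_congr h (h hx)

theorem differentiableOn_edgeDeriv {ℓ : ℝ} (hℓ : 0 < ℓ) {f : ℝ → ℂ}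
    (hf : ContDiffOn ℝ 2 f (Icc 0 ℓ)) : DifferentiableOn ℝ (edgeDeriv ℓ f) (Icc 0 ℓ) := by
  have h : ContDiffOn ℝ 1 (derivWithin f (Icc 0 ℓ)) (Icc 0 ℓ) :=
    hf.derivWithin (uniqueDiffOn_Icc hℓ) (by norm_num)
  exact h.differentiableOn (by norm_num)

/-- The space of all solutions of the Robin problem with spectral parameter `μ`. -/
def robinEigenspace {V : Type*} [Fintype V] [DecidableEq V] (G : SimpleGraph V)
    [DecidableRel G.Adj] (o : EdgeOrientation G) {ℓ : ℝ} (hℓ : 0 < ℓ) (b : V → ℝ) (μ : ℂ) :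
    Submodule ℂ (G.edgeSet → ℝ → ℂ) where
  carrier := {y | IsRobinSolution G o ℓ b μ y}
  zero_mem' := by
    have h0 : edgeDeriv ℓ (0 : ℝ → ℂ) = 0 := by
      funext x
      exact congrFun (derivWithin_const (Icc 0 ℓ) (0 : ℂ)) x
    refine ⟨fun _ _ _ => rfl, fun _ => contDiffOn_const, fun e x _ => ?_, 0, ?_, ?_, ?_⟩
    · simp [h0]
    · simp
    · simp
    · simp [h0]
  add_mem' := by
    rintro y w ⟨hy0, hy1, hy2, u, hu0, hu1, hu2⟩ ⟨hw0, hw1, hw2, t, ht0, ht1, ht2⟩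
    have dy := fun e => (hy1 e).differentiableOn (by norm_num)
    have dw := fun e => (hw1 e).differentiableOn (by norm_num)
    have l0 : (0 : ℝ) ∈ Icc 0 ℓ := ⟨le_rfl, hℓ.le⟩
    have l1 : ℓ ∈ Icc 0 ℓ := ⟨hℓ.le, le_rfl⟩
    have d1 : ∀ e, ∀ x ∈ Icc 0 ℓ, edgeDeriv ℓ ((y + w) e) x
        = edgeDeriv ℓ (y e) x + edgeDeriv ℓ (w e) x :=
      fun e x hx => edgeDeriv_add (dy e) (dw e) hx
    refine ⟨fun e x hx => ?_, fun e => (hy1 e).add (hw1 e), fun e x hx => ?_, u + t, ?_, ?_, ?_⟩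
    · simp [hy0 e x hx, hw0 e x hx]
    · have h2 : edgeDeriv ℓ (edgeDeriv ℓ ((y + w) e)) x
          = edgeDeriv ℓ (edgeDeriv ℓ (y e)) x + edgeDeriv ℓ (edgeDeriv ℓ (w e)) x := by
        rw [edgeDeriv_congr (g := edgeDeriv ℓ (y e) + edgeDeriv ℓ (w e)) (d1 e) hx]
        exact edgeDeriv_add (differentiableOn_edgeDeriv hℓ (hy1 e))
          (differentiableOn_edgeDeriv hℓ (hw1 e)) hx
      rw [h2, neg_add, hy2 e x hx, hw2 e x hx]
      simp [mul_add]
    · intro e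
      simp [hu0, ht0]
    · intro e
      simp [hu1, ht1]
    · intro v
      have key := congrArg₂ (· + ·) (hu2 v) (ht2 v)
      simp only [← Finset.sum_filter] at key ⊢
      simp only [d1 _ _ l0, d1 _ _ l1, Finset.sum_add_distrib]
      rw [Pi.add_apply]
      linear_combination key
  smul_mem' := by
    rintro c y ⟨hy0, hy1, hy2, u, hu0, hu1, hu2⟩
    have d1 : ∀ e, edgeDeriv ℓ ((c • y) e) = c • edgeDeriv ℓ (y e) := by
      intro e
      funext x
      exact edgeDeriv_smul ℓ x c (y e)
    refine ⟨fun e x hx => ?_, fun e => (hy1 e).const_smul c, fun e x hx => ?_, c • u, ?_, ?_, ?_⟩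
    · simp [hy0 e x hx]
    · rw [d1, edgeDeriv_smul]
      have := hy2 e x hx
      simp only [Pi.smul_apply, smul_eq_mul]
      linear_combination c * this
    · intro e
      simp [hu0]
    · intro e
      simp [hu1]
    · intro v
      have key := congrArg (c * ·) (hu2 v)
      simp only [← Finset.sum_filter] at key ⊢
      simp only [d1]
      simp only [Pi.smul_apply, smul_eq_mul, ← Finset.mul_sum]
      linear_combination key

/-- The spectrum of the Robin problem: all complex `μ` for which it has a nonzero solution. -/
def robinSpectrum {V : Type*} [Fintype V] [DecidableEq V] (G : SimpleGraph V)
    [DecidableRel G.Adj] (o : EdgeOrientation G) {ℓ : ℝ} (hℓ : 0 < ℓ) (b : V → ℝ) : Set ℂ :=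
  {μ | ∃ y ∈ robinEigenspace G o hℓ b μ, y ≠ 0}

end

/-! Write `c` and `S` for the values at `ℓ` of the solutions `cos (√λ x)` and `sin (√λ x) / √λ`
(`edgeCos`, `edgeSin`). Away from the Dirichlet eigenvalues of an edge, called poles here, `S ≠ 0`.
A solution is then determined by its vertex values `u`, and the vertex conditions become `(c D - A +
S b) u = 0` (`map_fst_vertexData`). Hence the multiplicity of `λ` is the number of `j` with `branch
j S = c`, where the branches are the ordered eigenvalues of `D^(-1/2) (A - S b) D^(-1/2)`
(`finrank_ker_vertexMatrix`). At `S = 0` the branches are the zeros of `ψ` (`roots_psiPoly`).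

The zeros of `c - branch j S` are located by monotonicity. The form `(c D - A + S b) / S` equals `(c
- 1) / S` times `(D + A) / 2`, plus `(c + 1) / S` times `(D - A) / 2`, plus `b`. Both `D - A` and `D
+ A` are nonnegative, the latter because a tree is bipartite, and both scalar quotients decrease
strictly in `λ` between poles. By min-max, `(c - branch j S) / S` decreases strictly too
(`branch_quotient_lt`). For a middle branch, `branch j 0` lies in `(-1, 1)` while `c = ±1` at the
poles, so every gap contains exactly one zero (`existsUnique_branch_zero`). The gaps of even and odd
index give the families with `+arccos` and `-arccos`.

The first and the last branch start at `1` and `-1`, and their quotients need not blow up at every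
pole. Bipartiteness gives `branch j.rev S = -branch j (-S)`, so both are read off the top branch
with the sign `(-1)^k`. Since `branch 0 S = 1 - β S + O(S²)` with `β = ∑ b / ∑ deg`, the signed
quotient extends continuously across the `k`-th pole with value `β`. It therefore has exactly one
zero between the two neighbouring poles (`existsUnique_isExtremeZero`), and this zero is the pole
itself precisely when `∑ b = 0`. That agrees with the multiplicity at a pole, which signed incidence
matrices of the tree show to be `1` if `∑ b = 0` and `0` otherwise (`finrank_vertexData_pole`).

Non-real `λ` are excluded by a Green identity. For the asymptotics, `S → 0` along each sequence, so
`c` tends to the corresponding zero of `ψ` up to the sign `(-1)^k`, and the gap containing `λ`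
selects the branch of the arccosine. -/

/-! ### Courant–Fischer for real symmetric matrices -/

namespace Matrix.IsHermitian

variable {n : Type*} [Fintype n] [DecidableEq n] {M : Matrix n n ℝ}

/-- The coordinates of a vector in the orthonormal eigenbasis, ordered as the eigenvalues. -/
noncomputable def coords (hM : M.IsHermitian) : (n → ℝ) →ₗ[ℝ] (Fin (Fintype.card n) → ℝ) :=
  (LinearMap.funLeft ℝ ℝ (Fintype.equivOfCardEq (Fintype.card_fin (Fintype.card n)))).comp
    (Matrix.mulVecLin (star (hM.eigenvectorUnitary : Matrix n n ℝ)))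

theorem dotProduct_mulVec_eq_sum (hM : M.IsHermitian) (x : n → ℝ) :
    x ⬝ᵥ M *ᵥ x = ∑ i, hM.eigenvalues₀ i * hM.coords x i ^ 2 := by
  have h : x ⬝ᵥ M *ᵥ x
      = ∑ i, hM.eigenvalues i * ((star (hM.eigenvectorUnitary : Matrix n n ℝ)) *ᵥ x) i ^ 2 := by
    conv_lhs => rw [hM.spectral_theorem, Unitary.conjStarAlgAut_apply]
    rw [Matrix.mul_assoc, ← Matrix.mulVec_mulVec, ← Matrix.mulVec_mulVec, Matrix.dotProduct_mulVec,
      ← Matrix.mulVec_transpose]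
    simp only [dotProduct, Matrix.mulVec_diagonal, Function.comp_apply]
    refine Finset.sum_congr rfl fun i _ => ?_
    simp only [RCLike.ofReal_real_eq_id, id, Matrix.star_eq_conjTranspose,
      Matrix.conjTranspose_eq_transpose_of_trivial]
    ring
  rw [h, ← (Fintype.equivOfCardEq (Fintype.card_fin (Fintype.card n))).sum_comp]
  simp [eigenvalues, coords]

theorem dotProduct_self_eq_sum (hM : M.IsHermitian) (x : n → ℝ) :
    x ⬝ᵥ x = ∑ i, hM.coords x i ^ 2 := by
  have h : x ⬝ᵥ x
      = ∑ i, ((star (hM.eigenvectorUnitary : Matrix n n ℝ)) *ᵥ x) i ^ 2 := by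
    have h1 : x = (hM.eigenvectorUnitary : Matrix n n ℝ) *ᵥ
        ((star (hM.eigenvectorUnitary : Matrix n n ℝ)) *ᵥ x) := by
      rw [Matrix.mulVec_mulVec, Unitary.mul_star_self_of_mem hM.eigenvectorUnitary.2,
        Matrix.one_mulVec]
    conv_lhs => rhs; rw [h1]
    rw [Matrix.dotProduct_mulVec, ← Matrix.mulVec_transpose]
    simp only [dotProduct]
    refine Finset.sum_congr rfl fun i _ => ?_
    simp only [Matrix.star_eq_conjTranspose, Matrix.conjTranspose_eq_transpose_of_trivial]
    ring
  rw [h, ← (Fintype.equivOfCardEq (Fintype.card_fin (Fintype.card n))).sum_comp]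
  simp [coords]

/-- The vectors whose coordinates outside `s` vanish. -/
noncomputable def coordSubspace (hM : M.IsHermitian) (s : Finset (Fin (Fintype.card n))) :
    Submodule ℝ (n → ℝ) :=
  LinearMap.ker ((LinearMap.funLeft ℝ ℝ (Subtype.val : {i // i ∉ s} → _)).comp hM.coords)

theorem mem_coordSubspace (hM : M.IsHermitian) {s : Finset (Fin (Fintype.card n))} {x : n → ℝ} :
    x ∈ hM.coordSubspace s ↔ ∀ i ∉ s, hM.coords x i = 0 := by
  simp [coordSubspace, funext_iff]

theorem card_le_finrank_coordSubspace (hM : M.IsHermitian) (s : Finset (Fin (Fintype.card n))) :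
    s.card ≤ Module.finrank ℝ (hM.coordSubspace s) := by
  have h1 := LinearMap.finrank_range_add_finrank_ker
    ((LinearMap.funLeft ℝ ℝ (Subtype.val : {i // i ∉ s} → _)).comp hM.coords)
  have h2 := Submodule.finrank_le (LinearMap.range
    ((LinearMap.funLeft ℝ ℝ (Subtype.val : {i // i ∉ s} → _)).comp hM.coords))
  simp only [Module.finrank_fintype_fun_eq_card, Fintype.card_subtype_compl, Fintype.card_fin,
    Fintype.card_coe] at h1 h2
  have h3 : s.card ≤ Fintype.card n := by simpa using s.card_le_univ
  change _ + Module.finrank ℝ (hM.coordSubspace s) = _ at h1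
  omega

theorem exists_ne_zero_mem_inf {E : Type*} [AddCommGroup E] [Module ℝ E] [FiniteDimensional ℝ E]
    {W₁ W₂ : Submodule ℝ E}
    (h : Module.finrank ℝ E < Module.finrank ℝ W₁ + Module.finrank ℝ W₂) :
    ∃ x ∈ W₁, x ∈ W₂ ∧ x ≠ 0 := by
  have h1 := Submodule.finrank_sup_add_finrank_inf_eq W₁ W₂
  have h2 := Submodule.finrank_le (W₁ ⊔ W₂)
  have h3 : W₁ ⊓ W₂ ≠ ⊥ := by
    intro h0
    rw [h0, finrank_bot] at h1
    omega
  obtain ⟨x, hx, hx0⟩ := Submodule.exists_mem_ne_zero_of_ne_bot h3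
  exact ⟨x, hx.1, hx.2, hx0⟩

/-- The space of vectors spanned by the eigenvectors for the first `j + 1` eigenvalues. -/
theorem exists_forall_eigenvalues₀_mul_le (hM : M.IsHermitian) (j : Fin (Fintype.card n)) :
    ∃ W : Submodule ℝ (n → ℝ), j + 1 ≤ Module.finrank ℝ W ∧
      ∀ x ∈ W, hM.eigenvalues₀ j * (x ⬝ᵥ x) ≤ x ⬝ᵥ M *ᵥ x := by
  refine ⟨hM.coordSubspace (Finset.Iic j), ?_, fun x hx => ?_⟩
  · simpa using hM.card_le_finrank_coordSubspace (Finset.Iic j)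
  · rw [mem_coordSubspace] at hx
    rw [dotProduct_mulVec_eq_sum hM, dotProduct_self_eq_sum hM, Finset.mul_sum]
    refine Finset.sum_le_sum fun i _ => ?_
    by_cases hi : i ≤ j
    · exact mul_le_mul_of_nonneg_right (hM.eigenvalues₀_antitone hi) (sq_nonneg _)
    · simp [hx i (by simpa using hi)]

/-- The eigenvalues are in decreasing order, so the form is bounded above by the `j`-th one on the
span of the eigenvectors with index at least `j`. -/
theorem exists_forall_le_eigenvalues₀_mul (hM : M.IsHermitian) (j : Fin (Fintype.card n)) :
    ∃ W : Submodule ℝ (n → ℝ), Fintype.card n ≤ Module.finrank ℝ W + j ∧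
      ∀ x ∈ W, x ⬝ᵥ M *ᵥ x ≤ hM.eigenvalues₀ j * (x ⬝ᵥ x) := by
  refine ⟨hM.coordSubspace (Finset.Ici j), ?_, fun x hx => ?_⟩
  · have := hM.card_le_finrank_coordSubspace (Finset.Ici j)
    rw [Fin.card_Ici] at this
    omega
  · rw [mem_coordSubspace] at hx
    rw [dotProduct_mulVec_eq_sum hM, dotProduct_self_eq_sum hM, Finset.mul_sum]
    refine Finset.sum_le_sum fun i _ => ?_
    by_cases hi : j ≤ i
    · exact mul_le_mul_of_nonneg_right (hM.eigenvalues₀_antitone hi) (sq_nonneg _)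
    · simp [hx i (by simpa using hi)]

/-- The max-min half of the Courant–Fischer theorem. -/
theorem le_eigenvalues₀ (hM : M.IsHermitian) {j : Fin (Fintype.card n)} {t : ℝ}
    (W : Submodule ℝ (n → ℝ)) (hW : j + 1 ≤ Module.finrank ℝ W)
    (h : ∀ x ∈ W, t * (x ⬝ᵥ x) ≤ x ⬝ᵥ M *ᵥ x) : t ≤ hM.eigenvalues₀ j := by
  obtain ⟨W', hW', h'⟩ := hM.exists_forall_le_eigenvalues₀_mul j
  obtain ⟨x, hx, hx', hx0⟩ := exists_ne_zero_mem_inf (W₁ := W) (W₂ := W')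
    (by rw [Module.finrank_fintype_fun_eq_card]; omega)
  have hpos : 0 < x ⬝ᵥ x := by
    simpa using Matrix.dotProduct_star_self_pos_iff.2 hx0
  exact le_of_mul_le_mul_right ((h x hx).trans (h' x hx')) hpos

/-- The min-max half of the Courant–Fischer theorem. -/
theorem eigenvalues₀_le (hM : M.IsHermitian) {j : Fin (Fintype.card n)} {t : ℝ}
    (W : Submodule ℝ (n → ℝ)) (hW : Fintype.card n ≤ Module.finrank ℝ W + j)
    (h : ∀ x ∈ W, x ⬝ᵥ M *ᵥ x ≤ t * (x ⬝ᵥ x)) : hM.eigenvalues₀ j ≤ t := by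
  obtain ⟨W', hW', h'⟩ := hM.exists_forall_eigenvalues₀_mul_le j
  obtain ⟨x, hx, hx', hx0⟩ := exists_ne_zero_mem_inf (W₁ := W) (W₂ := W')
    (by rw [Module.finrank_fintype_fun_eq_card]; omega)
  have hpos : 0 < x ⬝ᵥ x := by
    simpa using Matrix.dotProduct_star_self_pos_iff.2 hx0
  exact le_of_mul_le_mul_right ((h' x hx').trans (h x hx)) hpos

end Matrix.IsHermitian

/-! ### Eigenvalue branches of the pencil `A - S b` relative to `D` -/

section Branches

open scoped Matrix

set_option linter.unusedSectionVars false

variable {V : Type*} [Fintype V] [DecidableEq V] (G : SimpleGraph V) [DecidableRel G.Adj]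
  (b : V → ℝ)

/-- The quadratic form of the degree matrix. -/
def degForm (u : V → ℝ) : ℝ := ∑ v, (G.degree v : ℝ) * u v ^ 2

/-- The quadratic form of the adjacency matrix. -/
def adjForm (u : V → ℝ) : ℝ := u ⬝ᵥ G.adjMatrix ℝ *ᵥ u

/-- The quadratic form of the diagonal matrix `b`. -/
def potForm (u : V → ℝ) : ℝ := ∑ v, b v * u v ^ 2

/-- The symmetric matrix `D^(-1/2) (A - S b) D^(-1/2)`. -/
noncomputable def scaledMatrix (S : ℝ) : Matrix V V ℝ :=
  Matrix.diagonal (fun v => (√(G.degree v))⁻¹) * (G.adjMatrix ℝ - S • Matrix.diagonal b)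
    * Matrix.diagonal (fun v => (√(G.degree v))⁻¹)

theorem isHermitian_scaledMatrix (S : ℝ) : (scaledMatrix G b S).IsHermitian := by
  have h : (G.adjMatrix ℝ - S • Matrix.diagonal b).IsHermitian := by
    refine (G.isHermitian_adjMatrix ℝ).sub ?_
    rw [← Matrix.diagonal_smul]
    exact Matrix.isHermitian_diagonal _
  have h2 := Matrix.isHermitian_conjTranspose_mul_mul
    (Matrix.diagonal (fun v => (√(G.degree v : ℝ))⁻¹)) h
  simpa [scaledMatrix] using h2

/-- The eigenvalues of `D^(-1/2) (A - S b) D^(-1/2)` in decreasing order, as functions of `S`. -/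
noncomputable def branch (j : Fin (Fintype.card V)) (S : ℝ) : ℝ :=
  (isHermitian_scaledMatrix G b S).eigenvalues₀ j

variable {G b}

/-- Multiplication by `D^(1/2)`. -/
noncomputable def sqrtDegEquiv (hd : ∀ v, 0 < G.degree v) : (V → ℝ) ≃ₗ[ℝ] (V → ℝ) :=
  LinearEquiv.piCongrRight fun v => LinearEquiv.smulOfNeZero ℝ ℝ (√(G.degree v))
    (Real.sqrt_ne_zero'.2 (by exact_mod_cast hd v))

theorem sqrtDegEquiv_apply (hd : ∀ v, 0 < G.degree v) (u : V → ℝ) (v : V) :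
    sqrtDegEquiv hd u v = √(G.degree v) * u v := rfl

theorem sqrtDegEquiv_dotProduct (hd : ∀ v, 0 < G.degree v) (u : V → ℝ) :
    sqrtDegEquiv hd u ⬝ᵥ sqrtDegEquiv hd u = degForm G u := by
  simp only [dotProduct, sqrtDegEquiv_apply, degForm]
  refine Finset.sum_congr rfl fun v _ => ?_
  have := Real.mul_self_sqrt (Nat.cast_nonneg (α := ℝ) (G.degree v))
  linear_combination (u v ^ 2) * this

/-- Substituting `x = D^(1/2) u` removes the scaling. The min-max principles for the branches below
can thus be stated with the forms of `A`, `b` and `D` alone. -/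
theorem sqrtDegEquiv_form (hd : ∀ v, 0 < G.degree v) (S : ℝ) (u : V → ℝ) :
    sqrtDegEquiv hd u ⬝ᵥ scaledMatrix G b S *ᵥ sqrtDegEquiv hd u
      = adjForm G u - S * potForm b u := by
  have h1 : Matrix.diagonal (fun v => (√(G.degree v : ℝ))⁻¹) *ᵥ sqrtDegEquiv hd u = u := by
    ext v
    rw [Matrix.mulVec_diagonal, sqrtDegEquiv_apply, ← mul_assoc, inv_mul_cancel₀, one_mul]
    exact Real.sqrt_ne_zero'.2 (by exact_mod_cast hd v)
  rw [scaledMatrix, Matrix.mul_assoc, ← Matrix.mulVec_mulVec, ← Matrix.mulVec_mulVec,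
    Matrix.dotProduct_mulVec, ← Matrix.mulVec_transpose, Matrix.diagonal_transpose, h1,
    Matrix.sub_mulVec, dotProduct_sub, adjForm, potForm, Matrix.smul_mulVec, dotProduct_smul,
    smul_eq_mul]
  congr 2
  simp only [dotProduct, Matrix.mulVec_diagonal]
  exact Finset.sum_congr rfl fun v _ => by ring

theorem exists_branch_mul_le (hd : ∀ v, 0 < G.degree v) (j : Fin (Fintype.card V)) (S : ℝ) :
    ∃ W : Submodule ℝ (V → ℝ), j + 1 ≤ Module.finrank ℝ W ∧
      ∀ u ∈ W, branch G b j S * degForm G u ≤ adjForm G u - S * potForm b u := by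
  obtain ⟨W, hW, h⟩ :=
    (isHermitian_scaledMatrix G b S).exists_forall_eigenvalues₀_mul_le j
  refine ⟨W.map (sqrtDegEquiv hd).symm.toLinearMap, ?_, ?_⟩
  · rwa [LinearEquiv.finrank_map_eq]
  · rintro _ ⟨x, hx, rfl⟩
    have := h x hx
    rw [← sqrtDegEquiv_dotProduct hd, ← sqrtDegEquiv_form hd]
    simpa [branch] using this

theorem exists_le_branch_mul (hd : ∀ v, 0 < G.degree v) (j : Fin (Fintype.card V)) (S : ℝ) :
    ∃ W : Submodule ℝ (V → ℝ), Fintype.card V ≤ Module.finrank ℝ W + j ∧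
      ∀ u ∈ W, adjForm G u - S * potForm b u ≤ branch G b j S * degForm G u := by
  obtain ⟨W, hW, h⟩ :=
    (isHermitian_scaledMatrix G b S).exists_forall_le_eigenvalues₀_mul j
  refine ⟨W.map (sqrtDegEquiv hd).symm.toLinearMap, ?_, ?_⟩
  · rwa [LinearEquiv.finrank_map_eq]
  · rintro _ ⟨x, hx, rfl⟩
    have := h x hx
    rw [← sqrtDegEquiv_dotProduct hd, ← sqrtDegEquiv_form hd]
    simpa [branch] using this

theorem le_branch (hd : ∀ v, 0 < G.degree v) {j : Fin (Fintype.card V)} {S t : ℝ}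
    (W : Submodule ℝ (V → ℝ)) (hW : j + 1 ≤ Module.finrank ℝ W)
    (h : ∀ u ∈ W, t * degForm G u ≤ adjForm G u - S * potForm b u) : t ≤ branch G b j S := by
  refine (isHermitian_scaledMatrix G b S).le_eigenvalues₀
    (W.map (sqrtDegEquiv hd).toLinearMap) (by rwa [LinearEquiv.finrank_map_eq]) ?_
  rintro _ ⟨u, hu, rfl⟩
  simpa [sqrtDegEquiv_dotProduct hd, sqrtDegEquiv_form hd] using h u hu

theorem branch_le (hd : ∀ v, 0 < G.degree v) {j : Fin (Fintype.card V)} {S t : ℝ}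
    (W : Submodule ℝ (V → ℝ)) (hW : Fintype.card V ≤ Module.finrank ℝ W + j)
    (h : ∀ u ∈ W, adjForm G u - S * potForm b u ≤ t * degForm G u) : branch G b j S ≤ t := by
  refine (isHermitian_scaledMatrix G b S).eigenvalues₀_le
    (W.map (sqrtDegEquiv hd).toLinearMap) (by rwa [LinearEquiv.finrank_map_eq]) ?_
  rintro _ ⟨u, hu, rfl⟩
  simpa [sqrtDegEquiv_dotProduct hd, sqrtDegEquiv_form hd] using h u hu

theorem branch_le_of_forall (hd : ∀ v, 0 < G.degree v) {j : Fin (Fintype.card V)} {S t : ℝ}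
    (h : ∀ u, adjForm G u - S * potForm b u ≤ t * degForm G u) : branch G b j S ≤ t :=
  branch_le hd ⊤ (by simp) fun u _ => h u

theorem degForm_nonneg (u : V → ℝ) : 0 ≤ degForm G u :=
  Finset.sum_nonneg fun _ _ => by positivity

theorem sum_sq_le_degForm (hd : ∀ v, 0 < G.degree v) (u : V → ℝ) :
    ∑ v, u v ^ 2 ≤ degForm G u := by
  refine Finset.sum_le_sum fun v _ => ?_
  have : (1 : ℝ) ≤ G.degree v := by exact_mod_cast hd v
  nlinarith [sq_nonneg (u v)]

theorem abs_potForm_le (hd : ∀ v, 0 < G.degree v) (u : V → ℝ) :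
    |potForm b u| ≤ (∑ v, |b v|) * degForm G u := by
  refine (Finset.abs_sum_le_sum_abs _ _).trans ?_
  rw [Finset.sum_mul]
  refine Finset.sum_le_sum fun v _ => ?_
  rw [abs_mul, abs_of_nonneg (sq_nonneg (u v))]
  refine mul_le_mul_of_nonneg_left (le_trans ?_ (sum_sq_le_degForm hd u)) (abs_nonneg _)
  exact Finset.single_le_sum (f := fun v => u v ^ 2) (fun _ _ => sq_nonneg _) (Finset.mem_univ v)

/-- Changing the parameter from `T` to `S` perturbs the form by at most `|S - T| ∑ |b|` times the
form of `D`, and min-max transfers this bound to each branch. -/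
theorem branch_le_add (hd : ∀ v, 0 < G.degree v) (j : Fin (Fintype.card V)) (S T : ℝ) :
    branch G b j S ≤ branch G b j T + (∑ v, |b v|) * |S - T| := by
  obtain ⟨W, hW, h⟩ := exists_le_branch_mul (b := b) hd j T
  refine branch_le hd W hW fun u hu => ?_
  have h1 := abs_le.1 (abs_mul (S - T) (potForm b u)).le
  have h2 := mul_le_mul_of_nonneg_left (abs_potForm_le (b := b) hd u) (abs_nonneg (S - T))
  linarith [h u hu, h1.1]

theorem continuous_branch (hd : ∀ v, 0 < G.degree v) (j : Fin (Fintype.card V)) :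
    Continuous (branch G b j) := by
  have h : LipschitzWith (Real.toNNReal (∑ v, |b v|)) (branch G b j) := by
    refine LipschitzWith.of_le_add_mul _ fun S T => ?_
    rw [Real.coe_toNNReal _ (Finset.sum_nonneg fun _ _ => abs_nonneg _), Real.dist_eq]
    exact branch_le_add hd j S T
  exact h.continuous

theorem degForm_sub_adjForm_eq (u : V → ℝ) :
    degForm G u - adjForm G u = (∑ v, ∑ w, if G.Adj v w then (u v - u w) ^ 2 else 0) / 2 := by
  rw [← SimpleGraph.lapMatrix_toLinearMap₂', Matrix.toLinearMap₂'_apply', SimpleGraph.lapMatrix,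
    Matrix.sub_mulVec, dotProduct_sub, SimpleGraph.dotProduct_mulVec_degMatrix]
  simp [degForm, adjForm, pow_two, mul_assoc]

theorem adjForm_le_degForm (u : V → ℝ) : adjForm G u ≤ degForm G u := by
  have h : 0 ≤ degForm G u - adjForm G u := by
    rw [degForm_sub_adjForm_eq]
    exact div_nonneg (Finset.sum_nonneg fun _ _ => Finset.sum_nonneg fun _ _ => by
      split_ifs <;> positivity) two_pos.le
  linarith

theorem apply_eq_of_adjForm_eq_degForm (hG : G.Connected) {u : V → ℝ}
    (h : adjForm G u = degForm G u) (v w : V) : u v = u w := by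
  have h0 : Matrix.toLinearMap₂' ℝ (G.lapMatrix ℝ) u u = 0 := by
    rw [SimpleGraph.lapMatrix_toLinearMap₂', ← degForm_sub_adjForm_eq, h, sub_self]
  exact (G.lapMatrix_toLinearMap₂'_apply'_eq_zero_iff_forall_reachable u).1 h0 v w (hG v w)

theorem adjForm_one : adjForm G (fun _ => 1) = degForm G (fun _ => 1) := by
  have h := degForm_sub_adjForm_eq (G := G) (fun _ => (1 : ℝ))
  simp at h
  linarith

theorem branch_zero_le_one (hd : ∀ v, 0 < G.degree v) (j : Fin (Fintype.card V)) :
    branch G b j 0 ≤ 1 :=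
  branch_le_of_forall hd fun u => by simpa using adjForm_le_degForm u

theorem form_smul_one (a : ℝ) : degForm G (a • fun _ => 1) = a ^ 2 * degForm G (fun _ => 1)
    ∧ adjForm G (a • fun _ => 1) = a ^ 2 * degForm G (fun _ => 1)
    ∧ potForm b (a • fun _ => 1) = a ^ 2 * ∑ v, b v := by
  refine ⟨?_, ?_, ?_⟩
  · simp [degForm, Finset.mul_sum, mul_comm]
  · rw [← adjForm_one, adjForm, adjForm, Matrix.mulVec_smul, dotProduct_smul, smul_dotProduct]
    simp only [smul_eq_mul]
    ring
  · simp only [potForm, Pi.smul_apply, smul_eq_mul, mul_one, Finset.mul_sum]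
    exact Finset.sum_congr rfl fun _ _ => mul_comm _ _

/-- The negative of the derivative at `0` of the largest branch. -/
noncomputable def meanPot (G : SimpleGraph V) [DecidableRel G.Adj] (b : V → ℝ) : ℝ :=
  (∑ v, b v) / degForm G (fun _ => 1)

theorem degForm_one_pos [Nonempty V] (hd : ∀ v, 0 < G.degree v) :
    0 < degForm G (fun _ => 1) := by
  refine Finset.sum_pos (fun v _ => ?_) Finset.univ_nonempty
  have : (0 : ℝ) < G.degree v := by exact_mod_cast hd v
  positivity

/-- The constant functions serve as a one-dimensional trial space. -/
theorem le_branch_top [Nonempty V] (hd : ∀ v, 0 < G.degree v) {j : Fin (Fintype.card V)}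
    (hj : (j : ℕ) = 0) (S : ℝ) : 1 - S * meanPot G b ≤ branch G b j S := by
  have h1 : (fun _ => 1 : V → ℝ) ≠ 0 := fun h => one_ne_zero (congrFun h (Classical.arbitrary V))
  refine le_branch hd (ℝ ∙ (fun _ => 1 : V → ℝ)) (by rw [finrank_span_singleton h1]; omega) ?_
  intro u hu
  obtain ⟨a, rfl⟩ := Submodule.mem_span_singleton.1 hu
  obtain ⟨e1, e2, e3⟩ := form_smul_one (G := G) (b := b) a
  rw [e1, e2, e3]
  have := (degForm_one_pos hd).ne'
  have h2 : meanPot G b * degForm G (fun _ => 1) = ∑ v, b v := div_mul_cancel₀ _ this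
  rw [← h2]
  apply le_of_eq
  ring

theorem branch_top_zero [Nonempty V] (hd : ∀ v, 0 < G.degree v) {j : Fin (Fintype.card V)}
    (hj : (j : ℕ) = 0) : branch G b j 0 = 1 :=
  le_antisymm (branch_zero_le_one hd j) (by simpa using le_branch_top (b := b) hd hj 0)

/-- By connectedness, equality of the forms of `A` and `D` forces a constant function. A branch
other than the first with value `1` would supply such functions in a space of dimension at least
two. -/
theorem branch_zero_lt_one (hG : G.Connected) (hd : ∀ v, 0 < G.degree v)
    {j : Fin (Fintype.card V)} (hj : (j : ℕ) ≠ 0) : branch G b j 0 < 1 := by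
  have := hG.nonempty
  refine lt_of_le_of_ne (branch_zero_le_one hd j) fun h => ?_
  obtain ⟨W, hW, hle⟩ := exists_branch_mul_le (b := b) hd j 0
  have h1 : W ≤ ℝ ∙ (fun _ => 1 : V → ℝ) := by
    intro u hu
    have h2 := hle u hu
    rw [h] at h2
    have h3 := apply_eq_of_adjForm_eq_degForm hG
      (le_antisymm (adjForm_le_degForm u) (by linarith))
    refine Submodule.mem_span_singleton.2 ⟨u (Classical.arbitrary V), ?_⟩
    ext v
    simpa using h3 _ v
  have h4 := (Submodule.finrank_mono h1).trans (finrank_span_le_card _)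
  simp at h4
  omega

/-- Multiplication by a sign function. -/
noncomputable def signEquiv {σ : V → ℝ} (hσ : ∀ v, σ v ^ 2 = 1) : (V → ℝ) ≃ₗ[ℝ] (V → ℝ) :=
  LinearEquiv.piCongrRight fun v => LinearEquiv.smulOfNeZero ℝ ℝ (σ v)
    (fun h => by simpa [h] using hσ v)

theorem forms_signEquiv {σ : V → ℝ} (hσ : ∀ v, σ v ^ 2 = 1)
    (hadj : ∀ v w, G.Adj v w → σ v = -σ w) (u : V → ℝ) :
    degForm G (signEquiv hσ u) = degForm G u ∧ potForm b (signEquiv hσ u) = potForm b u ∧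
      adjForm G (signEquiv hσ u) = -adjForm G u := by
  have e : ∀ v, signEquiv hσ u v = σ v * u v := fun _ => rfl
  refine ⟨?_, ?_, ?_⟩
  · simp [degForm, e, mul_pow, hσ]
  · simp [potForm, e, mul_pow, hσ]
  · simp only [adjForm, SimpleGraph.dotProduct_mulVec_adjMatrix, ← Finset.sum_neg_distrib]
    refine Finset.sum_congr rfl fun v _ => Finset.sum_congr rfl fun w _ => ?_
    split_ifs with h
    · rw [e, e]
      have h1 := hadj v w h
      have h2 := hσ w
      rw [h1]
      linear_combination (-(u v * u w)) * h2
    · simp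

/-- Multiplication by the bipartition sign keeps `D` and `b` and turns `A` into `-A`. A space on
which the form is large becomes one on which it is small, which reverses the index. -/
theorem branch_rev_le {σ : V → ℝ} (hσ : ∀ v, σ v ^ 2 = 1)
    (hadj : ∀ v w, G.Adj v w → σ v = -σ w) (hd : ∀ v, 0 < G.degree v)
    (j : Fin (Fintype.card V)) (S : ℝ) : branch G b j.rev S ≤ -branch G b j (-S) := by
  obtain ⟨W, hW, h⟩ := exists_branch_mul_le (b := b) hd j (-S)
  refine branch_le hd (W.map (signEquiv hσ).toLinearMap) ?_ ?_
  · rw [LinearEquiv.finrank_map_eq, Fin.val_rev]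
    omega
  · rintro _ ⟨u, hu, rfl⟩
    obtain ⟨e1, e2, e3⟩ := forms_signEquiv (b := b) hσ hadj u
    have := h u hu
    simp only [LinearEquiv.coe_coe, e1, e2, e3]
    linarith

/-- The symmetry of the branches of a bipartite graph. -/
theorem branch_rev {σ : V → ℝ} (hσ : ∀ v, σ v ^ 2 = 1)
    (hadj : ∀ v w, G.Adj v w → σ v = -σ w) (hd : ∀ v, 0 < G.degree v)
    (j : Fin (Fintype.card V)) (S : ℝ) : branch G b j.rev S = -branch G b j (-S) := by
  refine le_antisymm (branch_rev_le hσ hadj hd j S) ?_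
  obtain ⟨W, hW, h⟩ := exists_le_branch_mul (b := b) hd j (-S)
  refine le_branch hd (W.map (signEquiv hσ).toLinearMap) ?_ ?_
  · rw [LinearEquiv.finrank_map_eq, Fin.val_rev]
    omega
  · rintro _ ⟨u, hu, rfl⟩
    obtain ⟨e1, e2, e3⟩ := forms_signEquiv (b := b) hσ hadj u
    have := h u hu
    simp only [LinearEquiv.coe_coe, e1, e2, e3]
    linarith

/-- This is the comparison behind the uniqueness of the zeros. The form `(c D - A + S b) / S` is a
combination of the nonnegative forms `D + A` and `D - A` plus a term free of `c` and `S`, so the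
order of the two scalar quotients passes to the forms and, through min-max, to the branch. -/
theorem branch_quotient_lt {σ : V → ℝ} (hσ : ∀ v, σ v ^ 2 = 1)
    (hadj : ∀ v w, G.Adj v w → σ v = -σ w) (hd : ∀ v, 0 < G.degree v)
    (j : Fin (Fintype.card V)) {c S c' S' : ℝ} (hS : 0 < S * S')
    (hm : (c' - 1) / S' < (c - 1) / S) (hp : (c' + 1) / S' < (c + 1) / S) :
    (c' - branch G b j S') / S' < (c - branch G b j S) / S := by
  -- A margin common to both quotients gives a gap of `ε` times the form of `D`, so the inequality
  -- stays strict after min-max.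
  obtain ⟨ε, hε, h1, h2⟩ : ∃ ε > 0, (c' - 1) / S' + ε ≤ (c - 1) / S ∧
      (c' + 1) / S' + ε ≤ (c + 1) / S := by
    refine ⟨min ((c - 1) / S - (c' - 1) / S') ((c + 1) / S - (c' + 1) / S'),
      lt_min (by linarith) (by linarith), ?_, ?_⟩
    · linarith [min_le_left ((c - 1) / S - (c' - 1) / S') ((c + 1) / S - (c' + 1) / S')]
    · linarith [min_le_right ((c - 1) / S - (c' - 1) / S') ((c + 1) / S - (c' + 1) / S')]
  have hS0 : S ≠ 0 := left_ne_zero_of_mul hS.ne'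
  have hS0' : S' ≠ 0 := right_ne_zero_of_mul hS.ne'
  have key : ∀ u, (c' * degForm G u - adjForm G u + S' * potForm b u) / S' + ε * degForm G u
      ≤ (c * degForm G u - adjForm G u + S * potForm b u) / S := by
    intro u
    have e : ∀ c S : ℝ, S ≠ 0 → (c * degForm G u - adjForm G u + S * potForm b u) / S
        = (c - 1) / S * ((degForm G u + adjForm G u) / 2)
          + (c + 1) / S * ((degForm G u - adjForm G u) / 2) + potForm b u := by
      intro c S h
      field_simp
      ring
    rw [e c S hS0, e c' S' hS0']
    have q1 := adjForm_le_degForm (G := G) u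
    have q2 : 0 ≤ degForm G u + adjForm G u := by
      obtain ⟨e1, e2, e3⟩ := forms_signEquiv (b := b) hσ hadj u
      have := adjForm_le_degForm (G := G) (signEquiv hσ u)
      linarith
    have r1 := mul_le_mul_of_nonneg_right h1 (div_nonneg q2 two_pos.le)
    have r2 := mul_le_mul_of_nonneg_right h2 (div_nonneg (sub_nonneg.2 q1) two_pos.le)
    linarith
  set g := (c - branch G b j S) / S with hg
  have hgS : branch G b j S = c - g * S := by
    rw [hg]; field_simp; ring
  suffices h : (c' - branch G b j S') / S' ≤ g - ε by linarith
  -- Division by `S` reverses the order for negative `S`. The sign decides which half of min-max is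
  -- used, but in both cases the trial space consists of `u` whose quotient form is at most `g`
  -- times that of `D`.
  rcases lt_or_gt_of_ne hS0 with hneg | hpos
  · have hneg' : S' < 0 := by nlinarith
    obtain ⟨W, hW, h⟩ := exists_le_branch_mul (b := b) hd j S
    have := branch_le (b := b) (S := S') (t := c' - (g - ε) * S') hd W hW fun u hu => by
      have a1 := h u hu
      rw [hgS] at a1
      have a2 := key u
      have a3 : (c * degForm G u - adjForm G u + S * potForm b u) / S ≤ g * degForm G u := by
        rw [div_le_iff_of_neg hneg]
        linarith
      have a4 : (c' * degForm G u - adjForm G u + S' * potForm b u) / S'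
          ≤ (g - ε) * degForm G u := by linarith
      rw [div_le_iff_of_neg hneg'] at a4
      linarith
    rw [div_le_iff_of_neg hneg']
    linarith
  · have hpos' : 0 < S' := by nlinarith
    obtain ⟨W, hW, h⟩ := exists_branch_mul_le (b := b) hd j S
    have := le_branch (b := b) (S := S') (t := c' - (g - ε) * S') hd W hW fun u hu => by
      have a1 := h u hu
      rw [hgS] at a1
      have a2 := key u
      have a3 : (c * degForm G u - adjForm G u + S * potForm b u) / S ≤ g * degForm G u := by
        rw [div_le_iff₀ hpos]
        linarith
      have a4 : (c' * degForm G u - adjForm G u + S' * potForm b u) / S'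
          ≤ (g - ε) * degForm G u := by linarith
      rw [div_le_iff₀ hpos'] at a4
      linarith
    rw [div_le_iff₀ hpos']
    linarith

end Branches

/-! ### Second order perturbation of the largest branch -/

section TopBranch

open scoped Matrix

set_option linter.unusedSectionVars false

variable {V : Type*} [Fintype V] [DecidableEq V] {G : SimpleGraph V} [DecidableRel G.Adj]
  {b : V → ℝ}

/-- The Laplacian `D - A` of a connected graph vanishes only on constants, where the rank one form
`(∑ deg u)²` is positive. The sum is positive definite, and `γ` is its least eigenvalue. -/
theorem exists_form_gap (hG : G.Connected) (hd : ∀ v, 0 < G.degree v) :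
    ∃ γ > 0, ∀ u : V → ℝ, (∑ v, (G.degree v : ℝ) * u v = 0) →
      γ * ∑ v, u v ^ 2 ≤ degForm G u - adjForm G u := by
  have := hG.nonempty
  set d : V → ℝ := fun v => G.degree v with hdd
  have hN : (G.lapMatrix ℝ + Matrix.vecMulVec d d).IsHermitian := by
    refine (G.isHermitian_lapMatrix ℝ).add ?_
    ext v w
    simp [Matrix.vecMulVec_apply, mul_comm]
  have hq : ∀ u : V → ℝ, u ⬝ᵥ (G.lapMatrix ℝ + Matrix.vecMulVec d d) *ᵥ u
      = degForm G u - adjForm G u + (∑ v, d v * u v) ^ 2 := by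
    intro u
    rw [Matrix.add_mulVec, dotProduct_add, degForm_sub_adjForm_eq,
      ← SimpleGraph.lapMatrix_toLinearMap₂', Matrix.toLinearMap₂'_apply', Matrix.vecMulVec_mulVec,
      pow_two]
    simp only [dotProduct, Pi.smul_apply, MulOpposite.smul_eq_mul_unop, MulOpposite.unop_op,
      Finset.mul_sum, Finset.sum_mul]
    congr 1
    exact Finset.sum_congr rfl fun _ _ => Finset.sum_congr rfl fun _ _ => by ring
  have hp : 0 < Fintype.card V := Fintype.card_pos
  let l : Fin (Fintype.card V) := ⟨Fintype.card V - 1, by omega⟩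
  refine ⟨hN.eigenvalues₀ l, ?_, fun u hu => ?_⟩
  · obtain ⟨W, hW, h⟩ := hN.exists_forall_le_eigenvalues₀_mul l
    have hW0 : 0 < Module.finrank ℝ W := by
      simp only [l] at hW
      omega
    have : Nontrivial W := Module.nontrivial_of_finrank_pos hW0
    obtain ⟨⟨x, hx⟩, hx0⟩ := exists_ne (0 : W)
    have hx0' : x ≠ 0 := fun h => hx0 (Subtype.ext h)
    have h1 := h x hx
    have hpos : 0 < x ⬝ᵥ x := by
      simpa using Matrix.dotProduct_star_self_pos_iff.2 hx0'
    have h2 : 0 < x ⬝ᵥ (G.lapMatrix ℝ + Matrix.vecMulVec d d) *ᵥ x := by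
      rw [hq]
      rcases (adjForm_le_degForm (G := G) x).eq_or_lt with h3 | h3
      · have h4 := apply_eq_of_adjForm_eq_degForm hG h3
        have h5 : x = fun _ => x (Classical.arbitrary V) := funext fun v => h4 _ _
        have h6 : x (Classical.arbitrary V) ≠ 0 := by
          intro h7
          apply hx0'
          rw [h5, h7]
          rfl
        have h7 : 0 < ∑ v, d v := Finset.sum_pos
          (fun v _ => by simpa [hdd] using hd v) Finset.univ_nonempty
        have h8 : ∑ v, d v * x v = (∑ v, d v) * x (Classical.arbitrary V) := by
          rw [Finset.sum_mul]
          exact Finset.sum_congr rfl fun v _ => by rw [h4 v]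
        rw [h8, h3, sub_self, zero_add]
        have := mul_ne_zero h7.ne' h6
        positivity
      · have := sq_nonneg (∑ v, d v * x v)
        linarith
    exact pos_of_mul_pos_left (h2.trans_le h1) hpos.le
  · obtain ⟨W, hW, h⟩ := hN.exists_forall_eigenvalues₀_mul_le l
    have hW1 : W = ⊤ := by
      apply Submodule.eq_top_of_finrank_eq
      have := Submodule.finrank_le W
      rw [Module.finrank_fintype_fun_eq_card] at this ⊢
      simp only [l] at hW
      omega
    have h1 := h u (hW1 ▸ Submodule.mem_top)
    rw [hq] at h1
    simp only [hdd] at h1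
    rw [hu] at h1
    simpa [dotProduct, ← pow_two] using h1

/-- The second order upper bound for the largest branch at `0`. -/
theorem exists_branch_top_le (hG : G.Connected) (hd : ∀ v, 0 < G.degree v) (b : V → ℝ) :
    ∃ C, ∃ δ > 0, ∀ j : Fin (Fintype.card V), ∀ S, |S| ≤ δ →
      branch G b j S ≤ 1 - S * meanPot G b + C * S ^ 2 := by
  have := hG.nonempty
  obtain ⟨γ, hγ, hgap⟩ := exists_form_gap hG hd
  -- Subtracting `β D` from the potential leaves `e` with `∑ e = 0`, which removes the term of first
  -- order on constants.
  set β := meanPot G b with hβ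
  set e : V → ℝ := fun v => b v - β * G.degree v with he
  have hD := degForm_one_pos (G := G) hd
  have hsum : ∑ v, e v = 0 := by
    have h1 : degForm G (fun _ => 1) = ∑ v, (G.degree v : ℝ) := by simp [degForm]
    have h2 : β * degForm G (fun _ => 1) = ∑ v, b v := div_mul_cancel₀ _ hD.ne'
    simp only [he, Finset.sum_sub_distrib, ← Finset.mul_sum, ← h1, h2, sub_self]
  set M₁ : ℝ := ∑ v, e v ^ 2 with hM₁
  set M₂ : ℝ := ∑ v, |e v| with hM₂
  have hM₁0 : 0 ≤ M₁ := Finset.sum_nonneg fun _ _ => sq_nonneg _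
  have hM₂0 : 0 ≤ M₂ := Finset.sum_nonneg fun _ _ => abs_nonneg _
  set C : ℝ := 2 * M₁ / γ with hC
  have hC0 : 0 ≤ C := by positivity
  have hd1 : 1 ≤ degForm G (fun _ => 1) := by
    have := sum_sq_le_degForm (G := G) hd (fun _ => 1)
    have h1 : (1 : ℝ) ≤ Fintype.card V := by exact_mod_cast Fintype.card_pos (α := V)
    simp at this
    linarith
  refine ⟨C, γ / (2 * (M₂ + 1)), by positivity, fun j S hS => ?_⟩
  have hS' : |S| * M₂ ≤ γ / 2 := by
    rw [le_div_iff₀ (by positivity)] at hS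
    nlinarith [abs_nonneg S]
  refine branch_le_of_forall hd fun u => ?_
  -- `a` is the degree-weighted mean, so that `u = y + a` with `y` orthogonal to the constants with
  -- respect to `D`.
  set a : ℝ := (∑ v, (G.degree v : ℝ) * u v) / degForm G (fun _ => 1) with ha
  set y : V → ℝ := fun v => u v - a with hy
  have hyu : u = fun v => y v + a := by ext v; simp [hy]
  have h1 : degForm G (fun _ => 1) = ∑ v, (G.degree v : ℝ) := by simp [degForm]
  have hy0 : ∑ v, (G.degree v : ℝ) * y v = 0 := by
    simp only [hy, mul_sub, Finset.sum_sub_distrib, ← Finset.sum_mul, ← h1, ha]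
    field_simp
    ring
  have hlap : degForm G u - adjForm G u = degForm G y - adjForm G y := by
    rw [degForm_sub_adjForm_eq, degForm_sub_adjForm_eq, hyu]
    simp
  have hdeg : degForm G u = degForm G y + a ^ 2 * degForm G (fun _ => 1) := by
    have : degForm G u = degForm G y + 2 * a * (∑ v, (G.degree v : ℝ) * y v)
        + a ^ 2 * degForm G (fun _ => 1) := by
      simp only [degForm, Finset.mul_sum, ← Finset.sum_add_distrib]
      exact Finset.sum_congr rfl fun v _ => by rw [congrFun hyu v]; ring
    rw [this, hy0]
    ring
  have hE : potForm b u - β * degForm G u = 2 * a * (∑ v, e v * y v) + potForm e y := by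
    have h2 : potForm b u - β * degForm G u
        = potForm e y + 2 * a * (∑ v, e v * y v) + a ^ 2 * ∑ v, e v := by
      simp only [potForm, degForm, Finset.mul_sum, ← Finset.sum_add_distrib,
        ← Finset.sum_sub_distrib]
      exact Finset.sum_congr rfl fun v _ => by rw [congrFun hyu v]; simp only [he]; ring
    rw [h2, hsum]
    ring
  set Y : ℝ := ∑ v, y v ^ 2 with hY
  have hcs : (∑ v, e v * y v) ^ 2 ≤ M₁ * Y := Finset.sum_mul_sq_le_sq_mul_sq _ _ _
  have hpe : |potForm e y| ≤ M₂ * Y := by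
    refine (Finset.abs_sum_le_sum_abs _ _).trans ?_
    rw [hM₂, Finset.sum_mul]
    refine Finset.sum_le_sum fun v _ => ?_
    rw [abs_mul, abs_of_nonneg (sq_nonneg (y v))]
    exact mul_le_mul_of_nonneg_left (Finset.single_le_sum (f := fun v => y v ^ 2)
      (fun _ _ => sq_nonneg _) (Finset.mem_univ v)) (abs_nonneg _)
  have hg := hgap y hy0
  have hY0 : 0 ≤ Y := Finset.sum_nonneg fun _ _ => sq_nonneg _
  -- The gap `γ Y` is spent in two halves. The first absorbs the quadratic term in `y`, which is
  -- possible by the choice of `δ`.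
  have k1 : -(γ / 2 * Y) ≤ S * potForm e y := by
    have := (abs_le.1 (abs_mul S (potForm e y)).le).1
    have h3 := mul_le_mul_of_nonneg_left hpe (abs_nonneg S)
    have h4 := mul_le_mul_of_nonneg_right hS' hY0
    linarith
  -- The second half and `C S² a²` absorb the cross term: by Cauchy–Schwarz the expression is
  -- nonnegative as soon as `C γ = 2 M₁`, after completing the square.
  have k2 : 0 ≤ γ / 2 * Y + S * (2 * a * (∑ v, e v * y v)) + C * S ^ 2 * a ^ 2 := by
    set q := ∑ v, e v * y v
    have h5 : C * γ = 2 * M₁ := by rw [hC]; field_simp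
    have h6 : 0 ≤ (γ / 2) * (γ / 2 * Y + S * (2 * a * q) + C * S ^ 2 * a ^ 2)  := by
      by_cases hz : M₁ = 0
      · have hq : q = 0 := by
          have : q ^ 2 ≤ 0 := by rw [hz] at hcs; linarith
          exact pow_eq_zero_iff two_ne_zero |>.1 (le_antisymm this (sq_nonneg _))
        rw [hq, mul_zero, mul_zero, add_zero]
        positivity
      · have hM : 0 < M₁ := lt_of_le_of_ne hM₁0 (Ne.symm hz)
        have h7 : 0 ≤ M₁ * ((γ / 2) * (γ / 2 * Y + S * (2 * a * q) + C * S ^ 2 * a ^ 2)) := by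
          have : M₁ * ((γ / 2) * (γ / 2 * Y + S * (2 * a * q) + C * S ^ 2 * a ^ 2))
            = (γ / 2) ^ 2 * (M₁ * Y - q ^ 2) + (γ / 2 * q + M₁ * S * a) ^ 2 := by
            linear_combination (M₁ / 2 * S ^ 2 * a ^ 2) * h5
          rw [this]
          have := sub_nonneg.2 hcs
          positivity
        exact nonneg_of_mul_nonneg_right h7 hM
    exact nonneg_of_mul_nonneg_right h6 (by positivity)
  have k3 : C * S ^ 2 * a ^ 2 ≤ C * S ^ 2 * degForm G u := by
    refine mul_le_mul_of_nonneg_left ?_ (by positivity)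
    rw [hdeg]
    nlinarith [degForm_nonneg (G := G) y, sq_nonneg a]
  have k4 : S * (potForm b u - β * degForm G u)
      = S * (2 * a * (∑ v, e v * y v)) + S * potForm e y := by rw [hE]; ring
  linarith

end TopBranch

/-! ### The fundamental solutions on an edge and the gaps between Dirichlet eigenvalues -/

section Scalar

/-- A strictly antitone function on both sides of a point of continuity is strictly antitone. -/
theorem strictAntiOn_of_continuousAt {s : Set ℝ} {f : ℝ → ℝ} {q : ℝ} (hs : s.OrdConnected)
    (hq : ContinuousAt f q) (h₁ : StrictAntiOn f (s ∩ Iio q)) (h₂ : StrictAntiOn f (s ∩ Ioi q)) :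
    StrictAntiOn f s := by
  have left : ∀ x ∈ s, q ∈ s → x < q → f q < f x := by
    intro x hx hqs hxq
    obtain ⟨m, hm1, hm2⟩ := exists_between hxq
    have hms : m ∈ s := hs.out hx hqs ⟨hm1.le, hm2.le⟩
    refine lt_of_le_of_lt ?_ (h₁ ⟨hx, hxq⟩ ⟨hms, hm2⟩ hm1)
    refine le_of_tendsto (hq.tendsto.mono_left (nhdsWithin_le_nhds (s := Iio q))) ?_
    filter_upwards [Ioo_mem_nhdsLT hm2] with y hy
    exact (h₁ ⟨hms, hm2⟩ ⟨hs.out hms hqs ⟨hy.1.le, hy.2.le⟩, hy.2⟩ hy.1).le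
  have right : ∀ x ∈ s, q ∈ s → q < x → f x < f q := by
    intro x hx hqs hxq
    obtain ⟨m, hm1, hm2⟩ := exists_between hxq
    have hms : m ∈ s := hs.out hqs hx ⟨hm1.le, hm2.le⟩
    refine lt_of_lt_of_le (h₂ ⟨hms, hm1⟩ ⟨hx, hxq⟩ hm2) ?_
    refine ge_of_tendsto (hq.tendsto.mono_left (nhdsWithin_le_nhds (s := Ioi q))) ?_
    filter_upwards [Ioo_mem_nhdsGT hm1] with y hy
    exact (h₂ ⟨hs.out hqs hms ⟨hy.1.le, hy.2.le⟩, hy.1⟩ ⟨hms, hm1⟩ hy.2).le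
  intro x hx y hy hxy
  rcases lt_trichotomy x q with h | rfl | h
  · rcases lt_trichotomy y q with h' | rfl | h'
    · exact h₁ ⟨hx, h⟩ ⟨hy, h'⟩ hxy
    · exact left x hx hy h
    · have hqs : q ∈ s := hs.out hx hy ⟨h.le, h'.le⟩
      exact (right y hy hqs h').trans (left x hx hqs h)
  · exact right y hy hx hxy
  · exact h₂ ⟨hx, h⟩ ⟨hy, h.trans hxy⟩ hxy

theorem existsUnique_zero_of_strictAntiOn {s : Set ℝ} {f : ℝ → ℝ} (hs : s.OrdConnected)
    (hf : ContinuousOn f s) (hm : StrictAntiOn f s) {a b : ℝ} (ha : a ∈ s) (hb : b ∈ s)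
    (hfa : 0 < f a) (hfb : f b < 0) : ∃! x, x ∈ s ∧ f x = 0 := by
  obtain ⟨x, hx, hx0⟩ := hs.isPreconnected.intermediate_value hb ha hf ⟨hfb.le, hfa.le⟩
  exact ⟨x, ⟨hx, hx0⟩, fun y hy => hm.injOn hy.1 hx (hy.2.trans hx0.symm)⟩

/-- `cos (√l x)`, as an entire function of `l`. -/
noncomputable def edgeCos (l x : ℝ) : ℝ := Real.cos (√l * x) * Real.cosh (√(-l) * x)

/-- `sin (√l x) / √l`, as an entire function of `l`. -/
noncomputable def edgeSin (l x : ℝ) : ℝ :=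
  x * Real.sinc (√l * x) * dslope Real.sinh 0 (√(-l) * x)

/-- The real square root of a negative number is `0`, so one of the trigonometric and the hyperbolic
factor is always trivial. The cases `l = s²`, `l = -s²` and `l = 0` cover every real `l`. -/
theorem edgeCos_sq {s : ℝ} (hs : 0 < s) (x : ℝ) : edgeCos (s ^ 2) x = Real.cos (s * x) := by
  rw [edgeCos, Real.sqrt_sq hs.le, Real.sqrt_eq_zero_of_nonpos (by nlinarith)]
  simp

theorem edgeSin_sq {s : ℝ} (hs : 0 < s) (x : ℝ) : edgeSin (s ^ 2) x = Real.sin (s * x) / s := by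
  rw [edgeSin, Real.sqrt_sq hs.le, Real.sqrt_eq_zero_of_nonpos (by nlinarith)]
  rcases eq_or_ne x 0 with rfl | hx
  · simp
  · rw [Real.sinc_of_ne_zero (mul_ne_zero hs.ne' hx)]
    simp
    field_simp

theorem edgeCos_neg_sq {s : ℝ} (hs : 0 < s) (x : ℝ) :
    edgeCos (-s ^ 2) x = Real.cosh (s * x) := by
  rw [edgeCos, neg_neg, Real.sqrt_sq hs.le, Real.sqrt_eq_zero_of_nonpos (by nlinarith)]
  simp

theorem edgeSin_neg_sq {s : ℝ} (hs : 0 < s) (x : ℝ) :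
    edgeSin (-s ^ 2) x = Real.sinh (s * x) / s := by
  rw [edgeSin, neg_neg, Real.sqrt_sq hs.le, Real.sqrt_eq_zero_of_nonpos (by nlinarith)]
  rcases eq_or_ne x 0 with rfl | hx
  · simp
  · rw [dslope_of_ne _ (mul_ne_zero hs.ne' hx), slope_def_field]
    simp
    field_simp

theorem edgeCos_zero_left (x : ℝ) : edgeCos 0 x = 1 := by simp [edgeCos]

theorem edgeSin_zero_left (x : ℝ) : edgeSin 0 x = x := by simp [edgeSin]

theorem edgeCos_zero_right (l : ℝ) : edgeCos l 0 = 1 := by simp [edgeCos]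

theorem edgeSin_zero_right (l : ℝ) : edgeSin l 0 = 0 := by simp [edgeSin]

theorem continuous_edgeCos (x : ℝ) : Continuous fun l => edgeCos l x := by
  unfold edgeCos
  fun_prop

theorem continuous_edgeSin (x : ℝ) : Continuous fun l => edgeSin l x := by
  have h : Continuous (dslope Real.sinh 0) := by
    refine continuous_iff_continuousAt.2 fun y => ?_
    rcases eq_or_ne y 0 with rfl | hy
    · exact continuousAt_dslope_same.2 Real.differentiable_sinh.differentiableAt
    · exact (continuousAt_dslope_of_ne hy).2 Real.continuous_sinh.continuousAt
  unfold edgeSin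
  have := Real.continuous_sinc
  fun_prop

theorem exists_sq_of_real (l : ℝ) :
    l = 0 ∨ (∃ s > 0, l = s ^ 2) ∨ ∃ s > 0, l = -s ^ 2 := by
  rcases lt_trichotomy l 0 with h | h | h
  · exact Or.inr (Or.inr ⟨√(-l), Real.sqrt_pos.2 (by linarith), by
      rw [Real.sq_sqrt (by linarith), neg_neg]⟩)
  · exact Or.inl h
  · exact Or.inr (Or.inl ⟨√l, Real.sqrt_pos.2 h, (Real.sq_sqrt h.le).symm⟩)

theorem hasDerivAt_const_mul_id (s x : ℝ) : HasDerivAt (fun x => s * x) s x := by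
  simpa using (hasDerivAt_id x).const_mul s

theorem hasDerivAt_edgeSin (l x : ℝ) : HasDerivAt (edgeSin l) (edgeCos l x) x := by
  rcases exists_sq_of_real l with rfl | ⟨s, hs, rfl⟩ | ⟨s, hs, rfl⟩
  · rw [funext edgeSin_zero_left, edgeCos_zero_left]
    exact hasDerivAt_id x
  · rw [funext (edgeSin_sq hs), edgeCos_sq hs]
    have := (hasDerivAt_const_mul_id s x).sin.div_const s
    rwa [mul_div_cancel_right₀ _ hs.ne'] at this
  · rw [funext (edgeSin_neg_sq hs), edgeCos_neg_sq hs]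
    have := (hasDerivAt_const_mul_id s x).sinh.div_const s
    rwa [mul_div_cancel_right₀ _ hs.ne'] at this

theorem hasDerivAt_edgeCos (l x : ℝ) : HasDerivAt (edgeCos l) (-l * edgeSin l x) x := by
  rcases exists_sq_of_real l with rfl | ⟨s, hs, rfl⟩ | ⟨s, hs, rfl⟩
  · rw [funext edgeCos_zero_left, neg_zero, zero_mul]
    exact hasDerivAt_const x 1
  · rw [funext (edgeCos_sq hs), edgeSin_sq hs]
    have := (hasDerivAt_const_mul_id s x).cos
    convert this using 1
    field_simp
  · rw [funext (edgeCos_neg_sq hs), edgeSin_neg_sq hs]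
    have := (hasDerivAt_const_mul_id s x).cosh
    convert this using 1
    field_simp

theorem edgeCos_sq_add (l x : ℝ) : edgeCos l x ^ 2 + l * edgeSin l x ^ 2 = 1 := by
  rcases exists_sq_of_real l with rfl | ⟨s, hs, rfl⟩ | ⟨s, hs, rfl⟩
  · simp [edgeCos_zero_left]
  · rw [edgeCos_sq hs, edgeSin_sq hs, div_pow, mul_div_cancel₀ _ (by positivity)]
    exact Real.cos_sq_add_sin_sq _
  · rw [edgeCos_neg_sq hs, edgeSin_neg_sq hs, div_pow, neg_mul,
      mul_div_cancel₀ _ (by positivity), Real.cosh_sq]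
    ring

theorem abs_edgeSin_le {l : ℝ} (hl : 0 < l) (x : ℝ) : |edgeSin l x| ≤ 1 / √l := by
  have hs := Real.sqrt_pos.2 hl
  conv_lhs => rw [← Real.sq_sqrt hl.le]
  rw [edgeSin_sq hs, abs_div, abs_of_pos hs]
  exact div_le_div_of_nonneg_right (Real.abs_sin_le_one _) hs.le

/-- The Dirichlet eigenvalues of an edge of length `ℓ`. -/
noncomputable def pole (ℓ : ℝ) (n : ℕ) : ℝ := (Real.pi * n / ℓ) ^ 2

/-- The interval between consecutive Dirichlet eigenvalues; for `n = 0` it is unbounded below. -/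
def poleGap (ℓ : ℝ) (n : ℕ) : Set ℝ := {l | (n ≠ 0 → pole ℓ n < l) ∧ l < pole ℓ (n + 1)}

variable {ℓ : ℝ}

theorem pole_strictMono (hℓ : 0 < ℓ) : StrictMono (pole ℓ) := by
  intro m n h
  have : (m : ℝ) < n := by exact_mod_cast h
  have := Real.pi_pos
  unfold pole
  gcongr

theorem pole_pos (hℓ : 0 < ℓ) {n : ℕ} (hn : n ≠ 0) : 0 < pole ℓ n := by
  have := Real.pi_pos
  have : (0 : ℝ) < n := by exact_mod_cast Nat.pos_of_ne_zero hn
  unfold pole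
  positivity

theorem sq_mem_poleGap (hℓ : 0 < ℓ) {s : ℝ} (hs : 0 < s) {n : ℕ} :
    s ^ 2 ∈ poleGap ℓ n ↔ (n : ℝ) * Real.pi < s * ℓ ∧ s * ℓ < (n + 1) * Real.pi := by
  have hpi := Real.pi_pos
  have h1 : ∀ m : ℕ, pole ℓ m < s ^ 2 ↔ (m : ℝ) * Real.pi < s * ℓ := by
    intro m
    rw [pole, sq_lt_sq₀ (by positivity) hs.le, div_lt_iff₀ hℓ, mul_comm]
  have h2 : ∀ m : ℕ, s ^ 2 < pole ℓ m ↔ s * ℓ < m * Real.pi := by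
    intro m
    rw [pole, sq_lt_sq₀ hs.le (by positivity), lt_div_iff₀ hℓ, mul_comm Real.pi]
  simp only [poleGap, mem_ofPred_eq, h1, h2, Nat.cast_add, Nat.cast_one]
  refine and_congr_left fun _ => ⟨fun h => ?_, fun h _ => h⟩
  rcases eq_or_ne n 0 with rfl | hn
  · simp only [Nat.cast_zero, zero_mul]
    positivity
  · exact h hn

theorem nonpos_mem_poleGap (hℓ : 0 < ℓ) {l : ℝ} (hl : l ≤ 0) {n : ℕ} :
    l ∈ poleGap ℓ n ↔ n = 0 := by
  constructor
  · intro h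
    by_contra hn
    have := h.1 hn
    have := pole_pos hℓ hn
    linarith
  · rintro rfl
    exact ⟨fun h => absurd rfl h, hl.trans_lt (pole_pos hℓ (by simp))⟩

theorem exists_mem_poleGap (hℓ : 0 < ℓ) (l : ℝ) :
    (∃ n, l ∈ poleGap ℓ n) ∨ ∃ n, n ≠ 0 ∧ l = pole ℓ n := by
  have hex : ∃ n : ℕ, l < pole ℓ (n + 1) := by
    obtain ⟨n, hn⟩ := exists_nat_gt (√(max l 0) * ℓ / Real.pi)
    refine ⟨n, ?_⟩
    have h1 : √(max l 0) < Real.pi * (n + 1 : ℕ) / ℓ := by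
      rw [div_lt_iff₀ Real.pi_pos] at hn
      rw [lt_div_iff₀ hℓ]
      push_cast
      nlinarith [Real.pi_pos]
    calc l ≤ max l 0 := le_max_left _ _
      _ = √(max l 0) ^ 2 := (Real.sq_sqrt (le_max_right _ _)).symm
      _ < pole ℓ (n + 1) := by unfold pole; gcongr
  classical
  have h1 := Nat.find_spec hex
  set n := Nat.find hex with hn
  by_cases h : n = 0
  · exact Or.inl ⟨n, fun h' => absurd h h', h1⟩
  · obtain ⟨m, hm⟩ := Nat.exists_eq_succ_of_ne_zero h
    have h2 : ¬ l < pole ℓ (m + 1) := Nat.find_min hex (m := m) (by omega)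
    rw [← Nat.succ_eq_add_one, ← hm] at h2
    rcases (not_lt.1 h2).eq_or_lt with h3 | h3
    · exact Or.inr ⟨n, h, h3.symm⟩
    · exact Or.inl ⟨n, fun _ => h3, h1⟩

theorem edgeSin_sign (hℓ : 0 < ℓ) {n : ℕ} {l : ℝ} (hl : l ∈ poleGap ℓ n) :
    0 < (-1) ^ n * edgeSin l ℓ := by
  rcases exists_sq_of_real l with rfl | ⟨s, hs, rfl⟩ | ⟨s, hs, rfl⟩
  · rw [nonpos_mem_poleGap hℓ le_rfl] at hl
    simpa [hl, edgeSin_zero_left] using hℓ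
  · rw [sq_mem_poleGap hℓ hs] at hl
    rw [edgeSin_sq hs, ← mul_div_assoc, ← Real.sin_sub_nat_mul_pi]
    exact div_pos (Real.sin_pos_of_pos_of_lt_pi (by linarith) (by linarith)) hs
  · rw [nonpos_mem_poleGap hℓ (by nlinarith)] at hl
    rw [edgeSin_neg_sq hs, hl, pow_zero, one_mul]
    exact div_pos (Real.sinh_pos_iff.2 (by positivity)) hs

theorem edgeSin_ne_zero (hℓ : 0 < ℓ) {n : ℕ} {l : ℝ} (hl : l ∈ poleGap ℓ n) :
    edgeSin l ℓ ≠ 0 := right_ne_zero_of_mul (edgeSin_sign hℓ hl).ne'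

theorem edge_pole (hℓ : 0 < ℓ) {n : ℕ} (hn : n ≠ 0) :
    edgeCos (pole ℓ n) ℓ = (-1) ^ n ∧ edgeSin (pole ℓ n) ℓ = 0 := by
  have hpi := Real.pi_pos
  have : (0 : ℝ) < n := by exact_mod_cast Nat.pos_of_ne_zero hn
  have hs : 0 < Real.pi * n / ℓ := by positivity
  have e : Real.pi * n / ℓ * ℓ = n * Real.pi := by field_simp
  rw [pole, edgeCos_sq hs, edgeSin_sq hs, e, Real.cos_nat_mul_pi, Real.sin_nat_mul_pi]
  simp

/-- The relation `σ² = 1` is what makes the numerator of the derivative factor; the sign of each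
factor can then be read off. -/
theorem hasDerivAt_trig_quotient {σ s : ℝ} (hσ : σ ^ 2 = 1) (h : Real.sin (s * ℓ) ≠ 0) :
    HasDerivAt (fun s => (Real.cos (s * ℓ) + σ) / (Real.sin (s * ℓ) / s))
      ((1 + σ * Real.cos (s * ℓ)) * (σ * Real.sin (s * ℓ) - s * ℓ) / Real.sin (s * ℓ) ^ 2) s := by
  have e : (fun s => (Real.cos (s * ℓ) + σ) / (Real.sin (s * ℓ) / s))
      = fun s => (Real.cos (s * ℓ) + σ) * s / Real.sin (s * ℓ) := by
    funext t
    rw [div_div_eq_mul_div]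
  rw [e]
  have hid : HasDerivAt (fun t : ℝ => t * ℓ) ℓ s := by
    simpa using (hasDerivAt_id s).mul_const ℓ
  have := ((hid.cos.add_const σ).fun_mul (hasDerivAt_id' s)).fun_div hid.sin h
  refine this.congr_deriv ?_
  congr 1
  linear_combination -(Real.cos (s * ℓ) * Real.sin (s * ℓ)) * hσ
    - s * ℓ * Real.sin_sq_add_cos_sq (s * ℓ)

theorem hasDerivAt_hyp_quotient {σ s : ℝ} (hσ : σ ^ 2 = 1) (h : Real.sinh (s * ℓ) ≠ 0) :
    HasDerivAt (fun s => (Real.cosh (s * ℓ) + σ) / (Real.sinh (s * ℓ) / s))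
      ((1 + σ * Real.cosh (s * ℓ)) * (σ * Real.sinh (s * ℓ) - s * ℓ) / Real.sinh (s * ℓ) ^ 2)
      s := by
  have e : (fun s => (Real.cosh (s * ℓ) + σ) / (Real.sinh (s * ℓ) / s))
      = fun s => (Real.cosh (s * ℓ) + σ) * s / Real.sinh (s * ℓ) := by
    funext t
    rw [div_div_eq_mul_div]
  rw [e]
  have hid : HasDerivAt (fun t : ℝ => t * ℓ) ℓ s := by
    simpa using (hasDerivAt_id s).mul_const ℓ
  have := ((hid.cosh.add_const σ).fun_mul (hasDerivAt_id' s)).fun_div hid.sinh h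
  refine this.congr_deriv ?_
  congr 1
  linear_combination -(Real.cosh (s * ℓ) * Real.sinh (s * ℓ)) * hσ
    - s * ℓ * Real.cosh_sq (s * ℓ)

/-- For `σ = 1` and `σ = -1` the quotients are `s cot (sℓ/2)` and `-s tan (sℓ/2)` with `l = s²`. In
the derivative `1 + σ cos` is positive off the poles, and `σ sin (sℓ) < sℓ`. -/
theorem strictAntiOn_trig (hℓ : 0 < ℓ) {σ : ℝ} (hσ : σ ^ 2 = 1) (n : ℕ) :
    StrictAntiOn (fun l => (edgeCos l ℓ + σ) / edgeSin l ℓ) (poleGap ℓ n ∩ Ioi 0) := by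
  have hpi := Real.pi_pos
  have h : StrictAntiOn (fun s => (Real.cos (s * ℓ) + σ) / (Real.sin (s * ℓ) / s))
      (Ioo (n * Real.pi / ℓ) ((n + 1) * Real.pi / ℓ)) := by
    have hy : ∀ s ∈ Ioo (n * Real.pi / ℓ) ((n + 1) * Real.pi / ℓ),
        0 < s * ℓ ∧ Real.sin (s * ℓ) ≠ 0 := by
      intro s hs
      rw [mem_Ioo, div_lt_iff₀ hℓ, lt_div_iff₀ hℓ] at hs
      refine ⟨lt_of_le_of_lt (by positivity) hs.1, fun h0 => ?_⟩
      have := Real.sin_pos_of_pos_of_lt_pi (x := s * ℓ - n * Real.pi) (by linarith)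
        (by linarith)
      rw [Real.sin_sub_nat_mul_pi, h0, mul_zero] at this
      exact lt_irrefl _ this
    refine strictAntiOn_of_deriv_neg (convex_Ioo _ _) (fun s hs => ?_) fun s hs => ?_
    · exact (hasDerivAt_trig_quotient hσ (hy s hs).2).continuousAt.continuousWithinAt
    · rw [interior_Ioo] at hs
      obtain ⟨h1, h2⟩ := hy s hs
      rw [(hasDerivAt_trig_quotient hσ h2).deriv]
      have h3 : 0 < Real.sin (s * ℓ) ^ 2 := by positivity
      refine div_neg_of_neg_of_pos (mul_neg_of_pos_of_neg ?_ ?_) h3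
      · have := Real.sin_sq_add_cos_sq (s * ℓ)
        nlinarith [sq_nonneg (σ - Real.cos (s * ℓ)), sq_nonneg (σ + Real.cos (s * ℓ)),
          sq_nonneg (1 + σ * Real.cos (s * ℓ))]
      · have h4 : |Real.sin (s * ℓ)| < s * ℓ := by
          simpa [abs_of_pos h1] using Real.abs_sin_lt_abs h1.ne'
        rw [abs_lt] at h4
        rcases sq_eq_sq_iff_eq_or_eq_neg.1 (hσ.trans (one_pow 2).symm) with rfl | rfl <;> linarith
  intro l₁ h₁ l₂ h₂ hlt
  have p₁ : 0 < √l₁ := Real.sqrt_pos.2 h₁.2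
  have p₂ : 0 < √l₂ := Real.sqrt_pos.2 h₂.2
  have e₁ := Real.sq_sqrt (le_of_lt h₁.2)
  have e₂ := Real.sq_sqrt (le_of_lt h₂.2)
  have m₁ := h₁.1
  have m₂ := h₂.1
  rw [← e₁, sq_mem_poleGap hℓ p₁] at m₁
  rw [← e₂, sq_mem_poleGap hℓ p₂] at m₂
  have := h (a := √l₁) (b := √l₂)
    ⟨by rw [div_lt_iff₀ hℓ]; exact m₁.1, by rw [lt_div_iff₀ hℓ]; exact m₁.2⟩
    ⟨by rw [div_lt_iff₀ hℓ]; exact m₂.1, by rw [lt_div_iff₀ hℓ]; exact m₂.2⟩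
    (Real.sqrt_lt_sqrt (le_of_lt h₁.2) hlt)
  simp only [← edgeCos_sq p₁, ← edgeCos_sq p₂, ← edgeSin_sq p₁, ← edgeSin_sq p₂, e₁, e₂] at this
  exact this

/-- With `l = -s²` the quotient increases in `s`, since the two factors of its derivative have the
same sign for either `σ`. The substitution reverses the order. -/
theorem strictAntiOn_hyp (hℓ : 0 < ℓ) {σ : ℝ} (hσ : σ ^ 2 = 1) :
    StrictAntiOn (fun l => (edgeCos l ℓ + σ) / edgeSin l ℓ) (Iio 0) := by
  have h : StrictMonoOn (fun s => (Real.cosh (s * ℓ) + σ) / (Real.sinh (s * ℓ) / s))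
      (Ioi 0) := by
    have hy : ∀ s ∈ Ioi (0 : ℝ), 0 < s * ℓ ∧ 0 < Real.sinh (s * ℓ) := by
      intro s hs
      have : 0 < s * ℓ := mul_pos hs hℓ
      exact ⟨this, Real.sinh_pos_iff.2 this⟩
    refine strictMonoOn_of_deriv_pos (convex_Ioi _) (fun s hs => ?_) fun s hs => ?_
    · exact (hasDerivAt_hyp_quotient hσ (hy s hs).2.ne').continuousAt.continuousWithinAt
    · rw [interior_Ioi] at hs
      obtain ⟨h1, h2⟩ := hy s hs
      rw [(hasDerivAt_hyp_quotient hσ h2.ne').deriv]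
      refine div_pos ?_ (by positivity)
      have h3 := Real.one_lt_cosh.2 h1.ne'
      have h4 := Real.self_lt_sinh_iff.2 h1
      rcases sq_eq_sq_iff_eq_or_eq_neg.1 (hσ.trans (one_pow 2).symm) with rfl | rfl
      · exact mul_pos (by linarith) (by linarith)
      · exact mul_pos_of_neg_of_neg (by linarith) (by linarith)
  intro l₁ h₁ l₂ h₂ hlt
  rw [mem_Iio] at h₁ h₂
  have p₁ : 0 < √(-l₁) := Real.sqrt_pos.2 (by linarith)
  have p₂ : 0 < √(-l₂) := Real.sqrt_pos.2 (by linarith)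
  have e₁ : -√(-l₁) ^ 2 = l₁ := by rw [Real.sq_sqrt (by linarith), neg_neg]
  have e₂ : -√(-l₂) ^ 2 = l₂ := by rw [Real.sq_sqrt (by linarith), neg_neg]
  have := h p₂ p₁ (Real.sqrt_lt_sqrt (by linarith) (by linarith : -l₂ < -l₁))
  simp only [← edgeCos_neg_sq p₁, ← edgeCos_neg_sq p₂, ← edgeSin_neg_sq p₁,
    ← edgeSin_neg_sq p₂, e₁, e₂] at this
  exact this

theorem ordConnected_poleGap (ℓ : ℝ) (n : ℕ) : (poleGap ℓ n).OrdConnected :=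
  ⟨fun _ hx _ hy _ hz => ⟨fun h => (hx.1 h).trans_le hz.1, hz.2.trans_lt hy.2⟩⟩

/-- Monotonicity for positive and for negative `l` is glued at `0`, where the denominator is `ℓ` and
the quotient is continuous. -/
theorem strictAntiOn_edge_quotient (hℓ : 0 < ℓ) {σ : ℝ} (hσ : σ ^ 2 = 1) (n : ℕ) :
    StrictAntiOn (fun l => (edgeCos l ℓ + σ) / edgeSin l ℓ) (poleGap ℓ n) := by
  refine strictAntiOn_of_continuousAt (q := 0) (ordConnected_poleGap ℓ n) ?_ ?_
    (strictAntiOn_trig hℓ hσ n)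
  · refine ContinuousAt.div (((continuous_edgeCos ℓ).add continuous_const).continuousAt)
      (continuous_edgeSin ℓ).continuousAt ?_
    rw [edgeSin_zero_left]
    exact hℓ.ne'
  · exact (strictAntiOn_hyp hℓ hσ).mono inter_subset_right

/-- Far to the left, `edgeCos - 1` dominates any multiple of `edgeSin`. -/
theorem exists_edgeSin_lt (hℓ : 0 < ℓ) (M : ℝ) :
    ∃ l < 0, 0 < edgeSin l ℓ ∧ M * edgeSin l ℓ < edgeCos l ℓ - 1 := by
  -- The bound `r ℓ ≥ 2` gives `exp (r ℓ) ≥ 3`, which is exactly what `cosh - 1 ≥ sinh / 2` needs;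
  -- `r > 2 M` then beats the factor `M`.
  set r := max (2 / ℓ) (2 * |M| + 1) with hr
  have hr0 : 0 < r := lt_of_lt_of_le (by positivity) (le_max_right _ _)
  have h1 : 2 ≤ r * ℓ := by
    rw [← div_le_iff₀ hℓ]
    exact le_max_left _ _
  have h2 : 2 * M < r := by
    have : 2 * |M| + 1 ≤ r := le_max_right _ _
    linarith [le_abs_self M]
  have h3 : 0 < Real.sinh (r * ℓ) := Real.sinh_pos_iff.2 (by linarith)
  refine ⟨-r ^ 2, by nlinarith, ?_, ?_⟩
  · rw [edgeSin_neg_sq hr0]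
    positivity
  · rw [edgeSin_neg_sq hr0, edgeCos_neg_sq hr0]
    have h4 : Real.sinh (r * ℓ) / 2 ≤ Real.cosh (r * ℓ) - 1 := by
      rw [Real.sinh_eq, Real.cosh_eq]
      have h5 : 3 ≤ Real.exp (r * ℓ) := by
        have := Real.add_one_le_exp (r * ℓ)
        linarith
      have h6 : Real.exp (-(r * ℓ)) * Real.exp (r * ℓ) = 1 := by
        rw [← Real.exp_add]; simp
      have h7 := Real.exp_pos (-(r * ℓ))
      nlinarith
    refine lt_of_lt_of_le ?_ h4
    rw [← mul_div_assoc, div_lt_div_iff₀ hr0 two_pos]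
    nlinarith

end Scalar

/-! ### Existence and uniqueness of the zeros on the branches -/

section Zeros

set_option linter.unusedSectionVars false

variable {V : Type*} [Fintype V] [DecidableEq V] {G : SimpleGraph V} [DecidableRel G.Adj]
  {b : V → ℝ} {ℓ : ℝ}

theorem SimpleGraph.IsTree.degree_pos_of_two_le_card (hG : G.IsTree) (hp : 2 ≤ Fintype.card V)
    (v : V) : 0 < G.degree v := by
  have : Nontrivial V := Fintype.one_lt_card_iff_nontrivial.1 hp
  exact hG.connected.preconnected.degree_pos_of_nontrivial v

theorem SimpleGraph.IsTree.exists_sign (hG : G.IsTree) :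
    ∃ σ : V → ℝ, (∀ v, σ v ^ 2 = 1) ∧ ∀ v w, G.Adj v w → σ v = -σ w := by
  have := hG.connected.nonempty
  refine ⟨fun v => (-1) ^ G.dist (Classical.arbitrary V) v, fun v => ?_, fun v w h => ?_⟩
  · rw [← pow_mul, mul_comm, pow_mul]
    simp
  · rcases hG.dist_eq_dist_add_one_of_adj (Classical.arbitrary V) h with e | e <;>
      simp only [e, pow_succ] <;> ring

theorem branch_mem_Ioo (hG : G.IsTree) (hp : 2 ≤ Fintype.card V) {j : Fin (Fintype.card V)}
    (h0 : (j : ℕ) ≠ 0) (h1 : (j : ℕ) + 1 ≠ Fintype.card V) :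
    branch G b j 0 ∈ Ioo (-1 : ℝ) 1 := by
  have hd := hG.degree_pos_of_two_le_card hp
  obtain ⟨σ, hσ, hadj⟩ := hG.exists_sign
  refine ⟨?_, branch_zero_lt_one hG.connected hd h0⟩
  have h2 := branch_zero_lt_one (b := b) hG.connected hd (j := j.rev) (by rw [Fin.val_rev]; omega)
  rw [branch_rev hσ hadj hd, neg_zero] at h2
  linarith

/-- The branch evaluated along the spectral parameter, as an eigenvalue of the scaled
Dirichlet-to-Neumann form, with the sign `ε` for the reflected branch. -/
noncomputable def branchQuotient (G : SimpleGraph V) [DecidableRel G.Adj] (b : V → ℝ) (ℓ ε : ℝ)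
    (j : Fin (Fintype.card V)) (l : ℝ) : ℝ :=
  (ε * edgeCos l ℓ - branch G b j (ε * edgeSin l ℓ)) / (ε * edgeSin l ℓ)

/-- Apply `branch_quotient_lt` to `ε c` and `ε S`. The sign `ε` at most interchanges the quotients
with `c - 1` and `c + 1`, and `S` keeps its sign inside a gap. -/
theorem strictAntiOn_branchQuotient (hG : G.IsTree) (hp : 2 ≤ Fintype.card V) (hℓ : 0 < ℓ)
    {ε : ℝ} (hε : ε ^ 2 = 1) (j : Fin (Fintype.card V)) (n : ℕ) :
    StrictAntiOn (branchQuotient G b ℓ ε j) (poleGap ℓ n) := by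
  have hd := hG.degree_pos_of_two_le_card hp
  obtain ⟨σ, hσ, hadj⟩ := hG.exists_sign
  intro l hl l' hl' hlt
  have hε0 : ε ≠ 0 := fun h => by simp [h] at hε
  have e : ∀ c S : ℝ, (ε * c - 1) / (ε * S) = (c + -ε) / S ∧
      (ε * c + 1) / (ε * S) = (c + ε) / S := by
    intro c S
    rw [← mul_div_mul_left (c + -ε) S hε0, ← mul_div_mul_left (c + ε) S hε0]
    constructor
    · congr 1; linear_combination hε
    · congr 1; linear_combination -hε
  refine branch_quotient_lt hσ hadj hd j ?_ ?_ ?_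
  · have h1 := edgeSin_sign hℓ hl
    have h2 := edgeSin_sign hℓ hl'
    have h3 := mul_pos h1 h2
    have h4 : ((-1 : ℝ) ^ n) * (-1) ^ n = 1 := by rw [← mul_pow]; simp
    have : ε * edgeSin l ℓ * (ε * edgeSin l' ℓ)
        = (-1) ^ n * edgeSin l ℓ * ((-1) ^ n * edgeSin l' ℓ) := by
      linear_combination (edgeSin l ℓ * edgeSin l' ℓ) * hε - (edgeSin l ℓ * edgeSin l' ℓ) * h4
    rwa [this]
  · rw [(e _ _).1, (e _ _).1]
    exact strictAntiOn_edge_quotient hℓ (by rwa [neg_sq]) n hl hl' hlt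
  · rw [(e _ _).2, (e _ _).2]
    exact strictAntiOn_edge_quotient hℓ hε n hl hl' hlt

theorem continuous_branch_edge (hd : ∀ v, 0 < G.degree v) (ε : ℝ) (j : Fin (Fintype.card V)) :
    Continuous fun l => ε * edgeCos l ℓ - branch G b j (ε * edgeSin l ℓ) :=
  (continuous_const.mul (continuous_edgeCos ℓ)).sub
    ((continuous_branch hd j).comp (continuous_const.mul (continuous_edgeSin ℓ)))

theorem continuousAt_branchQuotient (hd : ∀ v, 0 < G.degree v) {ε : ℝ} (hε : ε ^ 2 = 1)
    (j : Fin (Fintype.card V)) {l : ℝ} (hl : edgeSin l ℓ ≠ 0) :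
    ContinuousAt (branchQuotient G b ℓ ε j) l := by
  have hε0 : ε ≠ 0 := fun h => by simp [h] at hε
  exact (continuous_branch_edge hd ε j).continuousAt.div
    (continuous_const.mul (continuous_edgeSin ℓ)).continuousAt (mul_ne_zero hε0 hl)

theorem exists_mem_poleGap_right (hℓ : 0 < ℓ) (n : ℕ) {f : ℝ → ℝ}
    (hf : Continuous f) (h : 0 < f (pole ℓ n)) : ∃ l ∈ poleGap ℓ n, 0 < f l := by
  have h1 : ∀ᶠ l in 𝓝[>] pole ℓ n, 0 < f l :=
    nhdsWithin_le_nhds (hf.continuousAt.eventually (lt_mem_nhds h))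
  have h2 := Ioo_mem_nhdsGT (pole_strictMono hℓ (Nat.lt_succ_self n))
  obtain ⟨l, hl1, hl2⟩ := (h1.and h2).exists
  exact ⟨l, ⟨fun _ => hl2.1, hl2.2⟩, hl1⟩

theorem exists_mem_poleGap_left (hℓ : 0 < ℓ) (n : ℕ) {f : ℝ → ℝ}
    (hf : Continuous f) (h : 0 < f (pole ℓ (n + 1))) : ∃ l ∈ poleGap ℓ n, 0 < f l := by
  have h1 : ∀ᶠ l in 𝓝[<] pole ℓ (n + 1), 0 < f l :=
    nhdsWithin_le_nhds (hf.continuousAt.eventually (lt_mem_nhds h))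
  have h2 := Ioo_mem_nhdsLT (pole_strictMono hℓ (Nat.lt_succ_self n))
  obtain ⟨l, hl1, hl2⟩ := (h1.and h2).exists
  exact ⟨l, ⟨fun _ => hl2.1, hl2.2⟩, hl1⟩

/-- As `l → -∞`, `edgeCos` outgrows every multiple of `edgeSin`, whereas the branches grow at most
linearly in `S`. This replaces the missing left pole of the gap with index `0`. -/
theorem exists_branch_lt_edgeCos (hd : ∀ v, 0 < G.degree v) (hℓ : 0 < ℓ) :
    ∃ l ∈ poleGap ℓ 0, 0 < edgeSin l ℓ ∧
      ∀ j, branch G b j (edgeSin l ℓ) < edgeCos l ℓ := by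
  obtain ⟨l, hl, h1, h2⟩ := exists_edgeSin_lt hℓ (∑ v, |b v|)
  refine ⟨l, (nonpos_mem_poleGap hℓ hl.le).2 rfl, h1, fun j => ?_⟩
  have h3 := branch_le_add (b := b) hd j (edgeSin l ℓ) 0
  have h4 := branch_zero_le_one (b := b) hd j
  rw [sub_zero, abs_of_pos h1] at h3
  linarith

theorem branchQuotient_eq_zero_iff {ε : ℝ} (hε : ε ^ 2 = 1) {j : Fin (Fintype.card V)} {l : ℝ}
    (hl : edgeSin l ℓ ≠ 0) : branchQuotient G b ℓ ε j l = 0 ↔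
      ε * edgeCos l ℓ = branch G b j (ε * edgeSin l ℓ) := by
  have hε0 : ε ≠ 0 := fun h => by simp [h] at hε
  rw [branchQuotient, div_eq_zero_iff, or_iff_left (mul_ne_zero hε0 hl), sub_eq_zero]

/-- At a pole `S = 0` and `c = ±1`, while the branch lies strictly between `-1` and `1`. Thus the
quotient is positive near the left end of the gap and negative near the right end, and it is
strictly decreasing. -/
theorem existsUnique_branch_zero (hG : G.IsTree) (hp : 2 ≤ Fintype.card V) (hℓ : 0 < ℓ)
    {j : Fin (Fintype.card V)} (h0 : (j : ℕ) ≠ 0) (h1 : (j : ℕ) + 1 ≠ Fintype.card V) (n : ℕ) :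
    ∃! l, l ∈ poleGap ℓ n ∧ edgeCos l ℓ = branch G b j (edgeSin l ℓ) := by
  have hd := hG.degree_pos_of_two_le_card hp
  have hz := branch_mem_Ioo (b := b) hG hp h0 h1
  have hone : ((1 : ℝ)) ^ 2 = 1 := one_pow 2
  have hn1 : ((-1 : ℝ) ^ n) * (-1) ^ n = 1 := by rw [← mul_pow]; simp
  have hcont := continuous_branch_edge (b := b) (ℓ := ℓ) hd 1 j
  simp only [one_mul] at hcont
  have hsign : ∀ l ∈ poleGap ℓ n, branchQuotient G b ℓ 1 j l
      = ((-1) ^ n * (edgeCos l ℓ - branch G b j (edgeSin l ℓ))) / ((-1) ^ n * edgeSin l ℓ) := by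
    intro l _
    rw [mul_div_mul_left _ _ (left_ne_zero_of_mul_eq_one hn1), branchQuotient]
    simp only [one_mul]
  have hpos : ∃ l ∈ poleGap ℓ n, 0 < branchQuotient G b ℓ 1 j l := by
    rcases eq_or_ne n 0 with rfl | hn
    · obtain ⟨l, hl, h2, h3⟩ := exists_branch_lt_edgeCos (b := b) hd hℓ
      refine ⟨l, hl, ?_⟩
      simp only [branchQuotient, one_mul]
      exact div_pos (sub_pos.2 (h3 j)) h2
    · obtain ⟨l, hl, h2⟩ := exists_mem_poleGap_right hℓ n (continuous_const.mul hcont)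
        (f := fun l => (-1) ^ n * (edgeCos l ℓ - branch G b j (edgeSin l ℓ))) (by
          rw [(edge_pole hℓ hn).1, (edge_pole hℓ hn).2, mul_sub, hn1]
          rcases neg_one_pow_eq_or ℝ n with h | h <;> rw [h] <;> linarith [hz.1, hz.2])
      exact ⟨l, hl, by rw [hsign l hl]; exact div_pos h2 (edgeSin_sign hℓ hl)⟩
  have hneg : ∃ l ∈ poleGap ℓ n, branchQuotient G b ℓ 1 j l < 0 := by
    obtain ⟨l, hl, h2⟩ := exists_mem_poleGap_left hℓ n (continuous_const.mul hcont).neg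
      (f := fun l => -((-1) ^ n * (edgeCos l ℓ - branch G b j (edgeSin l ℓ)))) (by
        rw [(edge_pole hℓ n.succ_ne_zero).1, (edge_pole hℓ n.succ_ne_zero).2, mul_sub, pow_succ,
          ← mul_assoc, hn1]
        rcases neg_one_pow_eq_or ℝ n with h | h <;> rw [h] <;> linarith [hz.1, hz.2])
    refine ⟨l, hl, ?_⟩
    rw [hsign l hl]
    exact div_neg_of_neg_of_pos (neg_pos.1 h2) (edgeSin_sign hℓ hl)
  obtain ⟨x, hx, hx'⟩ := hpos
  obtain ⟨y, hy, hy'⟩ := hneg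
  have := existsUnique_zero_of_strictAntiOn (ordConnected_poleGap ℓ n)
    (fun l hl => (continuousAt_branchQuotient (b := b) hd hone j
      (edgeSin_ne_zero hℓ hl)).continuousWithinAt)
    (strictAntiOn_branchQuotient hG hp hℓ hone j n) hx hy hx' hy'
  refine (existsUnique_congr fun l => ?_).1 this
  refine and_congr_right fun hl => ?_
  rw [branchQuotient_eq_zero_iff hone (edgeSin_ne_zero hℓ hl), one_mul, one_mul]

/-- At the `k`-th pole `ε c = 1 = branch j 0`, so the quotient is of the form `0/0`. Its limit is
minus the derivative of the top branch at `0`, because `ε c - 1` is of second order in `S`. -/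
theorem tendsto_branchQuotient_pole (hG : G.IsTree) (hp : 2 ≤ Fintype.card V) (hℓ : 0 < ℓ)
    {j : Fin (Fintype.card V)} (hj : (j : ℕ) = 0) {k : ℕ} (hk : k ≠ 0) :
    Tendsto (branchQuotient G b ℓ ((-1) ^ k) j) (𝓝[≠] pole ℓ k) (𝓝 (meanPot G b)) := by
  have hd := hG.degree_pos_of_two_le_card hp
  have := hG.connected.nonempty
  set ε : ℝ := (-1) ^ k with hεd
  have hε : ε ^ 2 = 1 := by rw [hεd, ← pow_mul, mul_comm, pow_mul]; simp
  have hε0 : ε ≠ 0 := fun h => by simp [h] at hε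
  obtain ⟨hc0, hs0⟩ := edge_pole hℓ hk
  obtain ⟨C, δ, hδ, hC⟩ := exists_branch_top_le hG.connected hd b
  have hcS : Continuous fun l => ε * edgeSin l ℓ := continuous_const.mul (continuous_edgeSin ℓ)
  have hcC : Continuous fun l => 1 + ε * edgeCos l ℓ :=
    continuous_const.add (continuous_const.mul (continuous_edgeCos ℓ))
  have hC2 : 1 + ε * edgeCos (pole ℓ k) ℓ = 2 := by
    rw [hc0, ← pow_two, hε]
    norm_num
  have hlim : Tendsto (fun l => |C| * |ε * edgeSin l ℓ| +
      |l * (ε * edgeSin l ℓ) / (1 + ε * edgeCos l ℓ)|) (𝓝[≠] pole ℓ k) (𝓝 0) := by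
    have : ContinuousAt (fun l => |C| * |ε * edgeSin l ℓ| +
        |l * (ε * edgeSin l ℓ) / (1 + ε * edgeCos l ℓ)|) (pole ℓ k) := by
      refine (continuous_const.mul hcS.abs).continuousAt.add (ContinuousAt.abs ?_)
      exact (continuous_id.mul hcS).continuousAt.div hcC.continuousAt (by rw [hC2]; norm_num)
    have h2 := this.tendsto.mono_left (nhdsWithin_le_nhds (s := {pole ℓ k}ᶜ))
    simpa [hs0] using h2
  have hgap : ∀ᶠ l in 𝓝[≠] pole ℓ k, edgeSin l ℓ ≠ 0 := by
    have h1 : ∀ᶠ l in 𝓝 (pole ℓ k), l ∈ Ioo (pole ℓ (k - 1)) (pole ℓ (k + 1)) :=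
      Ioo_mem_nhds (pole_strictMono hℓ (by omega)) (pole_strictMono hℓ (by omega))
    filter_upwards [nhdsWithin_le_nhds h1, self_mem_nhdsWithin] with l hl hne
    rcases lt_or_gt_of_ne hne with h | h
    · refine edgeSin_ne_zero hℓ (n := k - 1) ⟨fun _ => hl.1, ?_⟩
      rwa [Nat.sub_add_cancel (Nat.pos_of_ne_zero hk)]
    · exact edgeSin_ne_zero hℓ (n := k) ⟨fun _ => h, hl.2⟩
  have hsmall : ∀ᶠ l in 𝓝[≠] pole ℓ k, |ε * edgeSin l ℓ| < δ := by
    refine nhdsWithin_le_nhds (hcS.abs.continuousAt.eventually (gt_mem_nhds ?_))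
    simpa [hs0] using hδ
  have hden : ∀ᶠ l in 𝓝[≠] pole ℓ k, 1 + ε * edgeCos l ℓ ≠ 0 :=
    nhdsWithin_le_nhds (hcC.continuousAt.eventually_ne (by rw [hC2]; norm_num))
  rw [tendsto_iff_dist_tendsto_zero]
  refine squeeze_zero' (Eventually.of_forall fun _ => dist_nonneg) ?_ hlim
  filter_upwards [hgap, hsmall, hden] with l h1 h2 h3
  rw [Real.dist_eq]
  set S := ε * edgeSin l ℓ with hS
  have hS0 : S ≠ 0 := mul_ne_zero hε0 h1
  have hlow := le_branch_top (b := b) hd hj S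
  have hup := hC j S h2.le
  -- The identity `c² + l S² = 1` rewrites `(ε c - 1) / S` as `-l S / (1 + ε c)`, with denominator
  -- tending to `2`. The remaining term is `O(S)` by the first order lower and second order upper
  -- bound.
  have e1 : branchQuotient G b ℓ ε j l - meanPot G b
      = (1 - S * meanPot G b - branch G b j S) / S
        + -(l * S / (1 + ε * edgeCos l ℓ)) := by
    have e2 := edgeCos_sq_add l ℓ
    rw [branchQuotient, ← hS]
    field_simp
    have : l * S ^ 2 = 1 - (ε * edgeCos l ℓ) ^ 2 := by
      rw [hS, mul_pow, mul_pow]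
      linear_combination ε ^ 2 * e2 + hε
    linear_combination this
  rw [e1]
  refine (abs_add_le _ _).trans (add_le_add ?_ (abs_neg _).le)
  rw [abs_div, div_le_iff₀ (abs_pos.2 hS0), abs_le]
  have e3 : |C| * |S| * |S| = |C| * S ^ 2 := by rw [mul_assoc, ← pow_two, sq_abs]
  have e4 : C * S ^ 2 ≤ |C| * S ^ 2 := mul_le_mul_of_nonneg_right (le_abs_self C) (sq_nonneg S)
  have e5 : 0 ≤ |C| * S ^ 2 := by positivity
  rw [e3]
  constructor <;> linarith

/-- The interval between the neighbours of the `k`-th Dirichlet eigenvalue; unbounded below for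
`k ≤ 1`. -/
def wideGap (ℓ : ℝ) (k : ℕ) : Set ℝ := {l | (2 ≤ k → pole ℓ (k - 1) < l) ∧ l < pole ℓ (k + 1)}

theorem ordConnected_wideGap (ℓ : ℝ) (n : ℕ) : (wideGap ℓ n).OrdConnected :=
  ⟨fun _ hx _ hy _ hz => ⟨fun h => (hx.1 h).trans_le hz.1, hz.2.trans_lt hy.2⟩⟩

theorem mem_wideGap_of_mem_poleGap (hℓ : 0 < ℓ) {k : ℕ} {l : ℝ} (hl : l ∈ poleGap ℓ k) :
    l ∈ wideGap ℓ k :=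
  ⟨fun h => (pole_strictMono hℓ (by omega)).trans (hl.1 (by omega)), hl.2⟩

theorem mem_wideGap_succ_of_mem_poleGap (hℓ : 0 < ℓ) {k : ℕ} {l : ℝ} (hl : l ∈ poleGap ℓ k) :
    l ∈ wideGap ℓ (k + 1) :=
  ⟨fun h => by simpa using hl.1 (by omega), hl.2.trans (pole_strictMono hℓ (by omega))⟩

theorem mem_poleGap_of_mem_wideGap_of_gt {k : ℕ} {l : ℝ} (hl : l ∈ wideGap ℓ k)
    (h : k ≠ 0 → pole ℓ k < l) : l ∈ poleGap ℓ k := ⟨h, hl.2⟩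

theorem mem_poleGap_of_mem_wideGap_of_lt {k : ℕ} {l : ℝ} (hl : l ∈ wideGap ℓ (k + 1))
    (h : l < pole ℓ (k + 1)) : l ∈ poleGap ℓ k :=
  ⟨fun hk => by simpa using hl.1 (by omega), h⟩

/-- `l` is the eigenvalue on the extreme branches with number `k`. -/
def IsExtremeZero (G : SimpleGraph V) [DecidableRel G.Adj] (b : V → ℝ) (ℓ : ℝ)
    (j : Fin (Fintype.card V)) (k : ℕ) (l : ℝ) : Prop :=
  l ∈ wideGap ℓ k ∧ ((k ≠ 0 ∧ l = pole ℓ k ∧ ∑ v, b v = 0) ∨ (¬ (k ≠ 0 ∧ l = pole ℓ k) ∧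
    (-1) ^ k * edgeCos l ℓ = branch G b j ((-1) ^ k * edgeSin l ℓ)))

/-- The equation alone always holds at the `k`-th pole, hence the separate condition there. The
zeros are those of the signed quotient, extended across the pole by `meanPot`, which vanishes
exactly when `∑ b = 0`. -/
theorem existsUnique_isExtremeZero (hG : G.IsTree) (hp : 2 ≤ Fintype.card V) (hℓ : 0 < ℓ)
    {j : Fin (Fintype.card V)} (hj : (j : ℕ) = 0) (k : ℕ) :
    ∃! l, IsExtremeZero G b ℓ j k l := by
  have hd := hG.degree_pos_of_two_le_card hp
  have := hG.connected.nonempty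
  set ε : ℝ := (-1) ^ k with hεd
  have hε : ε ^ 2 = 1 := by rw [hεd, ← pow_mul, mul_comm, pow_mul]; simp
  have hε0 : ε ≠ 0 := fun h => by simp [h] at hε
  have hz := branch_top_zero (b := b) hd hj
  have hcont := continuous_branch_edge (b := b) (ℓ := ℓ) hd ε j
  obtain ⟨y, hy, hy'⟩ : ∃ l ∈ poleGap ℓ k, branchQuotient G b ℓ ε j l < 0 := by
    obtain ⟨l, hl, h2⟩ := exists_mem_poleGap_left hℓ k hcont.neg
      (f := fun l => -(ε * edgeCos l ℓ - branch G b j (ε * edgeSin l ℓ))) (by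
        rw [(edge_pole hℓ k.succ_ne_zero).1, (edge_pole hℓ k.succ_ne_zero).2, mul_zero, hz,
          pow_succ, ← hεd]
        nlinarith)
    exact ⟨l, hl, div_neg_of_neg_of_pos (neg_pos.1 h2) (edgeSin_sign hℓ hl)⟩
  -- For `k = 0` there is no pole to cross, since `pole ℓ 0 = 0` is not a Dirichlet eigenvalue and
  -- the wide gap is an ordinary one.
  rcases eq_or_ne k 0 with hk | hk
  · obtain ⟨x, hx, h2, h3⟩ := exists_branch_lt_edgeCos (b := b) hd hℓ
    have hε1 : ε = 1 := by simp [hεd, hk]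
    have hx' : 0 < branchQuotient G b ℓ ε j x := by
      simp only [branchQuotient, hε1, one_mul]
      exact div_pos (sub_pos.2 (h3 j)) h2
    rw [← hk] at hx
    have := existsUnique_zero_of_strictAntiOn (ordConnected_poleGap ℓ k)
      (fun l hl => (continuousAt_branchQuotient (b := b) hd hε j
        (edgeSin_ne_zero hℓ hl)).continuousWithinAt)
      (strictAntiOn_branchQuotient hG hp hℓ hε j k) hx hy hx' hy'
    refine (existsUnique_congr fun l => ?_).1 this
    have hset : l ∈ poleGap ℓ k ↔ l ∈ wideGap ℓ k :=
      ⟨mem_wideGap_of_mem_poleGap hℓ,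
        fun h => mem_poleGap_of_mem_wideGap_of_gt h fun h' => absurd hk h'⟩
    rw [IsExtremeZero, ← hset]
    refine and_congr_right fun hl => ?_
    rw [branchQuotient_eq_zero_iff hε (edgeSin_ne_zero hℓ hl)]
    simp [hk, hεd]
  · obtain ⟨m, rfl⟩ := Nat.exists_eq_succ_of_ne_zero hk
    rw [Nat.succ_eq_add_one] at *
    set f := Function.update (branchQuotient G b ℓ ε j) (pole ℓ (m + 1)) (meanPot G b) with hf
    have hfne : ∀ l, l ≠ pole ℓ (m + 1) → f l = branchQuotient G b ℓ ε j l := fun l hl =>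
      Function.update_of_ne hl _ _
    have hleft : ∀ l ∈ wideGap ℓ (m + 1), l < pole ℓ (m + 1) → l ∈ poleGap ℓ m :=
      fun l hl h => mem_poleGap_of_mem_wideGap_of_lt hl h
    have hright : ∀ l ∈ wideGap ℓ (m + 1), pole ℓ (m + 1) < l → l ∈ poleGap ℓ (m + 1) :=
      fun l hl h => mem_poleGap_of_mem_wideGap_of_gt hl fun _ => h
    have hSne : ∀ l ∈ wideGap ℓ (m + 1), l ≠ pole ℓ (m + 1) → edgeSin l ℓ ≠ 0 := by
      intro l hl hne
      rcases lt_or_gt_of_ne hne with h | h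
      · exact edgeSin_ne_zero hℓ (hleft l hl h)
      · exact edgeSin_ne_zero hℓ (hright l hl h)
    have hfp : ContinuousAt f (pole ℓ (m + 1)) :=
      continuousAt_update_same.2 (tendsto_branchQuotient_pole hG hp hℓ hj hk)
    have hfc : ContinuousOn f (wideGap ℓ (m + 1)) := by
      intro l hl
      rcases eq_or_ne l (pole ℓ (m + 1)) with rfl | hne
      · exact hfp.continuousWithinAt
      · exact ((continuousAt_update_of_ne hne).2
          (continuousAt_branchQuotient hd hε j (hSne l hl hne))).continuousWithinAt
    have hfm : StrictAntiOn f (wideGap ℓ (m + 1)) := by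
      refine strictAntiOn_of_continuousAt (ordConnected_wideGap ℓ _) hfp ?_ ?_
      · intro x hx y hy hxy
        rw [hfne x hx.2.ne, hfne y hy.2.ne]
        exact strictAntiOn_branchQuotient hG hp hℓ hε j m (hleft x hx.1 hx.2)
          (hleft y hy.1 hy.2) hxy
      · intro x hx y hy hxy
        rw [hfne x hx.2.ne', hfne y hy.2.ne']
        exact strictAntiOn_branchQuotient hG hp hℓ hε j (m + 1) (hright x hx.1 hx.2)
          (hright y hy.1 hy.2) hxy
    -- To the left of the `k`-th pole `ε S < 0`. The numerator is negative near the preceding pole,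
    -- where it tends to `-2`, or far to the left if there is no preceding pole.
    obtain ⟨x, hx, hx'⟩ : ∃ l ∈ poleGap ℓ m, 0 < branchQuotient G b ℓ ε j l := by
      have hS : ∀ l ∈ poleGap ℓ m, ε * edgeSin l ℓ < 0 := by
        intro l hl
        have := edgeSin_sign hℓ hl
        rw [hεd, pow_succ]
        linarith
      rcases eq_or_ne m 0 with hm | hm
      · obtain ⟨l, hl, h2⟩ : ∃ l ∈ poleGap ℓ 0, ε * edgeCos l ℓ <
            branch G b j (ε * edgeSin l ℓ) := by
          obtain ⟨l, hl, h1, h2⟩ := exists_edgeSin_lt hℓ (∑ v, |b v|)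
          refine ⟨l, (nonpos_mem_poleGap hℓ hl.le).2 rfl, ?_⟩
          have hε1 : ε = -1 := by simp [hεd, hm]
          have h3 := branch_le_add (b := b) hd j 0 (-1 * edgeSin l ℓ)
          have e : |0 - -1 * edgeSin l ℓ| = edgeSin l ℓ := by
            rw [show 0 - -1 * edgeSin l ℓ = edgeSin l ℓ by ring, abs_of_pos h1]
          rw [hz, e] at h3
          have h4 : 0 ≤ (∑ v, |b v|) * edgeSin l ℓ :=
            mul_nonneg (Finset.sum_nonneg fun _ _ => abs_nonneg _) h1.le
          rw [hε1]
          linarith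
        rw [← hm] at hl
        exact ⟨l, hl, div_pos_of_neg_of_neg (sub_neg.2 h2) (hS l hl)⟩
      · obtain ⟨l, hl, h2⟩ := exists_mem_poleGap_right hℓ m hcont.neg
          (f := fun l => -(ε * edgeCos l ℓ - branch G b j (ε * edgeSin l ℓ))) (by
            rw [(edge_pole hℓ hm).1, (edge_pole hℓ hm).2, mul_zero, hz]
            have : ε * (-1) ^ m = -ε ^ 2 := by rw [hεd, pow_succ]; ring
            rw [this, hε]
            norm_num)
        exact ⟨l, hl, div_pos_of_neg_of_neg (neg_pos.1 h2) (hS l hl)⟩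
    have hxw := mem_wideGap_succ_of_mem_poleGap hℓ hx
    have hyw := mem_wideGap_of_mem_poleGap hℓ hy
    have := existsUnique_zero_of_strictAntiOn (ordConnected_wideGap ℓ (m + 1)) hfc hfm hxw hyw
      (by rwa [hfne x hx.2.ne]) (by rwa [hfne y (hy.1 hk).ne'])
    refine (existsUnique_congr fun l => ?_).1 this
    refine and_congr_right fun hl => ?_
    rcases eq_or_ne l (pole ℓ (m + 1)) with rfl | hne
    · rw [hf, Function.update_self, meanPot, div_eq_zero_iff,
        or_iff_left (degForm_one_pos hd).ne']
      simp
    · rw [hfne l hne, branchQuotient_eq_zero_iff hε (hSne l hl hne)]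
      simp [hne, hεd]

end Zeros

/-! ### Solutions of the differential equation on one edge -/

section EdgeSolutions

variable {ℓ : ℝ}

theorem hasDerivWithinAt_edgeDeriv {f : ℝ → ℂ} (hf : DifferentiableOn ℝ f (Icc 0 ℓ)) {x : ℝ}
    (hx : x ∈ Icc 0 ℓ) : HasDerivWithinAt f (edgeDeriv ℓ f x) (Icc 0 ℓ) x :=
  (hf x hx).hasDerivWithinAt

theorem eq_of_hasDerivWithinAt_zero {f : ℝ → ℂ}
    (h : ∀ x ∈ Icc 0 ℓ, HasDerivWithinAt f 0 (Icc 0 ℓ) x) {x : ℝ} (hx : x ∈ Icc 0 ℓ) :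
    f x = f 0 := by
  refine constant_of_derivWithin_zero (fun y hy => (h y hy).differentiableWithinAt)
    (fun y hy => ?_) x hx
  have hℓ : 0 < ℓ := hy.1.trans_lt hy.2
  exact (h y ⟨hy.1, hy.2.le⟩).derivWithin (uniqueDiffOn_Icc hℓ y ⟨hy.1, hy.2.le⟩)

/-- The solution on an edge with prescribed value and derivative at `0`. -/
theorem eq_edgeCos_add_edgeSin (hℓ : 0 < ℓ) {f : ℝ → ℂ} {l : ℝ} (hf : ContDiffOn ℝ 2 f (Icc 0 ℓ))
    (hode : ∀ x ∈ Icc 0 ℓ, -edgeDeriv ℓ (edgeDeriv ℓ f) x = l * f x) {x : ℝ}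
    (hx : x ∈ Icc 0 ℓ) : f x = f 0 * edgeCos l x + edgeDeriv ℓ f 0 * edgeSin l x := by
  set g := edgeDeriv ℓ f with hg
  have hf' : ∀ y ∈ Icc 0 ℓ, HasDerivWithinAt f (g y) (Icc 0 ℓ) y := fun y hy =>
    hasDerivWithinAt_edgeDeriv (hf.differentiableOn (by norm_num)) hy
  have hg' : ∀ y ∈ Icc 0 ℓ, HasDerivWithinAt g (-(l * f y)) (Icc 0 ℓ) y := fun y hy => by
    rw [← hode y hy, neg_neg]
    exact hasDerivWithinAt_edgeDeriv (differentiableOn_edgeDeriv hℓ hf) hy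
  have hC : ∀ y, HasDerivWithinAt (fun t => (edgeCos l t : ℂ)) ((-l * edgeSin l y : ℝ) : ℂ)
      (Icc 0 ℓ) y := fun y => (hasDerivAt_edgeCos l y).ofReal_comp.hasDerivWithinAt
  have hS : ∀ y, HasDerivWithinAt (fun t => (edgeSin l t : ℂ)) ((edgeCos l y : ℝ) : ℂ)
      (Icc 0 ℓ) y := fun y => (hasDerivAt_edgeSin l y).ofReal_comp.hasDerivWithinAt
  -- `f C - f' S` and `l f S + f' C` are constant along solutions. Eliminating `f'` by `C² + l S² =
  -- 1` recovers `f`, so uniqueness needs no general theorem on differential equations.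
  have w₁ := eq_of_hasDerivWithinAt_zero
    (f := fun y => f y * edgeCos l y - g y * edgeSin l y) (fun y hy => by
      refine (((hf' y hy).mul (hC y)).sub ((hg' y hy).mul (hS y))).congr_deriv ?_
      push_cast
      ring) hx
  have w₂ := eq_of_hasDerivWithinAt_zero
    (f := fun y => l * (f y * edgeSin l y) + g y * edgeCos l y) (fun y hy => by
      refine ((((hf' y hy).mul (hS y)).const_mul (l : ℂ)).add
        ((hg' y hy).mul (hC y))).congr_deriv ?_
      push_cast
      ring) hx
  simp only [edgeCos_zero_right, edgeSin_zero_right, Complex.ofReal_one, Complex.ofReal_zero,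
    mul_one, mul_zero, sub_zero, zero_add] at w₁ w₂
  have e : ((edgeCos l x : ℂ)) ^ 2 + l * (edgeSin l x : ℂ) ^ 2 = 1 := by
    exact_mod_cast edgeCos_sq_add l x
  linear_combination (-f x) * e + (edgeCos l x : ℂ) * w₁ + (edgeSin l x : ℂ) * w₂

/-- The function on an edge with value `a` and derivative `β` at `0`. -/
noncomputable def edgeFun (ℓ l : ℝ) (a β : ℂ) : ℝ → ℂ :=
  (Icc 0 ℓ).indicator fun x => a * (edgeCos l x : ℂ) + β * (edgeSin l x : ℂ)

theorem edgeFun_of_mem {l : ℝ} {a β : ℂ} {x : ℝ} (hx : x ∈ Icc 0 ℓ) :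
    edgeFun ℓ l a β x = a * (edgeCos l x : ℂ) + β * (edgeSin l x : ℂ) := indicator_of_mem hx _

theorem edgeDeriv_eq_of_eqOn (hℓ : 0 < ℓ) {f : ℝ → ℂ} {l : ℝ} {a β : ℂ}
    (h : EqOn f (fun x => a * (edgeCos l x : ℂ) + β * (edgeSin l x : ℂ)) (Icc 0 ℓ))
    {x : ℝ} (hx : x ∈ Icc 0 ℓ) :
    edgeDeriv ℓ f x = β * (edgeCos l x : ℂ) + (-l * a) * (edgeSin l x : ℂ) := by
  rw [edgeDeriv_congr h hx]
  have := (((hasDerivAt_edgeCos l x).ofReal_comp.const_mul a).add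
    ((hasDerivAt_edgeSin l x).ofReal_comp.const_mul β)).hasDerivWithinAt (s := Icc 0 ℓ)
  refine (this.derivWithin (uniqueDiffOn_Icc hℓ x hx)).trans ?_
  push_cast
  ring

theorem edgeDeriv_edgeFun (hℓ : 0 < ℓ) {l : ℝ} {a β : ℂ} {x : ℝ} (hx : x ∈ Icc 0 ℓ) :
    edgeDeriv ℓ (edgeFun ℓ l a β) x
      = β * (edgeCos l x : ℂ) + (-l * a) * (edgeSin l x : ℂ) :=
  edgeDeriv_eq_of_eqOn hℓ (fun _ hy => edgeFun_of_mem hy) hx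

theorem edgeDeriv_edgeDeriv_edgeFun (hℓ : 0 < ℓ) {l : ℝ} {a β : ℂ} {x : ℝ}
    (hx : x ∈ Icc 0 ℓ) :
    edgeDeriv ℓ (edgeDeriv ℓ (edgeFun ℓ l a β)) x = -(l * edgeFun ℓ l a β x) := by
  rw [edgeDeriv_eq_of_eqOn (l := l) (a := β) (β := -l * a) hℓ
    (fun y hy => edgeDeriv_edgeFun hℓ hy) hx, edgeFun_of_mem hx]
  ring

theorem contDiff_edgeCos (l : ℝ) : ContDiff ℝ 2 (edgeCos l) := by
  rcases exists_sq_of_real l with rfl | ⟨s, hs, rfl⟩ | ⟨s, hs, rfl⟩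
  · rw [funext edgeCos_zero_left]
    exact contDiff_const
  · rw [funext (edgeCos_sq hs)]
    fun_prop
  · rw [funext (edgeCos_neg_sq hs)]
    exact Real.contDiff_cosh.comp (by fun_prop)

theorem contDiff_edgeSin (l : ℝ) : ContDiff ℝ 2 (edgeSin l) := by
  rcases exists_sq_of_real l with rfl | ⟨s, hs, rfl⟩ | ⟨s, hs, rfl⟩
  · rw [funext edgeSin_zero_left]
    exact contDiff_id
  · rw [funext (edgeSin_sq hs)]
    fun_prop
  · rw [funext (edgeSin_neg_sq hs)]
    exact (Real.contDiff_sinh.comp (by fun_prop)).div_const _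

theorem contDiffOn_edgeFun (l : ℝ) (a β : ℂ) : ContDiffOn ℝ 2 (edgeFun ℓ l a β) (Icc 0 ℓ) := by
  have h : ContDiff ℝ 2 fun x => a * (edgeCos l x : ℂ) + β * (edgeSin l x : ℂ) :=
    (contDiff_const.mul (Complex.ofRealCLM.contDiff.comp (contDiff_edgeCos l))).add
      (contDiff_const.mul (Complex.ofRealCLM.contDiff.comp (contDiff_edgeSin l)))
  exact h.contDiffOn.congr fun x hx => edgeFun_of_mem hx

end EdgeSolutions

/-! ### Reduction of the eigenspace to finitely many data -/

section Eigenspace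

set_option linter.unusedSectionVars false

variable {V : Type*} [Fintype V] [DecidableEq V] {G : SimpleGraph V} [DecidableRel G.Adj]
  (o : EdgeOrientation G) (b : V → ℝ) (ℓ : ℝ)

theorem EdgeOrientation.adj (e : G.edgeSet) : G.Adj (o.src e) (o.tgt e) := by
  rw [← SimpleGraph.mem_edgeSet, o.mk_eq]
  exact e.2

theorem EdgeOrientation.exists_of_adj {v w : V} (h : G.Adj v w) :
    ∃ e, (o.src e = v ∧ o.tgt e = w) ∨ (o.src e = w ∧ o.tgt e = v) := by
  refine ⟨⟨s(v, w), h⟩, ?_⟩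
  have := o.mk_eq ⟨s(v, w), h⟩
  simpa using this

/-- The values at the vertices and the derivatives at the initial points of the edges of the
solutions of the Robin problem. -/
noncomputable def vertexData (l : ℝ) : Submodule ℂ ((V → ℂ) × (G.edgeSet → ℂ)) where
  carrier := {d | (∀ e, d.1 (o.tgt e) = d.1 (o.src e) * edgeCos l ℓ + d.2 e * edgeSin l ℓ) ∧
    ∀ v, (∑ e, if o.tgt e = v then d.2 e * edgeCos l ℓ + (-l * d.1 (o.src e)) * edgeSin l ℓ
      else 0) + b v * d.1 v = ∑ e, if o.src e = v then d.2 e else 0}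
  zero_mem' := by simp
  add_mem' := by
    rintro d d' ⟨h1, h2⟩ ⟨h1', h2'⟩
    refine ⟨fun e => ?_, fun v => ?_⟩
    · simp only [Prod.fst_add, Prod.snd_add, Pi.add_apply]
      linear_combination h1 e + h1' e
    · have key := congrArg₂ (· + ·) (h2 v) (h2' v)
      simp only [← Finset.sum_filter] at key ⊢
      simp only [Prod.fst_add, Prod.snd_add, Pi.add_apply, mul_add, add_mul,
        Finset.sum_add_distrib] at key ⊢
      linear_combination key
  smul_mem' := by
    rintro c d ⟨h1, h2⟩
    refine ⟨fun e => ?_, fun v => ?_⟩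
    · simp only [Prod.smul_fst, Prod.smul_snd, Pi.smul_apply, smul_eq_mul]
      linear_combination c * h1 e
    · have key := congrArg (c * ·) (h2 v)
      simp only [← Finset.sum_filter] at key ⊢
      simp only [Prod.smul_fst, Prod.smul_snd, Pi.smul_apply, smul_eq_mul, mul_add,
        Finset.mul_sum] at key ⊢
      refine Eq.trans ?_ key
      congr 1
      · exact Finset.sum_congr rfl fun _ _ => by ring
      · ring

/-- The functions on the edges with given values at the initial vertices and derivatives at the
initial points. -/
noncomputable def solutionMap (l : ℝ) :
    (V → ℂ) × (G.edgeSet → ℂ) →ₗ[ℂ] (G.edgeSet → ℝ → ℂ) where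
  toFun d e := edgeFun ℓ l (d.1 (o.src e)) (d.2 e)
  map_add' d d' := by
    ext e x
    by_cases hx : x ∈ Icc 0 ℓ
    · simp only [Pi.add_apply, edgeFun_of_mem hx, Prod.fst_add, Prod.snd_add]
      ring
    · simp [edgeFun, hx]
  map_smul' c d := by
    ext e x
    by_cases hx : x ∈ Icc 0 ℓ
    · simp only [Pi.smul_apply, edgeFun_of_mem hx, Prod.smul_fst, Prod.smul_snd, smul_eq_mul,
        RingHom.id_apply]
      ring
    · simp [edgeFun, hx]

variable {ℓ}

/-- Continuity makes the value at the start of each edge a vertex value, and with the initial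
derivative it fixes the solution on the edge. What remains are the conditions at the terminal points
and at the vertices. -/
theorem robinEigenspace_eq_map (hℓ : 0 < ℓ) (l : ℝ) :
    robinEigenspace G o hℓ b l = (vertexData o b ℓ l).map (solutionMap o ℓ l) := by
  have m0 : (0 : ℝ) ∈ Icc 0 ℓ := ⟨le_rfl, hℓ.le⟩
  have m1 : ℓ ∈ Icc 0 ℓ := ⟨hℓ.le, le_rfl⟩
  ext y
  rw [Submodule.mem_map]
  constructor
  · rintro ⟨h0, h1, h2, u, hu0, hu1, hu2⟩
    have hy : ∀ e, EqOn (y e) (fun x => u (o.src e) * (edgeCos l x : ℂ)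
        + edgeDeriv ℓ (y e) 0 * (edgeSin l x : ℂ)) (Icc 0 ℓ) := fun e x hx => by
      rw [eq_edgeCos_add_edgeSin hℓ (h1 e) (h2 e) hx, hu0]
    refine ⟨(u, fun e => edgeDeriv ℓ (y e) 0), ⟨fun e => ?_, fun v => ?_⟩, ?_⟩
    · exact (hu1 e).symm.trans (hy e m1)
    · rw [← hu2 v]
      congr 1
      refine Finset.sum_congr rfl fun e _ => ?_
      rw [edgeDeriv_eq_of_eqOn hℓ (hy e) m1]
    · ext e x
      by_cases hx : x ∈ Icc 0 ℓ
      · exact (edgeFun_of_mem hx).trans (hy e hx).symm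
      · rw [h0 e x hx]
        simp [solutionMap, edgeFun, hx]
  · rintro ⟨d, ⟨h1, h2⟩, rfl⟩
    refine ⟨fun e x hx => (indicator_of_notMem hx _ :
      edgeFun ℓ l (d.1 (o.src e)) (d.2 e) x = 0), fun e => contDiffOn_edgeFun l _ _,
      fun e x hx => ?_, d.1, fun e => ?_, fun e => ?_, fun v => ?_⟩
    · exact (congrArg Neg.neg (edgeDeriv_edgeDeriv_edgeFun hℓ hx)).trans (neg_neg _)
    · refine (edgeFun_of_mem m0).trans ?_
      simp [edgeCos_zero_right, edgeSin_zero_right]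
    · rw [h1]
      exact edgeFun_of_mem m1
    · refine Eq.trans ?_ ((h2 v).trans ?_)
      · congr 1
        refine Finset.sum_congr rfl fun e _ => ?_
        congr 1
        exact edgeDeriv_edgeFun hℓ m1
      · refine Finset.sum_congr rfl fun e _ => ?_
        congr 1
        refine Eq.trans ?_ (edgeDeriv_edgeFun hℓ m0).symm
        simp [edgeCos_zero_right, edgeSin_zero_right]

theorem finrank_map_eq_of_injOn {E F : Type*} [AddCommGroup E] [Module ℂ E] [AddCommGroup F]
    [Module ℂ F] (f : E →ₗ[ℂ] F) (T : Submodule ℂ E) (h : ∀ x ∈ T, f x = 0 → x = 0) :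
    Module.finrank ℂ (T.map f) = Module.finrank ℂ T := by
  rw [← LinearMap.range_domRestrict]
  refine LinearMap.finrank_range_of_inj ?_
  rw [← LinearMap.ker_eq_bot, LinearMap.ker_eq_bot']
  rintro ⟨x, hx⟩ hfx
  exact Subtype.ext (h x hx hfx)

theorem eq_zero_of_src_of_tgt (hd : ∀ v, 0 < G.degree v) {u : V → ℂ}
    (h0 : ∀ e, u (o.src e) = 0) (h1 : ∀ e, u (o.tgt e) = 0) : u = 0 := by
  ext v
  obtain ⟨w, hw⟩ := (G.degree_pos_iff_exists_adj v).1 (hd v)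
  obtain ⟨e, ⟨h, _⟩ | ⟨_, h⟩⟩ := o.exists_of_adj hw
  · rw [← h, h0, Pi.zero_apply]
  · rw [← h, h1, Pi.zero_apply]

/-- The data can be recovered from the functions. Positivity of the degrees enters because the value
at an isolated vertex would not be seen by any edge. -/
theorem finrank_robinEigenspace (hd : ∀ v, 0 < G.degree v) (hℓ : 0 < ℓ) (l : ℝ) :
    Module.finrank ℂ (robinEigenspace G o hℓ b l) = Module.finrank ℂ (vertexData o b ℓ l) := by
  have m0 : (0 : ℝ) ∈ Icc 0 ℓ := ⟨le_rfl, hℓ.le⟩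
  rw [robinEigenspace_eq_map]
  refine finrank_map_eq_of_injOn _ _ ?_
  rintro ⟨u, β⟩ ⟨h1, -⟩ h
  have hy : ∀ e, edgeFun ℓ l (u (o.src e)) (β e) = 0 := fun e => congrFun h e
  have hs : ∀ e, u (o.src e) = 0 := fun e => by
    have := congrFun (hy e) 0
    rw [edgeFun_of_mem m0] at this
    simpa [edgeCos_zero_right, edgeSin_zero_right] using this
  have hb : ∀ e, β e = 0 := fun e => by
    have h3 := edgeDeriv_edgeFun hℓ (l := l) (a := u (o.src e)) (β := β e) m0
    have h4 : edgeDeriv ℓ (0 : ℝ → ℂ) 0 = 0 :=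
      congrFun (derivWithin_const (Icc 0 ℓ) (0 : ℂ)) 0
    rw [hy e, h4] at h3
    simpa [edgeCos_zero_right, edgeSin_zero_right] using h3.symm
  have ht : ∀ e, u (o.tgt e) = 0 := fun e => by
    have := h1 e
    simpa [hs e, hb e] using this
  rw [eq_zero_of_src_of_tgt o hd hs ht, show β = 0 from funext hb]
  rfl

theorem finiteDimensional_robinEigenspace (hℓ : 0 < ℓ) (l : ℝ) :
    FiniteDimensional ℂ (robinEigenspace G o hℓ b l) := by
  rw [robinEigenspace_eq_map]
  infer_instance

theorem mem_robinSpectrum_iff (hℓ : 0 < ℓ) (l : ℝ) :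
    (l : ℂ) ∈ robinSpectrum G o hℓ b ↔ Module.finrank ℂ (robinEigenspace G o hℓ b l) ≠ 0 := by
  have := finiteDimensional_robinEigenspace o b hℓ l
  rw [Ne, Submodule.finrank_eq_zero, ← Ne, Submodule.ne_bot_iff]
  rfl

end Eigenspace

/-! ### Multiplicities away from the poles and at the poles -/

section Multiplicity

open scoped Matrix

set_option linter.unusedSectionVars false

variable {V : Type*} [Fintype V] [DecidableEq V] {G : SimpleGraph V} [DecidableRel G.Adj]
  (o : EdgeOrientation G) (b : V → ℝ) {ℓ : ℝ}

/-- Each neighbour of `v` is the other end of exactly one edge, which is either incoming or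
outgoing; the orientation therefore drops out. -/
theorem EdgeOrientation.sum_ite_add_sum_ite (X : V → ℂ) (v : V) :
    (∑ e, if o.tgt e = v then X (o.src e) else 0) + (∑ e, if o.src e = v then X (o.tgt e) else 0)
      = ∑ w ∈ G.neighborFinset v, X w := by
  have h1 : ∀ e : G.edgeSet, (if o.tgt e = v then X (o.src e) else 0)
      + (if o.src e = v then X (o.tgt e) else 0)
      = ∑ w, if s(v, w) = (e : Sym2 V) then X w else 0 := by
    intro e
    have hne := (o.adj e).ne
    simp only [← o.mk_eq e, Sym2.eq_iff]
    by_cases hs : o.src e = v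
    · have ht : o.tgt e ≠ v := fun h => hne (hs.trans h.symm)
      simp [hs, ht, ht.symm]
    · by_cases ht : o.tgt e = v
      · simp [ht, hs, Ne.symm hs]
      · simp [hs, ht, Ne.symm hs, Ne.symm ht]
  rw [← Finset.sum_add_distrib, Finset.sum_congr rfl fun e _ => h1 e, Finset.sum_comm,
    ← Finset.sum_filter_add_sum_filter_not _ (fun w => G.Adj v w)]
  have h2 : ∑ w with ¬ G.Adj v w, ∑ e : G.edgeSet, (if s(v, w) = (e : Sym2 V) then X w else 0)
      = 0 := by
    refine Finset.sum_eq_zero fun w hw => Finset.sum_eq_zero fun e _ => if_neg fun h => ?_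
    have := e.2
    rw [← h, SimpleGraph.mem_edgeSet] at this
    exact (Finset.mem_filter.1 hw).2 this
  rw [h2, add_zero, ← G.neighborFinset_eq_filter]
  refine Finset.sum_congr rfl fun w hw => ?_
  rw [SimpleGraph.mem_neighborFinset] at hw
  rw [Finset.sum_eq_single (⟨s(v, w), hw⟩ : G.edgeSet)]
  · simp
  · intro e _ he
    exact if_neg fun h => he (Subtype.ext h.symm)
  · simp

/-- The matrix `c D - A + S b`. -/
noncomputable def vertexMatrix (G : SimpleGraph V) [DecidableRel G.Adj] (b : V → ℝ) (c S : ℝ) :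
    Matrix V V ℝ :=
  c • G.degMatrix ℝ - G.adjMatrix ℝ + S • Matrix.diagonal b

theorem vertexMatrix_map_mulVec (c S : ℝ) (u : V → ℂ) (v : V) :
    ((vertexMatrix G b c S).map (algebraMap ℝ ℂ) *ᵥ u) v
      = c * G.degree v * u v - (∑ w ∈ G.neighborFinset v, u w) + S * b v * u v := by
  have h : (vertexMatrix G b c S).map (algebraMap ℝ ℂ)
      = (c : ℂ) • G.degMatrix ℂ - G.adjMatrix ℂ + (S : ℂ) • Matrix.diagonal (fun v => (b v : ℂ)) := by
    ext i j
    by_cases hij : i = j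
    · subst hij
      simp [vertexMatrix, SimpleGraph.degMatrix]
    · simp only [vertexMatrix, SimpleGraph.degMatrix, Matrix.map_apply, Matrix.add_apply,
        Matrix.sub_apply, Matrix.smul_apply, Matrix.diagonal_apply_ne _ hij,
        SimpleGraph.adjMatrix_apply]
      split_ifs <;> simp
  rw [h, Matrix.add_mulVec, Matrix.sub_mulVec, Matrix.smul_mulVec, Matrix.smul_mulVec]
  simp only [Pi.add_apply, Pi.sub_apply, Pi.smul_apply, G.degMatrix_mulVec_apply,
    G.adjMatrix_mulVec_apply, Matrix.mulVec_diagonal, smul_eq_mul]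
  ring

theorem sum_degree_ite (u : V → ℂ) (v : V) :
    (∑ e, if o.tgt e = v then u (o.tgt e) else 0) + (∑ e, if o.src e = v then u (o.src e) else 0)
      = G.degree v * u v := by
  have h := o.sum_ite_add_sum_ite (fun _ => u v) v
  rw [Finset.sum_const, SimpleGraph.card_neighborFinset_eq_degree, nsmul_eq_mul] at h
  rw [← h]
  congr 1 <;> refine Finset.sum_congr rfl fun e _ => ?_ <;> split_ifs with h1 <;> simp [h1]

/-- For `S ≠ 0` the initial derivative on an edge is `(u (tgt) - c u (src)) / S`. By `c² + l S² =
1`, `S` times the derivative at the end is `c u (tgt) - u (src)`, so the vertex condition times `S`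
is a row of `(c D - A + S b) u = 0`. -/
theorem map_fst_vertexData (hS : edgeSin (l : ℝ) ℓ ≠ 0) :
    (vertexData o b ℓ l).map (LinearMap.fst ℂ (V → ℂ) (G.edgeSet → ℂ))
      = LinearMap.ker ((vertexMatrix G b (edgeCos l ℓ) (edgeSin l ℓ)).map
        (algebraMap ℝ ℂ)).mulVecLin := by
  have hS' : (edgeSin l ℓ : ℂ) ≠ 0 := by exact_mod_cast hS
  have e : ((edgeCos l ℓ : ℂ)) ^ 2 + l * (edgeSin l ℓ : ℂ) ^ 2 = 1 := by
    exact_mod_cast edgeCos_sq_add l ℓ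
  set c : ℂ := (edgeCos l ℓ : ℂ) with hc
  set S : ℂ := (edgeSin l ℓ : ℂ) with hSd
  have key : ∀ (u : V → ℂ) (β : G.edgeSet → ℂ),
      (∀ e, u (o.tgt e) = u (o.src e) * c + β e * S) → ∀ v,
      ((vertexMatrix G b (edgeCos l ℓ) (edgeSin l ℓ)).map (algebraMap ℝ ℂ) *ᵥ u) v
        = S * ((∑ e, if o.tgt e = v then β e * c + (-l * u (o.src e)) * S else 0) + b v * u v
          - ∑ e, if o.src e = v then β e else 0) := by
    intro u β h v
    rw [vertexMatrix_map_mulVec, mul_assoc, ← sum_degree_ite o, ← o.sum_ite_add_sum_ite, ← hc,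
      ← hSd]
    have h1 : S * (∑ e, if o.tgt e = v then β e * c + (-l * u (o.src e)) * S else 0)
        = c * (∑ e, if o.tgt e = v then u (o.tgt e) else 0)
          - ∑ e, if o.tgt e = v then u (o.src e) else 0 := by
      simp only [Finset.mul_sum, ← Finset.sum_sub_distrib]
      refine Finset.sum_congr rfl fun a _ => ?_
      split_ifs
      · linear_combination -c * h a - (u (o.src a)) * e
      · simp
    have h2 : S * (∑ e, if o.src e = v then β e else 0)
        = (∑ e, if o.src e = v then u (o.tgt e) else 0)
          - c * ∑ e, if o.src e = v then u (o.src e) else 0 := by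
      simp only [Finset.mul_sum, ← Finset.sum_sub_distrib]
      refine Finset.sum_congr rfl fun a _ => ?_
      split_ifs
      · linear_combination -h a
      · simp
    linear_combination -h1 + h2
  ext u
  rw [Submodule.mem_map, LinearMap.mem_ker, Matrix.mulVecLin_apply]
  constructor
  · rintro ⟨⟨u, β⟩, ⟨h1, h2⟩, rfl⟩
    ext v
    rw [LinearMap.fst_apply, key u β h1 v, sub_eq_zero.2 (h2 v), mul_zero, Pi.zero_apply]
  · intro hu
    have h1 : ∀ e, u (o.tgt e) = u (o.src e) * c + (u (o.tgt e) - u (o.src e) * c) / S * S := by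
      intro e
      rw [div_mul_cancel₀ _ hS']
      ring
    refine ⟨(u, fun e => (u (o.tgt e) - u (o.src e) * c) / S), ⟨h1, fun v => ?_⟩, rfl⟩
    have h2 := key u _ h1 v
    rw [hu, Pi.zero_apply] at h2
    exact sub_eq_zero.1 ((mul_eq_zero.1 h2.symm).resolve_left hS')

theorem finrank_vertexData_eq_ker {l : ℝ} (hS : edgeSin l ℓ ≠ 0) :
    Module.finrank ℂ (vertexData o b ℓ l)
      = Module.finrank ℂ (LinearMap.ker ((vertexMatrix G b (edgeCos l ℓ) (edgeSin l ℓ)).map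
        (algebraMap ℝ ℂ)).mulVecLin) := by
  have hS' : (edgeSin l ℓ : ℂ) ≠ 0 := by exact_mod_cast hS
  rw [← map_fst_vertexData o b hS]
  refine (finrank_map_eq_of_injOn _ _ ?_).symm
  rintro ⟨u, β⟩ ⟨h1, -⟩ hu
  have hu : u = 0 := hu
  subst hu
  have : β = 0 := by
    ext e
    have := h1 e
    simpa [hS'] using this
  rw [this]
  rfl

theorem vertexMatrix_eq_conj_scaledMatrix (hd : ∀ v, 0 < G.degree v) (c S : ℝ) :
    vertexMatrix G b c S = Matrix.diagonal (fun v => √(G.degree v))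
      * (c • 1 - scaledMatrix G b S) * Matrix.diagonal (fun v => √(G.degree v)) := by
  ext i j
  have hi : √(G.degree i : ℝ) ≠ 0 := Real.sqrt_ne_zero'.2 (by exact_mod_cast hd i)
  have hj : √(G.degree j : ℝ) ≠ 0 := Real.sqrt_ne_zero'.2 (by exact_mod_cast hd j)
  simp only [vertexMatrix, scaledMatrix, Matrix.mul_diagonal, Matrix.diagonal_mul,
    Matrix.sub_apply, Matrix.add_apply, Matrix.smul_apply, smul_eq_mul, SimpleGraph.degMatrix]
  by_cases hij : i = j
  · subst hij
    have h2 := Real.mul_self_sqrt (Nat.cast_nonneg (α := ℝ) (G.degree i))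
    simp only [Matrix.diagonal_apply_eq, Matrix.one_apply_eq]
    field_simp
    linear_combination -c * h2
  · simp only [Matrix.diagonal_apply_ne _ hij, Matrix.one_apply_ne hij]
    field_simp
    ring

/-- The multiplicity at a point which is not a Dirichlet eigenvalue. -/
theorem finrank_ker_vertexMatrix (hd : ∀ v, 0 < G.degree v) (c S : ℝ) :
    Module.finrank ℂ (LinearMap.ker ((vertexMatrix G b c S).map (algebraMap ℝ ℂ)).mulVecLin)
      = Fintype.card {j // branch G b j S = c} := by
  set hM := isHermitian_scaledMatrix G b S
  set U : Matrix V V ℝ := (hM.eigenvectorUnitary : Matrix V V ℝ) with hU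
  set R : Matrix V V ℝ := Matrix.diagonal (fun v => √(G.degree v)) with hR
  have hUU : U * star U = 1 := Unitary.mul_star_self_of_mem hM.eigenvectorUnitary.2
  obtain ⟨ev, hev⟩ : ∃ ev, ev = hM.eigenvalues := ⟨_, rfl⟩
  have hspec : scaledMatrix G b S = U * Matrix.diagonal ev * star U := by
    conv_lhs => rw [hM.spectral_theorem, Unitary.conjStarAlgAut_apply]
    rw [hev]
    rfl
  -- Invertible factors on both sides of a diagonal matrix turn the kernel dimension into the number
  -- of zero entries `c - ev i`, over `ℂ` as well as over `ℝ`.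
  have e1 : vertexMatrix G b c S
      = (R * U) * Matrix.diagonal (fun i => c - ev i) * (star U * R) := by
    have : Matrix.diagonal (fun i => c - ev i)
        = c • (1 : Matrix V V ℝ) - Matrix.diagonal ev := by
      rw [← Matrix.diagonal_one, ← Matrix.diagonal_smul, Matrix.diagonal_sub]
      congr 1
      ext i
      simp
    rw [vertexMatrix_eq_conj_scaledMatrix b hd, ← hR, this, Matrix.mul_sub, Matrix.sub_mul, Matrix.mul_sub,
      Matrix.sub_mul, hspec]
    congr 1
    · simp only [Matrix.mul_smul, Matrix.smul_mul, Matrix.mul_one]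
      rw [Matrix.mul_assoc R U, ← Matrix.mul_assoc U, hUU, Matrix.one_mul]
    · simp only [Matrix.mul_assoc]
  have hRdet : IsUnit R.det := by
    rw [hR, Matrix.det_diagonal, isUnit_iff_ne_zero]
    exact Finset.prod_ne_zero_iff.2 fun v _ => Real.sqrt_ne_zero'.2 (by exact_mod_cast hd v)
  have hUdet : IsUnit U.det := by
    refine IsUnit.of_mul_eq_one (star U).det ?_
    rw [← Matrix.det_mul, hUU, Matrix.det_one]
  have hUdet' : IsUnit (star U).det := by
    refine IsUnit.of_mul_eq_one U.det ?_
    rw [mul_comm, ← Matrix.det_mul, hUU, Matrix.det_one]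
  have hmapdet : ∀ N : Matrix V V ℝ, IsUnit N.det → IsUnit (N.map (algebraMap ℝ ℂ)).det := by
    intro N hN
    have := hN.map (algebraMap ℝ ℂ)
    rwa [RingHom.map_det] at this
  have hrank : ((vertexMatrix G b c S).map (algebraMap ℝ ℂ)).rank
      = Fintype.card {i // ((c - ev i : ℝ) : ℂ) ≠ 0} := by
    rw [e1, Matrix.map_mul, Matrix.map_mul,
      Matrix.rank_mul_eq_left_of_isUnit_det _ _ (hmapdet _ (by
        rw [Matrix.det_mul]; exact hUdet'.mul hRdet)),
      Matrix.rank_mul_eq_right_of_isUnit_det _ _ (hmapdet _ (by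
        rw [Matrix.det_mul]; exact hRdet.mul hUdet)),
      Matrix.diagonal_map (map_zero _), Matrix.rank_diagonal]
    rfl
  have hsum := LinearMap.finrank_range_add_finrank_ker
    ((vertexMatrix G b c S).map (algebraMap ℝ ℂ)).mulVecLin
  rw [← Matrix.rank, hrank, Module.finrank_fintype_fun_eq_card] at hsum
  have hcompl := Fintype.card_subtype_compl (fun i => ((c - ev i : ℝ) : ℂ) ≠ 0)
  have hle := Fintype.card_subtype_le (fun i => ((c - ev i : ℝ) : ℂ) ≠ 0)
  have hequiv : Fintype.card {j // branch G b j S = c}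
      = Fintype.card {i // ¬ ((c - ev i : ℝ) : ℂ) ≠ 0} := by
    refine Fintype.card_congr ((Fintype.equivOfCardEq
      (Fintype.card_fin (Fintype.card V))).subtypeEquiv fun j => ?_)
    rw [not_not, Complex.ofReal_eq_zero, sub_eq_zero, hev, Matrix.IsHermitian.eigenvalues,
      Equiv.symm_apply_apply, eq_comm]
    rfl
  omega

theorem exists_sign_of_isTree (hG : G.IsTree) {ε : ℝ} (hε : ε ^ 2 = 1) :
    ∃ w : V → ℝ, (∀ v, w v ^ 2 = 1) ∧ ∀ v v', G.Adj v v' → w v = ε * w v' := by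
  rcases sq_eq_sq_iff_eq_or_eq_neg.1 (hε.trans (one_pow 2).symm) with rfl | rfl
  · exact ⟨fun _ => 1, by simp, by simp⟩
  · obtain ⟨w, h1, h2⟩ := hG.exists_sign
    exact ⟨w, h1, fun v v' h => by rw [h2 v v' h]; ring⟩

/-- The signed incidence matrix. -/
noncomputable def signedIncidence (ε : ℝ) : Matrix V G.edgeSet ℂ := fun v e =>
  (if o.tgt e = v then (ε : ℂ) else 0) - if o.src e = v then 1 else 0

theorem signedIncidence_mulVec (ε : ℝ) (β : G.edgeSet → ℂ) (v : V) :
    (signedIncidence o ε *ᵥ β) v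
      = (∑ e, if o.tgt e = v then β e * ε else 0) - ∑ e, if o.src e = v then β e else 0 := by
  simp only [Matrix.mulVec, dotProduct, signedIncidence, ← Finset.sum_sub_distrib]
  refine Finset.sum_congr rfl fun e _ => ?_
  split_ifs <;> ring

theorem signedIncidence_transpose_mulVec (ε : ℝ) (u : V → ℂ) (e : G.edgeSet) :
    ((signedIncidence o ε)ᵀ *ᵥ u) e = ε * u (o.tgt e) - u (o.src e) := by
  simp [Matrix.mulVec, dotProduct, signedIncidence, sub_mul, Finset.sum_sub_distrib]

/-- The product `u w` takes the same value at adjacent vertices, hence is constant on the connected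
graph. -/
theorem eq_smul_of_forall_tgt (hG : G.IsTree) {ε : ℝ} (hε : ε ^ 2 = 1) {w : V → ℝ}
    (hw : ∀ v, w v ^ 2 = 1) (hadj : ∀ v v', G.Adj v v' → w v = ε * w v') {u : V → ℂ}
    (hu : ∀ e, u (o.src e) = ε * u (o.tgt e)) :
    ∃ a : ℂ, u = a • fun v => (w v : ℂ) := by
  have hε' : (ε : ℂ) ^ 2 = 1 := by exact_mod_cast hε
  have hw' : ∀ v, (w v : ℂ) ^ 2 = 1 := fun v => by exact_mod_cast hw v
  have hadj' : ∀ v v', G.Adj v v' → (w v : ℂ) = ε * w v' := fun v v' h => by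
    exact_mod_cast hadj v v' h
  have h1 : ∀ v v', G.Adj v v' → u v * w v = u v' * w v' := by
    intro v v' h
    have hu' : u v = ε * u v' := by
      obtain ⟨e, ⟨rfl, rfl⟩ | ⟨rfl, rfl⟩⟩ := o.exists_of_adj h
      · exact hu e
      · linear_combination (-(ε : ℂ)) * hu e - u (o.tgt e) * hε'
    rw [hu', hadj' v v' h]
    linear_combination (u v' * w v') * hε'
  have h2 : ∀ v v', G.Reachable v v' → u v * w v = u v' * w v' := by
    rintro v v' ⟨p⟩
    induction p with
    | nil => rfl
    | cons h _ ih => exact (h1 _ _ h).trans ih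
  obtain ⟨r⟩ := hG.connected.nonempty
  refine ⟨u r * w r, funext fun v => ?_⟩
  rw [h2 r v (hG.connected r v), Pi.smul_apply, smul_eq_mul]
  linear_combination (-(u v)) * hw' v

theorem ker_signedIncidence_transpose (hG : G.IsTree) {ε : ℝ} (hε : ε ^ 2 = 1) {w : V → ℝ}
    (hw : ∀ v, w v ^ 2 = 1) (hadj : ∀ v v', G.Adj v v' → w v = ε * w v') :
    LinearMap.ker (signedIncidence o ε)ᵀ.mulVecLin = ℂ ∙ fun v => (w v : ℂ) := by
  ext u
  rw [LinearMap.mem_ker, Matrix.mulVecLin_apply, Submodule.mem_span_singleton]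
  constructor
  · intro h
    obtain ⟨a, rfl⟩ := eq_smul_of_forall_tgt o hG hε hw hadj (u := u) fun e => by
      have := congrFun h e
      rw [signedIncidence_transpose_mulVec, Pi.zero_apply] at this
      exact (sub_eq_zero.1 this).symm
    exact ⟨a, rfl⟩
  · rintro ⟨a, rfl⟩
    ext e
    have : (w (o.src e) : ℂ) = ε * w (o.tgt e) := by exact_mod_cast hadj _ _ (o.adj e)
    rw [signedIncidence_transpose_mulVec, Pi.zero_apply, Pi.smul_apply, Pi.smul_apply, this,
      smul_eq_mul, smul_eq_mul]
    ring

/-- The transpose has a one-dimensional kernel, and a tree has one edge fewer than vertices. So the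
matrix has full column rank and its range is a hyperplane. -/
theorem rank_signedIncidence (hG : G.IsTree) {ε : ℝ} (hε : ε ^ 2 = 1) :
    (signedIncidence o ε).rank = Fintype.card G.edgeSet ∧
      (signedIncidence o ε).rank + 1 = Fintype.card V := by
  obtain ⟨w, hw, hadj⟩ := exists_sign_of_isTree hG hε
  obtain ⟨r⟩ := hG.connected.nonempty
  have h1 := LinearMap.finrank_range_add_finrank_ker (signedIncidence o ε)ᵀ.mulVecLin
  have hw0 : (fun v => (w v : ℂ)) ≠ 0 := fun h => by
    have h2 := congrFun h r
    have h3 := hw r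
    simp only [Pi.zero_apply, Complex.ofReal_eq_zero] at h2
    simp [h2] at h3
  rw [ker_signedIncidence_transpose o hG hε hw hadj, finrank_span_singleton hw0, ← Matrix.rank,
    Matrix.rank_transpose, Module.finrank_fintype_fun_eq_card] at h1
  have h2 := hG.card_edgeFinset
  rw [SimpleGraph.edgeFinset_card] at h2
  exact ⟨by omega, h1⟩

theorem signedIncidence_injective (hG : G.IsTree) {ε : ℝ} (hε : ε ^ 2 = 1) {β : G.edgeSet → ℂ}
    (hβ : signedIncidence o ε *ᵥ β = 0) : β = 0 := by
  have h1 := LinearMap.finrank_range_add_finrank_ker (signedIncidence o ε).mulVecLin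
  rw [← Matrix.rank, (rank_signedIncidence o hG hε).1, Module.finrank_fintype_fun_eq_card] at h1
  have h2 : LinearMap.ker (signedIncidence o ε).mulVecLin = ⊥ :=
    Submodule.finrank_eq_zero.1 (by omega)
  exact (Submodule.mem_bot ℂ).1 (h2 ▸ (LinearMap.mem_ker.2 hβ))

theorem sum_sign_mul_signedIncidence {ε : ℝ} {w : V → ℝ}
    (hadj : ∀ v v', G.Adj v v' → w v = ε * w v') (β : G.edgeSet → ℂ) :
    (fun v => (w v : ℂ)) ⬝ᵥ signedIncidence o ε *ᵥ β = 0 := by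
  rw [Matrix.dotProduct_mulVec, ← Matrix.mulVec_transpose]
  refine Finset.sum_eq_zero fun e _ => ?_
  have : (w (o.src e) : ℂ) = ε * w (o.tgt e) := by exact_mod_cast hadj _ _ (o.adj e)
  rw [signedIncidence_transpose_mulVec, this, sub_self, zero_mul]

/-- The range lies in the hyperplane annihilated by `w` and has the same dimension. -/
theorem exists_signedIncidence_eq (hG : G.IsTree) {ε : ℝ} (hε : ε ^ 2 = 1) {w : V → ℝ}
    (hw : ∀ v, w v ^ 2 = 1) (hadj : ∀ v v', G.Adj v v' → w v = ε * w v') {x : V → ℂ}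
    (hx : (fun v => (w v : ℂ)) ⬝ᵥ x = 0) : ∃ β, signedIncidence o ε *ᵥ β = x := by
  obtain ⟨r⟩ := hG.connected.nonempty
  set φ : (V → ℂ) →ₗ[ℂ] ℂ := dotProductBilin ℂ ℂ (fun v => (w v : ℂ)) with hφ
  have hle : LinearMap.range (signedIncidence o ε).mulVecLin ≤ LinearMap.ker φ := by
    rintro _ ⟨β, rfl⟩
    exact sum_sign_mul_signedIncidence o hadj β
  have hφ0 : φ ≠ 0 := by
    intro h
    have h1 := LinearMap.congr_fun h (Pi.single r 1)
    have h2 : φ (Pi.single r 1) = (w r : ℂ) := by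
      simp [hφ]
    rw [h2, LinearMap.zero_apply, Complex.ofReal_eq_zero] at h1
    have h3 := hw r
    simp [h1] at h3
  have hker := Module.Dual.finrank_ker_add_one_of_ne_zero hφ0
  rw [Module.finrank_fintype_fun_eq_card] at hker
  have heq := Submodule.eq_of_le_of_finrank_eq hle (by
    rw [← Matrix.rank]
    have := (rank_signedIncidence o hG hε).2
    omega)
  have : x ∈ LinearMap.range (signedIncidence o ε).mulVecLin := by
    rw [heq]
    exact hx
  exact this

/-- The multiplicity at a Dirichlet eigenvalue. -/
theorem finrank_vertexData_pole (hG : G.IsTree) {l : ℝ} (hS : edgeSin l ℓ = 0) :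
    Module.finrank ℂ (vertexData o b ℓ l) = if ∑ v, b v = 0 then 1 else 0 := by
  set ε := edgeCos l ℓ with hεd
  have hε : ε ^ 2 = 1 := by
    have := edgeCos_sq_add l ℓ
    simpa [hS, ← hεd] using this
  have hε' : (ε : ℂ) ^ 2 = 1 := by exact_mod_cast hε
  obtain ⟨w, hw, hadj⟩ := exists_sign_of_isTree hG hε
  obtain ⟨r⟩ := hG.connected.nonempty
  have hw' : ∀ v, (w v : ℂ) ^ 2 = 1 := fun v => by exact_mod_cast hw v
  -- With `S = 0` the conditions decouple: `u` changes by the factor `ε` along each edge, and `β`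
  -- solves a linear system with the signed incidence matrix.
  have hmem : ∀ u β, (u, β) ∈ vertexData o b ℓ l ↔
      (∀ e, u (o.tgt e) = u (o.src e) * ε) ∧
        signedIncidence o ε *ᵥ β = -fun v => (b v : ℂ) * u v := by
    intro u β
    have h0 : (u, β) ∈ vertexData o b ℓ l ↔
      (∀ e, u (o.tgt e) = u (o.src e) * edgeCos l ℓ + β e * edgeSin l ℓ) ∧
      ∀ v, (∑ e, if o.tgt e = v then β e * edgeCos l ℓ + (-l * u (o.src e)) * edgeSin l ℓ
        else 0) + b v * u v = ∑ e, if o.src e = v then β e else 0 := Iff.rfl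
    rw [h0]
    simp only [hS, Complex.ofReal_zero, mul_zero, add_zero, ← hεd]
    refine and_congr_right fun _ => ?_
    rw [funext_iff]
    refine forall_congr' fun v => ?_
    rw [signedIncidence_mulVec, Pi.neg_apply, sub_eq_iff_eq_add, eq_neg_add_iff_add_eq, add_comm]
  -- Pairing that system with `w` annihilates the left side and leaves the solvability condition `a
  -- ∑ b = 0`.
  have hu : ∀ u β, (u, β) ∈ vertexData o b ℓ l → ∃ a : ℂ, u = a • (fun v => (w v : ℂ)) ∧
      a * ((∑ v, b v : ℝ) : ℂ) = 0 := by
    intro u β h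
    rw [hmem] at h
    obtain ⟨a, rfl⟩ := eq_smul_of_forall_tgt o hG hε hw hadj (u := u) fun e => by
      rw [h.1 e]
      linear_combination (-(u (o.src e))) * hε'
    refine ⟨a, rfl, ?_⟩
    have h1 := sum_sign_mul_signedIncidence o hadj β
    rw [h.2, dotProduct_neg, neg_eq_zero] at h1
    rw [← h1, Complex.ofReal_sum, Finset.mul_sum]
    refine Finset.sum_congr rfl fun v _ => ?_
    simp only [Pi.smul_apply, smul_eq_mul]
    linear_combination (-(a * b v)) * hw' v
  have hβ : ∀ β, (0, β) ∈ vertexData o b ℓ l → β = 0 := by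
    intro β h
    rw [hmem] at h
    refine signedIncidence_injective o hG hε (h.2.trans ?_)
    ext v
    simp
  split_ifs with hb
  · have hx : (fun v => (w v : ℂ)) ⬝ᵥ (-fun v => (b v : ℂ) * w v) = 0 := by
      rw [dotProduct_neg, neg_eq_zero]
      have : (fun v => (w v : ℂ)) ⬝ᵥ (fun v => (b v : ℂ) * w v) = ((∑ v, b v : ℝ) : ℂ) := by
        rw [Complex.ofReal_sum]
        refine Finset.sum_congr rfl fun v _ => ?_
        linear_combination (b v : ℂ) * hw' v
      rw [this, hb, Complex.ofReal_zero]
    obtain ⟨β₀, hβ₀⟩ := exists_signedIncidence_eq o hG hε hw hadj hx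
    have hm₀ : ((fun v => (w v : ℂ)), β₀) ∈ vertexData o b ℓ l := by
      rw [hmem]
      refine ⟨fun e => ?_, hβ₀⟩
      have : (w (o.tgt e) : ℂ) = ε * w (o.src e) := by
        exact_mod_cast hadj _ _ (o.adj e).symm
      rw [this, mul_comm]
    have hspan : vertexData o b ℓ l = ℂ ∙ ((fun v => (w v : ℂ)), β₀) := by
      refine le_antisymm ?_ ((Submodule.span_singleton_le_iff_mem _ _).2 hm₀)
      rintro ⟨u, β⟩ h
      obtain ⟨a, rfl, -⟩ := hu u β h
      have h1 := Submodule.sub_mem _ h (Submodule.smul_mem _ a hm₀)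
      have h2 : (a • (fun v => (w v : ℂ)), β) - a • ((fun v => (w v : ℂ)), β₀)
          = (0, β - a • β₀) := by simp
      rw [h2] at h1
      have h3 := hβ _ h1
      rw [sub_eq_zero] at h3
      exact Submodule.mem_span_singleton.2 ⟨a, by rw [h3]; rfl⟩
    rw [hspan, finrank_span_singleton]
    intro h
    have h2 := congrFun (congrArg Prod.fst h) r
    have h3 := hw' r
    simp only [Prod.fst_zero, Pi.zero_apply] at h2
    simp [h2] at h3
  · have hbot : vertexData o b ℓ l = ⊥ := by
      rw [eq_bot_iff]
      rintro ⟨u, β⟩ h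
      obtain ⟨a, rfl, ha⟩ := hu u β h
      have ha0 : a = 0 := (mul_eq_zero.1 ha).resolve_right (by exact_mod_cast hb)
      rw [ha0, zero_smul] at h ⊢
      rw [hβ β h]
      exact Submodule.zero_mem _
    rw [hbot, finrank_bot]

end Multiplicity

/-! ### Reality of the spectrum -/

section Reality

set_option linter.unusedSectionVars false

variable {V : Type*} [Fintype V] [DecidableEq V] {G : SimpleGraph V} [DecidableRel G.Adj]
  (o : EdgeOrientation G) (b : V → ℝ) {ℓ : ℝ}

theorem sum_ite_mul_conj (f : G.edgeSet → ℂ) (s : G.edgeSet → V) (u : V → ℂ) :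
    ∑ v, (∑ e, if s e = v then f e else 0) * starRingEnd ℂ (u v)
      = ∑ e, f e * starRingEnd ℂ (u (s e)) := by
  simp only [Finset.sum_mul]
  rw [Finset.sum_comm]
  refine Finset.sum_congr rfl fun e _ => ?_
  simp [ite_mul]

/-- A Green identity: for `W = ∑ y' conj y` the vertex conditions give `W ℓ - W 0 = -∑ b |u|²`,
which is real, while the equation gives `Im W' = -Im μ ∑ |y|²`. -/
theorem eq_zero_of_mem_robinEigenspace (hℓ : 0 < ℓ) {μ : ℂ} (hμ : μ.im ≠ 0)
    {y : G.edgeSet → ℝ → ℂ} (hy : y ∈ robinEigenspace G o hℓ b μ) : y = 0 := by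
  obtain ⟨h0, h1, h2, u, hu0, hu1, hu2⟩ := hy
  have m0 : (0 : ℝ) ∈ Icc 0 ℓ := ⟨le_rfl, hℓ.le⟩
  have m1 : ℓ ∈ Icc 0 ℓ := ⟨hℓ.le, le_rfl⟩
  set g : G.edgeSet → ℝ → ℂ := fun e => edgeDeriv ℓ (y e) with hg
  set W : ℝ → ℂ := fun x => ∑ e, g e x * starRingEnd ℂ (y e x) with hW
  have hWd : ∀ x ∈ Icc 0 ℓ, HasDerivWithinAt W
      (∑ e, (-(μ * y e x) * starRingEnd ℂ (y e x) + g e x * starRingEnd ℂ (g e x)))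
      (Icc 0 ℓ) x := by
    intro x hx
    refine HasDerivWithinAt.fun_sum fun e _ => ?_
    have d1 : HasDerivWithinAt (y e) (g e x) (Icc 0 ℓ) x :=
      hasDerivWithinAt_edgeDeriv ((h1 e).differentiableOn (by norm_num)) hx
    have d2 : HasDerivWithinAt (g e) (-(μ * y e x)) (Icc 0 ℓ) x := by
      rw [← h2 e x hx, neg_neg]
      exact hasDerivWithinAt_edgeDeriv (differentiableOn_edgeDeriv hℓ (h1 e)) hx
    have d3 : HasDerivWithinAt (fun t => starRingEnd ℂ (y e t)) (starRingEnd ℂ (g e x))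
        (Icc 0 ℓ) x := d1.star
    exact d2.mul d3
  -- The factor `-Im μ` makes the derivative nonnegative for either sign of `Im μ`. A monotone
  -- function with equal end values is constant, so no integration is needed.
  set Φ : ℝ → ℝ := fun x => -μ.im * (W x).im with hΦ
  have hΦd : ∀ x ∈ Icc 0 ℓ, HasDerivWithinAt Φ (μ.im ^ 2 * ∑ e, Complex.normSq (y e x))
      (Icc 0 ℓ) x := by
    intro x hx
    have := (Complex.imCLM.hasFDerivAt.comp_hasDerivWithinAt x (hWd x hx)).const_mul (-μ.im)
    refine this.congr_deriv ?_
    rw [Complex.imCLM_apply, Complex.im_sum, Finset.mul_sum, Finset.mul_sum]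
    refine Finset.sum_congr rfl fun e _ => ?_
    have e1 : -(μ * y e x) * starRingEnd ℂ (y e x) = -(μ * (Complex.normSq (y e x) : ℂ)) := by
      rw [neg_mul, mul_assoc, Complex.mul_conj]
    rw [e1, Complex.mul_conj]
    simp
    ring
  have hmono : MonotoneOn Φ (Icc 0 ℓ) := by
    refine monotoneOn_of_hasDerivWithinAt_nonneg (convex_Icc 0 ℓ)
      (fun x hx => (hΦd x hx).continuousWithinAt)
      (fun x hx => (hΦd x (interior_subset hx)).mono interior_subset) fun x _ => ?_
    exact mul_nonneg (sq_nonneg _) (Finset.sum_nonneg fun _ _ => Complex.normSq_nonneg _)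
  have hends : Φ ℓ = Φ 0 := by
    have e1 : W ℓ - W 0 = -∑ v, (b v : ℂ) * (u v * starRingEnd ℂ (u v)) := by
      have : ∀ v, (∑ e, if o.tgt e = v then g e ℓ else 0) * starRingEnd ℂ (u v)
          - (∑ e, if o.src e = v then g e 0 else 0) * starRingEnd ℂ (u v)
          = -((b v : ℂ) * (u v * starRingEnd ℂ (u v))) := by
        intro v
        linear_combination (starRingEnd ℂ (u v)) * hu2 v
      simp only [hW, hu0, hu1]
      rw [← sum_ite_mul_conj (fun e => g e ℓ) o.tgt u,
        ← sum_ite_mul_conj (fun e => g e 0) o.src u, ← Finset.sum_sub_distrib,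
        ← Finset.sum_neg_distrib]
      exact Finset.sum_congr rfl fun v _ => this v
    have e2 : (W ℓ - W 0).im = 0 := by
      rw [e1, Complex.neg_im, Complex.im_sum, neg_eq_zero]
      refine Finset.sum_eq_zero fun v _ => ?_
      rw [Complex.mul_conj]
      simp
    rw [Complex.sub_im, sub_eq_zero] at e2
    simp only [hΦ, e2]
  have hconst : ∀ x ∈ Icc 0 ℓ, Φ x = Φ 0 := fun x hx =>
    le_antisymm ((hmono hx m1 hx.2).trans hends.le) (hmono m0 hx hx.1)
  ext e x
  by_cases hx : x ∈ Icc 0 ℓ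
  · have d0 : HasDerivWithinAt Φ 0 (Icc 0 ℓ) x :=
      (hasDerivWithinAt_const x (Icc 0 ℓ) (Φ 0)).congr hconst (hconst x hx)
    have := (uniqueDiffOn_Icc hℓ x hx).eq_deriv _ (hΦd x hx) d0
    have h3 := (mul_eq_zero.1 this).resolve_left (pow_ne_zero 2 hμ)
    rw [Finset.sum_eq_zero_iff_of_nonneg fun _ _ => Complex.normSq_nonneg _] at h3
    exact Complex.normSq_eq_zero.1 (h3 e (Finset.mem_univ e))
  · exact h0 e x hx

end Reality

/-! ### The zeros of `ψ` -/

section Roots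

set_option linter.unusedSectionVars false

variable {V : Type*} [Fintype V] [DecidableEq V] {G : SimpleGraph V} [DecidableRel G.Adj]

/-- Factoring `D^(1/2)` out on both sides of `-X D + A` shows that `ψ` is a nonzero constant times
the characteristic polynomial of the scaled matrix at `S = 0`, where `b` plays no role. -/
theorem roots_psiPoly (hd : ∀ v, 0 < G.degree v) (b : V → ℝ) :
    (psiPoly G).roots = Finset.univ.val.map fun j => branch G b j 0 := by
  have h1 : -((X : ℝ[X]) • G.degMatrix ℝ[X]) + G.adjMatrix ℝ[X]
      = Matrix.diagonal (fun v => C √(G.degree v)) * (-(scaledMatrix G b 0).charmatrix)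
        * Matrix.diagonal (fun v => C √(G.degree v)) := by
    ext1 i j
    have hi : √(G.degree i : ℝ) ≠ 0 := Real.sqrt_ne_zero'.2 (by exact_mod_cast hd i)
    have hj : √(G.degree j : ℝ) ≠ 0 := Real.sqrt_ne_zero'.2 (by exact_mod_cast hd j)
    have hP : C √(G.degree i) * C (scaledMatrix G b 0 i j) * C √(G.degree j)
        = G.adjMatrix ℝ[X] i j := by
      rw [← C_mul, ← C_mul, scaledMatrix, Matrix.mul_diagonal, Matrix.diagonal_mul, zero_smul,
        sub_zero]
      have : √(G.degree i : ℝ) * ((√(G.degree i : ℝ))⁻¹ * G.adjMatrix ℝ i j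
          * (√(G.degree j : ℝ))⁻¹) * √(G.degree j : ℝ) = G.adjMatrix ℝ i j := by
        field_simp
      rw [this, SimpleGraph.adjMatrix_apply, SimpleGraph.adjMatrix_apply]
      split_ifs <;> simp
    rw [Matrix.mul_diagonal, Matrix.diagonal_mul, Matrix.neg_apply, Matrix.charmatrix_apply,
      Matrix.add_apply, Matrix.neg_apply, Matrix.smul_apply, ← hP, SimpleGraph.degMatrix,
      smul_eq_mul]
    by_cases hij : i = j
    · subst hij
      have h2 : C √(G.degree i : ℝ) * C √(G.degree i : ℝ) = (G.degree i : ℝ[X]) := by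
        rw [← C_mul, Real.mul_self_sqrt (Nat.cast_nonneg _), map_natCast]
      rw [Matrix.diagonal_apply_eq, Matrix.diagonal_apply_eq]
      linear_combination X * h2
    · rw [Matrix.diagonal_apply_ne _ hij, Matrix.diagonal_apply_ne _ hij]
      ring
  have h2 : psiPoly G = C ((-1) ^ Fintype.card V * (∏ v, √(G.degree v : ℝ)) ^ 2)
      * (scaledMatrix G b 0).charpoly := by
    rw [psiPoly, h1, Matrix.det_mul, Matrix.det_mul, Matrix.det_neg, Matrix.det_diagonal,
      ← map_prod, Matrix.charpoly, C_mul, C_pow, C_pow, C_neg, C_1]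
    ring
  rw [h2, Polynomial.roots_C_mul, (isHermitian_scaledMatrix G b 0).roots_charpoly_eq_eigenvalues₀]
  · rfl
  · refine mul_ne_zero (pow_ne_zero _ (by norm_num)) (pow_ne_zero _ ?_)
    exact Finset.prod_ne_zero_iff.2 fun v _ => Real.sqrt_ne_zero'.2 (by exact_mod_cast hd v)

end Roots

/-! ### Separating the two extreme indices -/

section SplitFin

/-- The inclusion of the indices different from the first and the last one. -/
def Fin.middle {n : ℕ} (l : Fin (n - 2)) : Fin n := ⟨l + 1, by omega⟩

theorem Fin.sum_univ_eq_ends_add_middle {M : Type*} [AddCommMonoid M] {n : ℕ} (hn : 2 ≤ n)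
    (f : Fin n → M) :
    ∑ j, f j = f ⟨0, by omega⟩ + f (Fin.rev ⟨0, by omega⟩) + ∑ l : Fin (n - 2), f l.middle := by
  obtain ⟨m, rfl⟩ := Nat.exists_eq_add_of_le' hn
  have h1 : (Fin.last m).succ = Fin.rev ⟨0, by omega⟩ := by
    ext
    simp
  have h2 : ∑ l : Fin (m + 2 - 2), f l.middle = ∑ i : Fin m, f i.castSucc.succ := rfl
  rw [Fin.sum_univ_succ, Fin.sum_univ_castSucc, h1, h2, add_comm (∑ i : Fin m, _) _, ← add_assoc]
  rfl

theorem Fin.map_univ_eq_ends_add_middle {α : Type*} {n : ℕ} (hn : 2 ≤ n) (f : Fin n → α) :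
    Finset.univ.val.map f = {f (Fin.rev ⟨0, by omega⟩), f ⟨0, by omega⟩}
      + Finset.univ.val.map fun l : Fin (n - 2) => f l.middle := by
  have h : ∀ {m : ℕ} (g : Fin m → α), Finset.univ.val.map g = ∑ j, ({g j} : Multiset α) := by
    intro m g
    exact (Multiset.sum_map_singleton _).symm.trans (by rw [Multiset.map_map]; rfl)
  rw [h, h, Fin.sum_univ_eq_ends_add_middle hn, add_comm {f ⟨0, _⟩}, Multiset.insert_eq_cons,
    Multiset.singleton_add]

end SplitFin

/-! ### Counting zeros with multiplicity -/

section Counting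

set_option linter.unusedSectionVars false

theorem encard_setOf_eq_and (n : ℕ) (Q : Prop) [Decidable Q] :
    {k : ℕ | k = n ∧ Q}.encard = if Q then 1 else 0 := by
  split_ifs with h
  · rw [← encard_singleton n]
    congr 1
    ext k
    simp [h]
  · simp [h]

/-- Every `n` is `2 k`, or `2 k - 1` with `k ≥ 1`, for exactly one `k`. The condition `1 ≤ k`
removes the truncated value `2 * 0 - 1 = 0`, which would count gap `0` twice. -/
theorem encard_even_add_odd (n : ℕ) (Q : Prop) [Decidable Q] :
    {k : ℕ | n = 2 * k ∧ Q}.encard + {k : ℕ | 1 ≤ k ∧ n = 2 * k - 1 ∧ Q}.encard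
      = if Q then 1 else 0 := by
  rcases Nat.even_or_odd' n with ⟨m, rfl | rfl⟩
  · have h1 : {k : ℕ | 2 * m = 2 * k ∧ Q} = {k | k = m ∧ Q} := by
      ext k
      exact and_congr_left fun _ => by omega
    have h2 : {k : ℕ | 1 ≤ k ∧ 2 * m = 2 * k - 1 ∧ Q} = ∅ := by
      ext k
      simp only [mem_ofPred_eq, mem_empty_iff_false, iff_false]
      rintro ⟨h, h', -⟩
      omega
    rw [h1, h2, encard_empty, add_zero, encard_setOf_eq_and]
  · have h1 : {k : ℕ | 1 ≤ k ∧ 2 * m + 1 = 2 * k - 1 ∧ Q} = {k | k = m + 1 ∧ Q} := by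
      ext k
      simp only [mem_ofPred_eq, ← and_assoc]
      exact and_congr_left fun _ => by omega
    have h2 : {k : ℕ | 2 * m + 1 = 2 * k ∧ Q} = ∅ := by
      ext k
      simp only [mem_ofPred_eq, mem_empty_iff_false, iff_false]
      rintro ⟨h, -⟩
      omega
    rw [h1, h2, encard_empty, zero_add, encard_setOf_eq_and]

/-- Of two consecutive numbers one is even and one is odd, so each of `A` and `B` is counted once.
-/
theorem encard_adjacent (n : ℕ) (Q : ℕ → Prop) (A B : Prop) [Decidable A] [Decidable B]
    (hA : ∀ k, Even k → (Q k ↔ A)) (hB : ∀ k, Odd k → (Q k ↔ B)) :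
    {k : ℕ | (k = n ∨ k = n + 1) ∧ Q k}.encard
      = (if A then 1 else 0) + if B then 1 else 0 := by
  have h : {k : ℕ | (k = n ∨ k = n + 1) ∧ Q k} = {k | k = n ∧ Q n} ∪ {k | k = n + 1 ∧ Q (n + 1)} := by
    ext k
    simp only [mem_ofPred_eq, mem_union]
    constructor
    · rintro ⟨rfl | rfl, hq⟩
      · exact Or.inl ⟨rfl, hq⟩
      · exact Or.inr ⟨rfl, hq⟩
    · rintro (⟨rfl, hq⟩ | ⟨rfl, hq⟩)
      · exact ⟨Or.inl rfl, hq⟩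
      · exact ⟨Or.inr rfl, hq⟩
  have hdisj : Disjoint {k : ℕ | k = n ∧ Q n} {k | k = n + 1 ∧ Q (n + 1)} := by
    rw [Set.disjoint_left]
    rintro k ⟨h1, -⟩ ⟨h2, -⟩
    omega
  rw [h, encard_union_eq hdisj]
  rcases Nat.even_or_odd n with hn | hn
  · rw [hA n hn, hB (n + 1) hn.add_one, encard_setOf_eq_and, encard_setOf_eq_and]
  · rw [hB n hn, hA (n + 1) hn.add_one, encard_setOf_eq_and, encard_setOf_eq_and, add_comm]

variable {ℓ : ℝ}

theorem poleGap_unique (hℓ : 0 < ℓ) {m n : ℕ} {l : ℝ} (hm : l ∈ poleGap ℓ m)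
    (hn : l ∈ poleGap ℓ n) : m = n := by
  have key : ∀ {m n : ℕ}, l ∈ poleGap ℓ m → l ∈ poleGap ℓ n → ¬ m < n := by
    intro m n hm hn h
    have h1 := hm.2.trans_le ((pole_strictMono hℓ).monotone (Nat.succ_le_of_lt h))
    exact lt_asymm h1 (hn.1 (by omega))
  have h1 := key hm hn
  have h2 := key hn hm
  omega

theorem pole_notMem_poleGap (hℓ : 0 < ℓ) {m n : ℕ} (hn : n ≠ 0) : pole ℓ n ∉ poleGap ℓ m := by
  rintro ⟨h1, h2⟩
  have h3 := (pole_strictMono hℓ).lt_iff_lt.1 h2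
  rcases eq_or_ne m 0 with h | h
  · omega
  · have := (pole_strictMono hℓ).lt_iff_lt.1 (h1 h)
    omega

theorem pole_mem_wideGap (hℓ : 0 < ℓ) {k n : ℕ} (hn : n ≠ 0) :
    pole ℓ n ∈ wideGap ℓ k ↔ k = n := by
  rw [wideGap, mem_ofPred_eq, (pole_strictMono hℓ).lt_iff_lt, (pole_strictMono hℓ).lt_iff_lt]
  constructor
  · rintro ⟨h1, h2⟩
    by_cases h : 2 ≤ k
    · have := h1 h
      omega
    · omega
  · rintro rfl
    exact ⟨fun _ => by omega, by omega⟩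

theorem mem_wideGap_iff (hℓ : 0 < ℓ) {k n : ℕ} {l : ℝ} (hl : l ∈ poleGap ℓ n) :
    l ∈ wideGap ℓ k ↔ k = n ∨ k = n + 1 := by
  constructor
  · intro h
    rcases Nat.eq_zero_or_pos k with rfl | hk
    · exact Or.inl (poleGap_unique hℓ
        (mem_poleGap_of_mem_wideGap_of_gt h fun h => absurd rfl h) hl)
    · obtain ⟨m, rfl⟩ := Nat.exists_eq_succ_of_ne_zero hk.ne'
      rcases lt_trichotomy l (pole ℓ (m + 1)) with h1 | h1 | h1
      · have := poleGap_unique hℓ (mem_poleGap_of_mem_wideGap_of_lt h h1) hl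
        omega
      · exact absurd (h1 ▸ hl) (pole_notMem_poleGap hℓ m.succ_ne_zero)
      · have := poleGap_unique hℓ (mem_poleGap_of_mem_wideGap_of_gt h fun _ => h1) hl
        omega
  · rintro (rfl | rfl)
    · exact mem_wideGap_of_mem_poleGap hℓ hl
    · exact mem_wideGap_succ_of_mem_poleGap hℓ hl

variable {V : Type*} [Fintype V] [DecidableEq V] {G : SimpleGraph V} [DecidableRel G.Adj]
  (o : EdgeOrientation G) (b : V → ℝ)

/-- The numbering of the zeros on the branches counts every eigenvalue with its multiplicity. -/
theorem sum_encard_eq_finrank (hG : G.IsTree) (hp : 2 ≤ Fintype.card V) (hℓ : 0 < ℓ)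
    {lamOne : ℕ → ℝ} {lamPlus lamMinus : Fin (Fintype.card V - 2) → ℕ → ℝ}
    (h₁ : ∀ k μ, lamOne k = μ ↔ IsExtremeZero G b ℓ ⟨0, by omega⟩ k μ)
    (h₂ : ∀ l k μ, lamPlus l k = μ ↔ μ ∈ poleGap ℓ (2 * k) ∧
      edgeCos μ ℓ = branch G b l.middle (edgeSin μ ℓ))
    (h₃ : ∀ l k μ, lamMinus l k = μ ↔ μ ∈ poleGap ℓ (2 * k - 1) ∧
      edgeCos μ ℓ = branch G b l.middle (edgeSin μ ℓ)) (μ : ℝ) :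
    {k | lamOne k = μ}.encard + ∑ l, {k | lamPlus l k = μ}.encard
        + ∑ l, {k | 1 ≤ k ∧ lamMinus l k = μ}.encard
      = (Module.finrank ℂ (robinEigenspace G o hℓ b (μ : ℂ)) : ℕ∞) := by
  classical
  have hd := hG.degree_pos_of_two_le_card hp
  obtain ⟨σ, hσ, hadj⟩ := hG.exists_sign
  rw [finrank_robinEigenspace o b hd hℓ]
  simp only [h₁, h₂, h₃]
  rcases exists_mem_poleGap hℓ μ with ⟨n, hn⟩ | ⟨n, hn, rfl⟩
  · have hS := edgeSin_ne_zero hℓ hn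
    have hgap : ∀ m, μ ∈ poleGap ℓ m ↔ n = m := fun m =>
      ⟨fun h => poleGap_unique hℓ hn h, fun h => h ▸ hn⟩
    have hwide : ∀ k, IsExtremeZero G b ℓ ⟨0, by omega⟩ k μ ↔ (k = n ∨ k = n + 1) ∧
        (-1) ^ k * edgeCos μ ℓ = branch G b ⟨0, by omega⟩ ((-1) ^ k * edgeSin μ ℓ) := by
      intro k
      rw [IsExtremeZero, mem_wideGap_iff hℓ hn]
      refine and_congr_right fun _ => ?_
      have : ¬ (k ≠ 0 ∧ μ = pole ℓ k) := by
        rintro ⟨hk, rfl⟩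
        exact pole_notMem_poleGap hℓ hk hn
      constructor
      · rintro (h | h)
        · exact absurd ⟨h.1, h.2.1⟩ this
        · exact h.2
      · exact fun h => Or.inr ⟨this, h⟩
    rw [finrank_vertexData_eq_ker o b hS, finrank_ker_vertexMatrix b hd, Fintype.card_subtype,
      Finset.card_filter, Nat.cast_sum, Fin.sum_univ_eq_ends_add_middle hp, add_assoc,
      ← Finset.sum_add_distrib]
    congr 1
    · simp only [hwide]
      -- The gap `n` lies in the wide gaps `n` and `n + 1`. The even one of these tests the first
      -- branch, and the odd one, by the reflection symmetry, the last branch.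
      rw [encard_adjacent n _ (branch G b ⟨0, by omega⟩ (edgeSin μ ℓ) = edgeCos μ ℓ)
        (branch G b (Fin.rev ⟨0, by omega⟩) (edgeSin μ ℓ) = edgeCos μ ℓ)]
      · push_cast
        rfl
      · intro k hk
        rw [hk.neg_one_pow, one_mul, one_mul, eq_comm]
      · intro k hk
        rw [hk.neg_one_pow, branch_rev hσ hadj hd, neg_one_mul, neg_one_mul, neg_eq_iff_eq_neg,
          eq_comm]
    · refine Finset.sum_congr rfl fun l _ => ?_
      simp only [hgap]
      rw [encard_even_add_odd]
      push_cast
      exact if_congr eq_comm rfl rfl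
  -- At a pole the middle families do not contribute, and among the wide gaps only the one with
  -- index `n` contains it.
  · have h4 : ∀ k, IsExtremeZero G b ℓ ⟨0, by omega⟩ k (pole ℓ n) ↔ k = n ∧ ∑ v, b v = 0 := by
      intro k
      rw [IsExtremeZero, pole_mem_wideGap hℓ hn]
      refine and_congr_right fun h => ?_
      subst h
      simp [hn]
    simp only [h4, pole_notMem_poleGap hℓ hn, false_and, and_false, ofPred_false, encard_empty,
      Finset.sum_const_zero, add_zero]
    rw [finrank_vertexData_pole o b hG (edge_pole hℓ hn).2, encard_setOf_eq_and]
    split_ifs <;> rfl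

/-- For real `μ`, a positive multiplicity means that some index set is nonempty; non-real `μ` are
excluded beforehand. -/
theorem robinSpectrum_eq_image (hℓ : 0 < ℓ) {ι : Type*} [Fintype ι] {lamOne : ℕ → ℝ}
    {lamPlus lamMinus : ι → ℕ → ℝ}
    (h : ∀ μ : ℝ, {k | lamOne k = μ}.encard + ∑ l, {k | lamPlus l k = μ}.encard
        + ∑ l, {k | 1 ≤ k ∧ lamMinus l k = μ}.encard
      = (Module.finrank ℂ (robinEigenspace G o hℓ b (μ : ℂ)) : ℕ∞)) :
    robinSpectrum G o hℓ b = (fun x : ℝ => (x : ℂ)) ''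
      (range lamOne ∪ (⋃ l, range (lamPlus l)) ∪ ⋃ l, lamMinus l '' Ici 1) := by
  have key : ∀ x : ℝ, (x : ℂ) ∈ robinSpectrum G o hℓ b ↔
      x ∈ range lamOne ∪ (⋃ l, range (lamPlus l)) ∪ ⋃ l, lamMinus l '' Ici 1 := by
    intro x
    rw [mem_robinSpectrum_iff, ← not_iff_not, not_not, ← Nat.cast_eq_zero (R := ℕ∞), ← h x]
    simp [Set.encard_eq_zero, Set.eq_empty_iff_forall_notMem, Finset.sum_eq_zero_iff, not_or]
  ext μ
  constructor
  · intro hμ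
    have him : μ.im = 0 := by
      by_contra h0
      obtain ⟨y, hy, hy0⟩ := hμ
      exact hy0 (eq_zero_of_mem_robinEigenspace o b hℓ h0 hy)
    have hre : ((μ.re : ℝ) : ℂ) = μ := Complex.ext rfl (by simp [him])
    rw [← hre] at hμ
    exact ⟨μ.re, (key _).1 hμ, hre⟩
  · rintro ⟨x, hx, rfl⟩
    exact (key x).2 hx

end Counting

/-! ### Asymptotics of the square roots -/

section Asymptotics

set_option linter.unusedSectionVars false

variable {ℓ : ℝ}

/-- The bound `|edgeSin| ≤ 1 / √l` for `l > 0` and the growth of the poles force the limit. -/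
theorem tendsto_edgeSin_of_pole_lt (hℓ : 0 < ℓ) {s : ℕ → ℝ}
    (hs : ∀ k, 2 ≤ k → pole ℓ (k - 1) < s k) :
    Tendsto (fun k => edgeSin (s k) ℓ) atTop (𝓝 0) := by
  have h1 : Tendsto (fun k : ℕ => (ℓ / Real.pi) * (1 / ((k - 1 : ℕ) : ℝ))) atTop (𝓝 0) := by
    have : Tendsto (fun k : ℕ => 1 / ((k - 1 : ℕ) : ℝ)) atTop (𝓝 0) :=
      tendsto_one_div_atTop_nhds_zero_nat.comp (tendsto_sub_atTop_nat 1)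
    simpa using this.const_mul (ℓ / Real.pi)
  refine squeeze_zero_norm' ?_ h1
  filter_upwards [eventually_ge_atTop 2] with k hk
  have hk' : (0 : ℝ) < ((k - 1 : ℕ) : ℝ) := by
    exact_mod_cast (show 0 < k - 1 by omega)
  have hpi := Real.pi_pos
  have h2 := hs k hk
  have h3 : 0 < s k := (pole_pos hℓ (by omega)).trans h2
  rw [Real.norm_eq_abs]
  refine (abs_edgeSin_le h3 ℓ).trans ?_
  have h4 : Real.pi * ((k - 1 : ℕ) : ℝ) / ℓ ≤ √(s k) := Real.le_sqrt_of_sq_le h2.le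
  calc 1 / √(s k) ≤ 1 / (Real.pi * ((k - 1 : ℕ) : ℝ) / ℓ) :=
        one_div_le_one_div_of_le (by positivity) h4
    _ = ℓ / Real.pi * (1 / ((k - 1 : ℕ) : ℝ)) := by field_simp

theorem edgeCos_eq_cos {l : ℝ} (hl : 0 < l) (x : ℝ) : edgeCos l x = Real.cos (√l * x) := by
  conv_lhs => rw [← Real.sq_sqrt hl.le]
  exact edgeCos_sq (Real.sqrt_pos.2 hl) x

/-- A square root in a gap is determined by the value of `edgeCos`. -/
theorem sqrt_mul_eq_of_mem_poleGap_even (hℓ : 0 < ℓ) {k : ℕ} (hk : k ≠ 0) {l : ℝ}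
    (hl : l ∈ poleGap ℓ (2 * k)) :
    √l * ℓ = Real.arccos (edgeCos l ℓ) + 2 * Real.pi * k := by
  have hl0 : 0 < l := (pole_pos hℓ (n := 2 * k) (by omega)).trans (hl.1 (by omega))
  have hs := Real.sqrt_pos.2 hl0
  have h := hl
  rw [← Real.sq_sqrt hl0.le, sq_mem_poleGap hℓ hs] at h
  push_cast at h
  have e : Real.cos (√l * ℓ) = Real.cos (√l * ℓ - k * (2 * Real.pi)) :=
    (Real.cos_sub_nat_mul_two_pi _ _).symm
  rw [edgeCos_eq_cos hl0, e, Real.arccos_cos (by linarith [h.1]) (by linarith [h.2])]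
  ring

theorem sqrt_mul_eq_of_mem_poleGap_odd (hℓ : 0 < ℓ) {k : ℕ} (hk : k ≠ 0) {l : ℝ}
    (hl : l ∈ poleGap ℓ (2 * k - 1)) :
    √l * ℓ = -Real.arccos (edgeCos l ℓ) + 2 * Real.pi * k := by
  have hl0 : 0 < l := (pole_pos hℓ (n := 2 * k - 1) (by omega)).trans (hl.1 (by omega))
  have hs := Real.sqrt_pos.2 hl0
  have h := hl
  rw [← Real.sq_sqrt hl0.le, sq_mem_poleGap hℓ hs] at h
  have hc : ((2 * k - 1 : ℕ) : ℝ) = 2 * k - 1 := by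
    rw [Nat.cast_sub (by omega)]
    push_cast
    ring
  rw [hc] at h
  have e : Real.cos (√l * ℓ) = Real.cos (k * (2 * Real.pi) - √l * ℓ) :=
    (Real.cos_nat_mul_two_pi_sub _ _).symm
  rw [edgeCos_eq_cos hl0, e, Real.arccos_cos (by linarith [h.2]) (by linarith [h.1])]
  ring

/-- The wide gap only places `√l ℓ` within `π` of `k π`, on either side. The arccosine thus gives
the distance, which suffices when it tends to `0`. -/
theorem abs_sqrt_mul_sub_of_mem_wideGap (hℓ : 0 < ℓ) {k : ℕ} (hk : 2 ≤ k) {l : ℝ}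
    (hl : l ∈ wideGap ℓ k) :
    |√l * ℓ - k * Real.pi| = Real.arccos ((-1) ^ k * edgeCos l ℓ) := by
  have hpi := Real.pi_pos
  have hl0 : 0 < l := (pole_pos hℓ (n := k - 1) (by omega)).trans (hl.1 hk)
  have h1 : ((k : ℝ) - 1) * Real.pi < √l * ℓ := by
    have := Real.lt_sqrt_of_sq_lt (hl.1 hk)
    rw [div_lt_iff₀ hℓ, Nat.cast_sub (by omega)] at this
    push_cast at this
    linarith
  have h2 : √l * ℓ < ((k : ℝ) + 1) * Real.pi := by
    have := (Real.sqrt_lt' (by positivity)).2 hl.2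
    rw [lt_div_iff₀ hℓ] at this
    push_cast at this
    linarith
  rw [edgeCos_eq_cos hl0, ← Real.cos_sub_nat_mul_pi, ← Real.cos_abs, Real.arccos_cos (abs_nonneg _)]
  rw [abs_le]
  constructor <;> linarith

end Asymptotics

/-! ### Assembly of the theorem -/

theorem theorem3p1 {V : Type*} [Fintype V] [DecidableEq V] (G : SimpleGraph V)
    [DecidableRel G.Adj] (hG : G.IsTree) (hp : 2 ≤ Fintype.card V) (o : EdgeOrientation G)
    {ℓ : ℝ} (hℓ : 0 < ℓ) (b : V → ℝ) :
    -- the zeros of `ψ`, with multiplicity, are `-1`, `1` and the `z l`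
    ∃ z : Fin (Fintype.card V - 2) → ℝ,
      (psiPoly G).roots = {-1, 1} + Finset.univ.val.map z ∧
      (∀ l, z l ∈ Ioo (-1 : ℝ) 1) ∧
      -- the sequences; those in the family `lamMinus` are numbered from `k = 1` on
      ∃ (lamOne : ℕ → ℝ) (lamPlus lamMinus : Fin (Fintype.card V - 2) → ℕ → ℝ),
        -- the spectrum is the union of the sequences
        robinSpectrum G o hℓ b = (fun x : ℝ => (x : ℂ)) ''
          (range lamOne ∪ (⋃ l, range (lamPlus l)) ∪ ⋃ l, lamMinus l '' Ici 1) ∧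
        -- and every eigenvalue occurs in it as often as its multiplicity says
        (∀ μ : ℝ, {k | lamOne k = μ}.encard + ∑ l, {k | lamPlus l k = μ}.encard
            + ∑ l, {k | 1 ≤ k ∧ lamMinus l k = μ}.encard
          = (Module.finrank ℂ (robinEigenspace G o hℓ b (μ : ℂ)) : ℕ∞)) ∧
        Tendsto (fun k : ℕ => √(lamOne k) - Real.pi * k / ℓ) atTop (𝓝 0) ∧
        (∀ l, Tendsto (fun k : ℕ =>
          √(lamPlus l k) - (Real.arccos (z l) + 2 * Real.pi * k) / ℓ) atTop (𝓝 0)) ∧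
        ∀ l, Tendsto (fun k : ℕ =>
          √(lamMinus l k) - (-Real.arccos (z l) + 2 * Real.pi * k) / ℓ) atTop (𝓝 0) := by
  have hd := hG.degree_pos_of_two_le_card hp
  have := hG.connected.nonempty
  obtain ⟨σ, hσ, hadj⟩ := hG.exists_sign
  have hm : ∀ l : Fin (Fintype.card V - 2), (l.middle : ℕ) ≠ 0 ∧
      (l.middle : ℕ) + 1 ≠ Fintype.card V := fun l => by
    simp only [Fin.middle]
    omega
  have hU : ∀ (l : Fin (Fintype.card V - 2)) (n : ℕ), ∃! μ, μ ∈ poleGap ℓ n ∧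
      edgeCos μ ℓ = branch G b l.middle (edgeSin μ ℓ) := fun l n =>
    existsUnique_branch_zero hG hp hℓ (hm l).1 (hm l).2 n
  have hE := existsUnique_isExtremeZero (b := b) hG hp hℓ (j := ⟨0, by omega⟩) rfl
  choose μ hμ hμ' using hU
  choose ν hν hν' using hE
  have htop := branch_top_zero (b := b) hd (j := ⟨0, by omega⟩) rfl
  -- The zero of a middle branch in gap `n` is assigned to the plus family for `n = 2 k` and to the
  -- minus family for `n = 2 k - 1`. At `k = 0` the truncated subtraction repeats gap `0`, which is
  -- left out of the count.
  have hcount := sum_encard_eq_finrank o b hG hp hℓ (lamOne := ν)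
    (lamPlus := fun l k => μ l (2 * k)) (lamMinus := fun l k => μ l (2 * k - 1))
    (fun k x => ⟨fun h => h ▸ hν k, fun h => (hν' k x h).symm⟩)
    (fun l k x => ⟨fun h => h ▸ hμ l _, fun h => (hμ' l _ x h).symm⟩)
    (fun l k x => ⟨fun h => h ▸ hμ l _, fun h => (hμ' l _ x h).symm⟩)
  -- At a zero `edgeCos` equals the branch at `edgeSin`, and `edgeSin → 0`. Continuity of the branch
  -- and of the arccosine does the rest for both numberings `2 k` and `2 k - 1`.
  have hfinish : ∀ {l : Fin (Fintype.card V - 2)} {m : ℕ → ℕ},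
      (∀ k, 2 ≤ k → k - 1 ≤ m k ∧ m k ≠ 0) →
      Tendsto (fun k => Real.arccos (edgeCos (μ l (m k)) ℓ)) atTop
        (𝓝 (Real.arccos (branch G b l.middle 0))) := by
    intro l m hm
    simp only [(hμ l _).2]
    refine ((Real.continuous_arccos.comp (continuous_branch hd _)).tendsto 0).comp
      (tendsto_edgeSin_of_pole_lt hℓ fun k hk => ?_)
    exact ((pole_strictMono hℓ).monotone (hm k hk).1).trans_lt ((hμ l (m k)).1.1 (hm k hk).2)
  refine ⟨fun l => branch G b l.middle 0, ?_, fun l => branch_mem_Ioo hG hp (hm l).1 (hm l).2,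
    ν, fun l k => μ l (2 * k), fun l k => μ l (2 * k - 1),
    robinSpectrum_eq_image o b hℓ hcount, hcount, ?_, fun l => ?_, fun l => ?_⟩
  · rw [roots_psiPoly hd b, Fin.map_univ_eq_ends_add_middle hp, branch_rev hσ hadj hd, neg_zero,
      htop]
  · have hS : Tendsto (fun k : ℕ => (-1) ^ k * edgeSin (ν k) ℓ) atTop (𝓝 0) := by
      have h1 := tendsto_edgeSin_of_pole_lt hℓ (s := ν) fun k hk => (hν k).1.1 hk
      rw [tendsto_zero_iff_abs_tendsto_zero] at h1 ⊢
      refine h1.congr fun k => ?_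
      simp [abs_mul]
    have hlim : Tendsto (fun k : ℕ =>
        Real.arccos (branch G b ⟨0, by omega⟩ ((-1) ^ k * edgeSin (ν k) ℓ)) / ℓ) atTop (𝓝 0) := by
      have h1 := (((Real.continuous_arccos.comp
        (continuous_branch (b := b) hd ⟨0, by omega⟩)).tendsto 0).comp hS).div_const ℓ
      simp only [Function.comp_apply, htop, Real.arccos_one, zero_div] at h1
      exact h1
    refine squeeze_zero_norm' ?_ hlim
    filter_upwards [eventually_ge_atTop 2] with k hk
    have h1 := abs_sqrt_mul_sub_of_mem_wideGap hℓ hk (hν k).1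
    -- If the extreme zero is the pole itself, the branch equation still holds, since both sides
    -- equal `1`.
    have h2 : (-1) ^ k * edgeCos (ν k) ℓ
        = branch G b ⟨0, by omega⟩ ((-1) ^ k * edgeSin (ν k) ℓ) := by
      rcases (hν k).2 with ⟨hk0, h3, -⟩ | ⟨-, h3⟩
      · rw [h3, (edge_pole hℓ hk0).1, (edge_pole hℓ hk0).2, mul_zero, htop, ← mul_pow]
        simp
      · exact h3
    rw [← h2, ← h1, Real.norm_eq_abs, le_div_iff₀ hℓ]
    conv_lhs => rhs; rw [← abs_of_pos hℓ]
    rw [← abs_mul]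
    apply le_of_eq
    congr 1
    field_simp
  · have h1 := ((hfinish (l := l) (m := fun k => 2 * k) fun k hk => by omega).sub_const
      (Real.arccos (branch G b l.middle 0))).div_const ℓ
    rw [sub_self, zero_div] at h1
    refine h1.congr' ?_
    filter_upwards [eventually_ge_atTop 1] with k hk
    have h2 := sqrt_mul_eq_of_mem_poleGap_even hℓ (k := k) (by omega) (hμ l (2 * k)).1
    field_simp
    linarith
  · have h1 := ((hfinish (l := l) (m := fun k => 2 * k - 1) fun k hk => by omega).sub_const
      (Real.arccos (branch G b l.middle 0))).neg.div_const ℓ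
    rw [sub_self, neg_zero, zero_div] at h1
    refine h1.congr' ?_
    filter_upwards [eventually_ge_atTop 1] with k hk
    have h2 := sqrt_mul_eq_of_mem_poleGap_odd hℓ (k := k) (by omega) (hμ l (2 * k - 1)).1
    field_simp
    linarith
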